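/- An instance of List Coloring consists of a finite graph $G$ and, for every vertex $u$ of $G$, a finite list $L(u)$ of colors; the question is whether there is a map $f$ from the vertices to colors with $f(u)\in L(u)$ for every vertex $u$ and $f(u)\neq f(v)$ for every edge $uv$. The treedepth of $G$ is the minimum depth (number of vertices on a longest root-to-leaf path) of a rooted forest $F$ on the vertex set of $G$ such that for every edge $uv$ of $G$ one of $u,v$ is an ancestor of the other in $F$. A modulator of $G$ to treedepth at most $d$ is a set $W\subseteq V(G)$ such that $G-W$ has treedepth at most $d$. For $t\ge 1$, $\mathrm{W}[t]$ is the class of parameterized problems that, for some constant $h$, have an fpt-reduction (a reduction computable in time $f(k)\cdot n^{O(1)}$ whose output parameter is at most $g(k)$, with $f,g$ computable) to the problem, parameterized by $k$, of deciding whether a given Boolean circuit of depth at most $h$ and weft at most $t$ has a satisfying assignment with exactly $k$ true inputs; here the weft is the maximum number of gates of fan-in greater than $2$ on a directed path. Then: 1. List Coloring parameterized by the vertex cover number of $G$ is in $\mathrm{W}[2]$. 2. For every integer $d\geq 1$, List Coloring parameterized by the minimum size of a modulator of $G$ to treedepth at most $d$ is in $\mathrm{W}[2d]$. -/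

import Mathlib

namespace ParamComplexity

/-! ## Data, programs and running time

The machine model is the language of WHILE programs over binary trees (LISP data), with a
size-charged cost: every elementary operation that creates or returns a tree is charged the size
of that tree, so no operation is cheaper than writing down its result. Up to polynomial factors
this cost is the running time of a Turing machine, in both directions. -/

/-- Binary trees with unlabelled leaves: the data that programs work on. -/
inductive Data : Type where
  | nil : Data
  | cons (a b : Data) : Data

namespace Data

/-- The number of nodes of a tree. It is the length of an input, up to a constant factor. -/
def size : Data → ℕ
  | nil => 1
  | cons a b => a.size + b.size + 1

/-- The first component of a pair. -/
def fst : Data → Data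
  | nil => nil
  | cons a _ => a

/-- The second component of a pair. -/
def snd : Data → Data
  | nil => nil
  | cons _ b => b

/-- Lists of trees. -/
def ofList : List Data → Data
  | [] => nil
  | a :: l => cons a (ofList l)

/-- Bits: `0` is `nil` and `1` is `cons nil nil`. -/
def ofBool : Bool → Data
  | false => nil
  | true => cons nil nil

/-- Numbers in unary. -/
def ofUnary : ℕ → Data
  | 0 => nil
  | n + 1 => cons nil (ofUnary n)

/-- Numbers in binary, least significant bit first. -/
def ofBinary (n : ℕ) : Data :=
  ofList (n.bits.map ofBool)

theorem ofList_injective : Function.Injective ofList := by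
  intro l
  induction l with
  | nil => intro m h; cases m <;> simp_all [ofList]
  | cons a l ih =>
    intro m h
    cases m with
    | nil => simp [ofList] at h
    | cons b m =>
      simp only [ofList, cons.injEq] at h
      rw [h.1, ih h.2]

theorem ofBool_injective : Function.Injective ofBool := by
  intro a b h
  cases a <;> cases b <;> simp_all [ofBool]

theorem ofUnary_injective : Function.Injective ofUnary := by
  intro m
  induction m with
  | zero => intro n h; cases n <;> simp_all [ofUnary]
  | succ m ih =>
    intro n h
    cases n with
    | zero => simp [ofUnary] at h
    | succ n =>
      simp only [ofUnary, cons.injEq, true_and] at h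
      rw [ih h]

theorem ofBinary_injective : Function.Injective ofBinary := by
  intro m n h
  have h1 : m.bits = n.bits := ofBool_injective.list_map (ofList_injective h)
  induction m using Nat.binaryRec' generalizing n with
  | zero =>
    by_contra hn
    have : n.bits ≠ [] := by
      intro h0
      have := congrArg List.length h0
      rw [Nat.size_eq_bits_len] at this
      simp only [List.length_nil, Nat.size_eq_zero] at this
      exact hn this.symm
    exact this (by rw [← h1]; simp)
  | bit b m hb ih =>
    induction n using Nat.binaryRec' with
    | zero => rw [Nat.bits_append_bit m b hb] at h1; simp at h1
    | bit c n hc _ =>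
      rw [Nat.bits_append_bit m b hb, Nat.bits_append_bit n c hc] at h1
      simp only [List.cons.injEq] at h1
      obtain ⟨rfl, h2⟩ := h1
      rw [ih (by unfold ofBinary; rw [h2]) h2]

end Data

/-- Programs, each of which maps a tree to a tree: the identity, the constant `nil`, the two
projections, composition (`comp p q` runs `p` and then `q` on its result), pairing, branching and
loops. A tree counts as true when it is not `nil`. -/
inductive Prog : Type where
  | id : Prog
  | nil : Prog
  | fst : Prog
  | snd : Prog
  | comp (p q : Prog) : Prog
  | cons (p q : Prog) : Prog
  | ite (c p q : Prog) : Prog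
  | loop (c p : Prog) : Prog

/-- `Runs p x y n`: the program `p` on input `x` halts with output `y` after time exactly `n`. -/
inductive Runs : Prog → Data → Data → ℕ → Prop where
  | id (x : Data) : Runs .id x x x.size
  | nil (x : Data) : Runs .nil x .nil 1
  | fst (x : Data) : Runs .fst x x.fst x.fst.size
  | snd (x : Data) : Runs .snd x x.snd x.snd.size
  | comp {p q : Prog} {x y z : Data} {m n : ℕ} :
      Runs p x y m → Runs q y z n → Runs (.comp p q) x z (m + n + 1)
  | cons {p q : Prog} {x y z : Data} {m n : ℕ} :
      Runs p x y m → Runs q x z n → Runs (.cons p q) x (.cons y z) (m + n + (Data.cons y z).size)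
  | ite_true {c p q : Prog} {x b y : Data} {m n : ℕ} :
      Runs c x b m → b ≠ .nil → Runs p x y n → Runs (.ite c p q) x y (m + n + 1)
  | ite_false {c p q : Prog} {x y : Data} {m n : ℕ} :
      Runs c x .nil m → Runs q x y n → Runs (.ite c p q) x y (m + n + 1)
  | loop_done {c p : Prog} {x : Data} {m : ℕ} :
      Runs c x .nil m → Runs (.loop c p) x x (m + x.size)
  | loop_step {c p : Prog} {x b y z : Data} {m n k : ℕ} :
      Runs c x b m → b ≠ .nil → Runs p x y n → Runs (.loop c p) y z k →
        Runs (.loop c p) x z (m + n + k + 1)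

/-! ## Parameterized problems and fpt-reductions -/

/-- A parameterized decision problem: a type of instances, an unambiguous encoding of the
instances as data, the yes-instances, and the parameter of each instance. -/
structure ParamProblem where
  Inst : Type
  encode : Inst → Data
  encode_injective : Function.Injective encode
  Yes : Inst → Prop
  param : Inst → ℕ

/-- There is an fpt-reduction from `P` to `Q`: a program that maps each instance `x` of `P` with
parameter `k` to an instance `y` of `Q` with the same answer, in time `f k * |x| ^ c`, such that
the parameter of `y` is at most `g k`; here `f` and `g` are computable and `c` is a constant. -/
def FptReducible (P Q : ParamProblem) : Prop :=
  ∃ (p : Prog) (f g : ℕ → ℕ) (c : ℕ), Computable f ∧ Computable g ∧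
    ∀ x : P.Inst, ∃ (y : Q.Inst) (n : ℕ),
      Runs p (P.encode x) (Q.encode y) n ∧
      n ≤ f (P.param x) * (P.encode x).size ^ c ∧
      Q.param y ≤ g (P.param x) ∧
      (P.Yes x ↔ Q.Yes y)

/-! ## Circuits and the W-hierarchy -/

/-- A gate of a Boolean circuit, with the numbers of the gates whose values it reads. -/
inductive Gate : Type where
  | input : Gate
  | neg (i : ℕ) : Gate
  | conj (is : List ℕ) : Gate
  | disj (is : List ℕ) : Gate

namespace Gate

/-- The gates that are wired to a gate. -/
def preds : Gate → List ℕ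
  | input => []
  | neg i => [i]
  | conj is => is
  | disj is => is

/-- The value of the gate is `b` when the values of the other gates are given by `v`
(no condition for an input gate). -/
def Holds (v : ℕ → Prop) (b : Prop) : Gate → Prop
  | input => True
  | neg i => b ↔ ¬ v i
  | conj is => b ↔ ∀ i ∈ is, v i
  | disj is => b ↔ ∃ i ∈ is, v i

/-- The encoding of a gate: a tag and the numbers of its predecessors. -/
def encode : Gate → Data
  | input => .cons (.ofUnary 0) .nil
  | neg i => .cons (.ofUnary 1) (.ofUnary i)
  | conj is => .cons (.ofUnary 2) (.ofList (is.map .ofUnary))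
  | disj is => .cons (.ofUnary 3) (.ofList (is.map .ofUnary))

theorem encode_injective : Function.Injective encode := by
  intro a b h
  have key : ∀ l m : List ℕ, Data.ofList (l.map .ofUnary) = Data.ofList (m.map .ofUnary) →
      l = m := fun l m h => Data.ofUnary_injective.list_map (Data.ofList_injective h)
  cases a <;> cases b <;> simp [encode, Data.ofUnary] at h ⊢
  · exact Data.ofUnary_injective h
  · exact key _ _ h
  · exact key _ _ h

end Gate

/-- A Boolean circuit: its gates in a topological order (each gate reads only gates with smaller
numbers), and the number of the output gate. -/
structure Circuit where
  gates : List Gate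
  out : ℕ
  out_lt : out < gates.length
  preds_lt : ∀ (i : ℕ) (g : Gate), gates[i]? = some g → ∀ j ∈ g.preds, j < i

namespace Circuit

/-- There is a wire from gate `i` to gate `j`. -/
def Wire (C : Circuit) (i j : ℕ) : Prop :=
  ∃ g, C.gates[j]? = some g ∧ i ∈ g.preds

/-- A gate is large if its fan-in is greater than two. -/
def isLarge (C : Circuit) (i : ℕ) : Bool :=
  match C.gates[i]? with
  | some g => decide (2 < g.preds.length)
  | none => false

/-- Every directed path of the circuit has at most `h` edges. -/
def DepthLE (C : Circuit) (h : ℕ) : Prop :=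
  ∀ p : List ℕ, p.IsChain C.Wire → p.length ≤ h + 1

/-- Every directed path of the circuit contains at most `t` large gates. -/
def WeftLE (C : Circuit) (t : ℕ) : Prop :=
  ∀ p : List ℕ, p.IsChain C.Wire → p.countP C.isLarge ≤ t

/-- The values `v` of the gates are consistent: each gate that is not an input gate has the value
computed from its predecessors. The values of the input gates are free and determine the rest. -/
def Consistent (C : Circuit) (v : ℕ → Prop) : Prop :=
  ∀ (i : ℕ) (g : Gate), C.gates[i]? = some g → g.Holds v (v i)

/-- Some assignment that makes exactly `k` input gates true makes the output gate true. -/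
def WeightedSat (C : Circuit) (k : ℕ) : Prop :=
  ∃ v : ℕ → Prop, C.Consistent v ∧ {i | C.gates[i]? = some .input ∧ v i}.ncard = k ∧ v C.out

/-- The encoding of a circuit: the list of its gates, and the output gate. -/
def encode (C : Circuit) : Data :=
  .cons (.ofList (C.gates.map Gate.encode)) (.ofUnary C.out)

theorem encode_injective : Function.Injective encode := by
  rintro ⟨g, o, _, _⟩ ⟨g', o', _, _⟩ h
  simp only [encode, Data.cons.injEq] at h
  obtain rfl := Gate.encode_injective.list_map (Data.ofList_injective h.1)
  obtain rfl := Data.ofUnary_injective h.2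
  rfl

end Circuit

/-- An instance of weighted satisfiability for circuits of weft at most `t` and depth at most
`h`. -/
structure WCSInstance (t h : ℕ) where
  circuit : Circuit
  weft_le : circuit.WeftLE t
  depth_le : circuit.DepthLE h
  weight : ℕ

/-- Weighted circuit satisfiability for circuits of weft at most `t` and depth at most `h`:
is there a satisfying assignment of weight exactly `k`? The parameter is `k`. -/
def weightedCircuitSat (t h : ℕ) : ParamProblem where
  Inst := WCSInstance t h
  encode x := .cons x.circuit.encode (.ofUnary x.weight)
  encode_injective := by
    rintro ⟨C, _, _, k⟩ ⟨C', _, _, k'⟩ h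
    simp only [Data.cons.injEq] at h
    obtain rfl := Circuit.encode_injective h.1
    obtain rfl := Data.ofUnary_injective h.2
    rfl
  Yes x := x.circuit.WeightedSat x.weight
  param x := x.weight

/-- Membership in the class W[t]: there is an fpt-reduction to weighted satisfiability of circuits
of weft at most `t` whose depth is bounded by some constant `h`. -/
def InW (t : ℕ) (P : ParamProblem) : Prop :=
  ∃ h : ℕ, FptReducible P (weightedCircuitSat t h)

/-! ## Treedepth and modulators -/

/-- A rooted forest with vertex set `V`, given by the parent of each vertex that is not a root. -/
structure RootedForest (V : Type*) where
  parent : V → Option V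
  wf : WellFounded fun u v => parent v = some u

namespace RootedForest

variable {V : Type*}

/-- `u` is a proper ancestor of `v`. -/
def IsAncestor (F : RootedForest V) (u v : V) : Prop :=
  Relation.TransGen (fun a b => F.parent b = some a) u v

/-- The depth is at most `d`: every downward path has at most `d` vertices. -/
def DepthLE (F : RootedForest V) (d : ℕ) : Prop :=
  ∀ p : List V, p.IsChain (fun u v => F.parent v = some u) → p.length ≤ d

/-- `F` is an elimination forest of `G`: adjacent vertices are in ancestor relation. -/
def IsEliminationForest (F : RootedForest V) (G : SimpleGraph V) : Prop :=
  ∀ u v, G.Adj u v → F.IsAncestor u v ∨ F.IsAncestor v u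

end RootedForest

/-- `G` has treedepth at most `d`. -/
def TreedepthLE {V : Type*} (G : SimpleGraph V) (d : ℕ) : Prop :=
  ∃ F : RootedForest V, F.IsEliminationForest G ∧ F.DepthLE d

/-- `W` is a modulator of `G` to the class of graphs of treedepth at most `d`. -/
def IsTreedepthModulator {V : Type*} (G : SimpleGraph V) (d : ℕ) (W : Set V) : Prop :=
  TreedepthLE (G.induce Wᶜ) d

/-- The minimum size of a modulator of the finite graph `G` to treedepth at most `d`. -/
noncomputable def treedepthModulatorNum {V : Type*} [Finite V] (G : SimpleGraph V) (d : ℕ) : ℕ :=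
  sInf {k | ∃ W : Set V, IsTreedepthModulator G d W ∧ W.ncard = k}

/-! ## List Coloring -/

/-- An instance of List Coloring: a finite graph and a finite list of colors for each vertex. -/
structure ListColoringInstance where
  n : ℕ
  graph : SimpleGraph (Fin n)
  colors : Fin n → List ℕ

namespace ListColoringInstance

/-- There is a proper coloring that takes the color of each vertex from its list. -/
def Colorable (I : ListColoringInstance) : Prop :=
  ∃ f : Fin I.n → ℕ, (∀ u, f u ∈ I.colors u) ∧ ∀ u v, I.graph.Adj u v → f u ≠ f v

open Classical in
/-- The encoding of an instance: for each vertex, its row of the adjacency matrix and the list of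
its colors, written in binary. -/
noncomputable def encode (I : ListColoringInstance) : Data :=
  .ofList (List.ofFn fun u =>
    .cons (.ofList (List.ofFn fun v => .ofBool (decide (I.graph.Adj u v))))
      (.ofList ((I.colors u).map .ofBinary)))

theorem encode_injective : Function.Injective encode := by
  classical
  rintro ⟨n, G, L⟩ ⟨n', G', L'⟩ h
  have h1 := Data.ofList_injective h
  obtain rfl : n = n' := by simpa using congrArg List.length h1
  have h2 := fun u => congrFun (List.ofFn_injective h1) u
  simp only [Data.cons.injEq] at h2
  obtain rfl : G = G' := by
    ext u v
    have h3 := congrFun (List.ofFn_injective (Data.ofList_injective (h2 u).1)) v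
    simpa using Data.ofBool_injective h3
  obtain rfl : L = L' :=
    funext fun u => Data.ofBinary_injective.list_map (Data.ofList_injective (h2 u).2)
  rfl

end ListColoringInstance

/-- List Coloring with the parameter `κ`. -/
noncomputable def listColoring (κ : ListColoringInstance → ℕ) : ParamProblem where
  Inst := ListColoringInstance
  encode := ListColoringInstance.encode
  encode_injective := ListColoringInstance.encode_injective
  Yes := ListColoringInstance.Colorable
  param := κ

/-- List Coloring parameterized by the vertex cover number of the graph. -/
noncomputable def listColoringByVertexCover : ParamProblem :=
  listColoring fun I => I.graph.vertexCoverNum.toNat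

/-- List Coloring parameterized by the minimum size of a modulator of the graph to treedepth at
most `d`. -/
noncomputable def listColoringByTreedepthModulator (d : ℕ) : ParamProblem :=
  listColoring fun I => treedepthModulatorNum I.graph d

end ParamComplexity

namespace ParamComplexity

/-! ## Polynomial bounds and polynomial-time functions -/

/-! Let `d = j + 1`. A graph of treedepth more than `d` contains a set of boundedly many vertices,
at most `K` (depending on `d` only), that already induces treedepth more than `d`
(`exists_bounded_obstruction`). Greedily collecting such obstructions as long as they remain
obstructions after removal of what has been collected gives, in polynomial time, a modulator `W` of
size at most `K` times the optimum, since an optimal modulator must contain a new vertex of each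
collected obstruction.

The circuit has an input for each pair of a vertex of `W` and a color from its list, and the weight
is `|W|`. Clauses demand a true input for each vertex of `W`; with weight `|W|` this leaves exactly
one, so the admissible assignments are the colorings `f` of `W`. It remains to express by a formula
with `d` alternations AND-OR that `f` extends to `G - W`. For every component of `G - W` there must
be a color of its root, not blocked by a neighbor in `W`, such that the rest of the component can be
colored with the root color hard-wired. This costs one AND (components) and one OR (roots and
colors) per level of treedepth, because the condition that nothing blocks the color is a conjunction
that merges with the AND of the next level.

At the last level the remaining vertices are isolated, and the natural condition for a vertex is an
OR over colors of an AND over blockers, which would give one alternation too many. But `W` uses at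
most `|W|` colors, so a vertex with more than `|W|` available colors imposes no condition. Any other
vertex has at most `|W|` colors with at most `|W|` blockers each, and distributivity turns this
small OR of ANDs into an AND of at most `2 ^ (|W| ^ 2)` ORs. Hence `2 * d` layers of large gates
suffice (`eval_extensionFormula`, `weightedSat_iff`, `Leveled.weftLE`).

The only step that is not polynomial is writing the number `2 ^ (|W| ^ 2)` in unary
(`exists_pad_program`). Everything else is polynomial in the instance together with that number, so
the total time is fpt (`exists_reduction`). The statement on vertex covers is the case `d = 1`, as a
vertex cover is a modulator to treedepth 1. -/

/-- Types whose elements are represented by trees. -/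
class Enc (α : Type) where
  enc : α → Data

open Enc (enc)

/-- The size of the representation of an element. -/
def esize {α : Type} [Enc α] (a : α) : ℕ := (enc a).size

instance : Enc Data := ⟨fun a => a⟩
instance : Enc Bool := ⟨Data.ofBool⟩
instance : Enc ℕ := ⟨Data.ofUnary⟩
instance : Enc Gate := ⟨Gate.encode⟩
instance {α : Type} [Enc α] : Enc (List α) := ⟨fun l => Data.ofList (l.map enc)⟩
instance {α β : Type} [Enc α] [Enc β] : Enc (α × β) := ⟨fun p => Data.cons (enc p.1) (enc p.2)⟩

section Sizes

variable {α β : Type} [Enc α] [Enc β]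

theorem Data.one_le_size (a : Data) : 1 ≤ a.size := by
  cases a <;> simp [Data.size]

theorem one_le_esize (a : α) : 1 ≤ esize a := Data.one_le_size _

theorem esize_pair (a : α) (b : β) : esize (a, b) = esize a + esize b + 1 := rfl

@[simp] theorem esize_nil : esize ([] : List α) = 1 := rfl

@[simp] theorem esize_cons (a : α) (l : List α) : esize (a :: l) = esize a + esize l + 1 := rfl

theorem esize_append (l m : List α) : esize (l ++ m) + 1 = esize l + esize m := by
  induction l with
  | nil => simp; omega
  | cons a l ih => simp only [List.cons_append, esize_cons]; omega

theorem esize_reverse (l : List α) : esize l.reverse = esize l := by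
  induction l with
  | nil => rfl
  | cons a l ih =>
    have := esize_append l.reverse [a]
    simp only [List.reverse_cons, esize_cons, esize_nil] at *
    omega

theorem length_lt_esize (l : List α) : l.length < esize l := by
  induction l with
  | nil => simp
  | cons a l ih => simp only [List.length_cons, esize_cons]; have := one_le_esize a; omega

theorem esize_le_of_mem {a : α} {l : List α} (h : a ∈ l) : esize a < esize l := by
  induction l with
  | nil => simp at h
  | cons b l ih =>
    simp only [esize_cons]
    rcases List.mem_cons.1 h with rfl | h
    · omega
    · have := ih h; omega

theorem esize_le_of_sublist {l m : List α} (h : l.Sublist m) : esize l ≤ esize m := by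
  induction h with
  | slnil => simp
  | cons a _ ih => simp only [esize_cons]; omega
  | cons_cons a _ ih => simp only [esize_cons]; omega

theorem esize_le_of_forall {l : List α} {B : ℕ} (h : ∀ a ∈ l, esize a ≤ B) :
    esize l ≤ l.length * (B + 1) + 1 := by
  induction l with
  | nil => simp
  | cons a l ih =>
    have h1 := ih fun b hb => h b (List.mem_cons_of_mem _ hb)
    have h2 := h a List.mem_cons_self
    simp only [esize_cons, List.length_cons]
    nlinarith

@[simp] theorem enc_unary_size (n : ℕ) : (Data.ofUnary n).size = 2 * n + 1 := by
  induction n with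
  | zero => rfl
  | succ n ih => simp only [Data.ofUnary, Data.size]; omega

@[simp] theorem esize_nat (n : ℕ) : esize n = 2 * n + 1 := enc_unary_size n

theorem esize_bool (b : Bool) : esize b ≤ 3 := by cases b <;> decide

end Sizes

/-- The function `N` is bounded by a polynomial in the size of its argument. -/
def PolyBound {α : Type} [Enc α] (N : α → ℕ) : Prop :=
  ∃ c, ∀ a, N a ≤ (esize a + 1) ^ c

namespace PolyBound

variable {α β : Type} [Enc α] [Enc β] {M N : α → ℕ}

theorem mono (hN : PolyBound N) (h : ∀ a, M a ≤ N a) : PolyBound M := by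
  obtain ⟨c, hc⟩ := hN
  exact ⟨c, fun a => (h a).trans (hc a)⟩

theorem const (k : ℕ) : PolyBound (fun _ : α => k) :=
  ⟨k, fun a => (Nat.lt_two_pow_self).le.trans
    (Nat.pow_le_pow_left (by have := one_le_esize a; omega) k)⟩

theorem size : PolyBound (esize : α → ℕ) := ⟨1, fun a => by simp⟩

theorem mul (hM : PolyBound M) (hN : PolyBound N) : PolyBound (fun a => M a * N a) := by
  obtain ⟨c, hc⟩ := hM
  obtain ⟨d, hd⟩ := hN
  exact ⟨c + d, fun a => by rw [pow_add]; exact Nat.mul_le_mul (hc a) (hd a)⟩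

theorem add (hM : PolyBound M) (hN : PolyBound N) : PolyBound (fun a => M a + N a) := by
  obtain ⟨c, hc⟩ := hM
  obtain ⟨d, hd⟩ := hN
  refine ⟨c + d + 1, fun a => ?_⟩
  have h1 := one_le_esize a
  have h2 : (esize a + 1) ^ c ≤ (esize a + 1) ^ (c + d) :=
    Nat.pow_le_pow_right (by omega) (by omega)
  have h3 : (esize a + 1) ^ d ≤ (esize a + 1) ^ (c + d) :=
    Nat.pow_le_pow_right (by omega) (by omega)
  have h4 := hc a
  have h5 := hd a
  rw [pow_succ]
  nlinarith

theorem pow (hM : PolyBound M) (k : ℕ) : PolyBound (fun a => M a ^ k) := by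
  obtain ⟨c, hc⟩ := hM
  exact ⟨c * k, fun a => by rw [pow_mul]; exact Nat.pow_le_pow_left (hc a) k⟩

theorem comp {N : β → ℕ} (hN : PolyBound N) {f : α → β} (hf : PolyBound fun a => esize (f a)) :
    PolyBound (fun a => N (f a)) := by
  obtain ⟨c, hc⟩ := hN
  exact ((hf.add (const 1)).pow c).mono fun a => hc (f a)

end PolyBound

/-- Each operation is charged at least the size of its result. Thus a time bound is also a bound on
the output size, which is what allows polynomial time bounds to be composed. -/
theorem Runs.size_le {p : Prog} {x y : Data} {n : ℕ} (h : Runs p x y n) : y.size ≤ n := by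
  induction h <;> (try simp only [Data.size] at *) <;> omega

/-- The function is computed by a program in polynomial time. -/
def PolyTime {α β : Type} [Enc α] [Enc β] (f : α → β) : Prop :=
  ∃ (p : Prog) (N : α → ℕ), PolyBound N ∧ ∀ a, ∃ n, Runs p (enc a) (enc (f a)) n ∧ n ≤ N a

/-! ### Closure of polynomial-time functions under composition, pairing and branching -/

namespace PolyTime

section Basic

variable {α β γ δ : Type} [Enc α] [Enc β] [Enc γ] [Enc δ]

theorem size {f : α → β} (hf : PolyTime f) : PolyBound (fun a => esize (f a)) := by
  obtain ⟨p, N, hN, h⟩ := hf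
  refine hN.mono fun a => ?_
  obtain ⟨n, h1, h2⟩ := h a
  exact h1.size_le.trans h2

/-- Programs see only the trees, so the same program serves every function with the same encoded
values. This moves results freely between types such as lists, unary numbers, gates and formulas. -/
theorem of_enc_eq {f : α → β} {g : α → γ} (hf : PolyTime f) (h : ∀ a, enc (f a) = enc (g a)) :
    PolyTime g := by
  obtain ⟨p, N, hN, hp⟩ := hf
  exact ⟨p, N, hN, fun a => by rw [← h]; exact hp a⟩

protected theorem id : PolyTime (fun a : α => a) :=
  ⟨.id, esize, .size, fun _ => ⟨_, .id _, le_rfl⟩⟩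

theorem comp {g : β → γ} {f : α → β} (hg : PolyTime g) (hf : PolyTime f) :
    PolyTime (fun a => g (f a)) := by
  obtain ⟨q, M, hM, hq⟩ := hg
  have hs := hf.size
  obtain ⟨p, N, hN, hp⟩ := hf
  refine ⟨.comp p q, fun a => N a + M (f a) + 1, (hN.add (hM.comp hs)).add (.const 1),
    fun a => ?_⟩
  obtain ⟨m, h1, h2⟩ := hp a
  obtain ⟨n, h3, h4⟩ := hq (f a)
  exact ⟨_, .comp h1 h3, by dsimp only; omega⟩

theorem pair {f : α → β} {g : α → γ} (hf : PolyTime f) (hg : PolyTime g) :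
    PolyTime (fun a => (f a, g a)) := by
  have hs := hf.size
  have ht := hg.size
  obtain ⟨q, M, hM, hq⟩ := hg
  obtain ⟨p, N, hN, hp⟩ := hf
  refine ⟨.cons p q, fun a => N a + M a + (esize (f a) + esize (g a) + 1),
    (hN.add hM).add ((hs.add ht).add (.const 1)), fun a => ?_⟩
  obtain ⟨m, h1, h2⟩ := hp a
  obtain ⟨n, h3, h4⟩ := hq a
  refine ⟨_, .cons h1 h3, ?_⟩
  simp only [Data.size, esize]
  omega

theorem cons {f : α → β} {g : α → List β} (hf : PolyTime f) (hg : PolyTime g) :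
    PolyTime (fun a => f a :: g a) :=
  (hf.pair hg).of_enc_eq fun _ => rfl

theorem dataCons {f : α → Data} {g : α → Data} (hf : PolyTime f) (hg : PolyTime g) :
    PolyTime (fun a => Data.cons (f a) (g a)) :=
  (hf.pair hg).of_enc_eq fun _ => rfl

theorem dataFst : PolyTime Data.fst := by
  refine ⟨.fst, esize, .size, fun a => ⟨_, .fst _, ?_⟩⟩
  cases a <;> simp [Data.fst, esize, enc, Data.size]
  omega

theorem dataSnd : PolyTime Data.snd := by
  refine ⟨.snd, esize, .size, fun a => ⟨_, .snd _, ?_⟩⟩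
  cases a <;> simp [Data.snd, esize, enc, Data.size]
  omega

theorem toEnc : PolyTime (fun a : α => enc a) :=
  PolyTime.id.of_enc_eq fun _ => rfl

theorem fst {f : α → β × γ} (hf : PolyTime f) : PolyTime (fun a => (f a).1) :=
  ((dataFst.comp toEnc).comp hf).of_enc_eq fun _ => rfl

theorem snd {f : α → β × γ} (hf : PolyTime f) : PolyTime (fun a => (f a).2) :=
  ((dataSnd.comp toEnc).comp hf).of_enc_eq fun _ => rfl

theorem const (b : β) : PolyTime (fun _ : α => b) := by
  suffices H : ∀ d : Data, PolyTime (fun _ : α => d) from (H (enc b)).of_enc_eq fun _ => rfl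
  intro d
  induction d with
  | nil => exact ⟨.nil, fun _ => 1, .const 1, fun _ => ⟨1, .nil _, le_rfl⟩⟩
  | cons a b iha ihb => exact iha.dataCons ihb

theorem tail {f : α → List β} (hf : PolyTime f) : PolyTime (fun a => (f a).tail) := by
  refine ((dataSnd.comp toEnc).comp hf).of_enc_eq fun a => ?_
  cases h : f a <;> simp [enc, Data.ofList, Data.snd]

theorem ite {c : α → Bool} {f g : α → β} (hc : PolyTime c) (hf : PolyTime f) (hg : PolyTime g) :
    PolyTime (fun a => if c a = true then f a else g a) := by
  obtain ⟨r, K, hK, hr⟩ := hc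
  obtain ⟨q, M, hM, hq⟩ := hg
  obtain ⟨p, N, hN, hp⟩ := hf
  refine ⟨.ite r p q, fun a => K a + (N a + M a) + 1, (hK.add (hN.add hM)).add (.const 1),
    fun a => ?_⟩
  obtain ⟨k, h1, h2⟩ := hr a
  obtain ⟨m, h3, h4⟩ := hp a
  obtain ⟨n, h5, h6⟩ := hq a
  cases h : c a
  · rw [h] at h1
    exact ⟨_, .ite_false h1 (by simpa [h] using h5), by dsimp only; omega⟩
  · rw [h] at h1
    exact ⟨_, .ite_true h1 (by simp [enc, Data.ofBool]) (by simpa [h] using h3), by dsimp only; omega⟩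

/-- Branching on whether the tree that represents an element is `nil`. -/
theorem iteNil {l : α → Data} {f g : α → β} (hl : PolyTime l) (hf : PolyTime f)
    (hg : PolyTime g) : PolyTime (fun a => match l a with | .nil => g a | .cons _ _ => f a) := by
  obtain ⟨r, K, hK, hr⟩ := hl
  obtain ⟨q, M, hM, hq⟩ := hg
  obtain ⟨p, N, hN, hp⟩ := hf
  refine ⟨.ite r p q, fun a => K a + (N a + M a) + 1, (hK.add (hN.add hM)).add (.const 1),
    fun a => ?_⟩
  obtain ⟨k, h1, h2⟩ := hr a
  obtain ⟨m, h3, h4⟩ := hp a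
  obtain ⟨n, h5, h6⟩ := hq a
  cases h : l a
  · rw [h] at h1
    exact ⟨_, .ite_false h1 (by simpa [h] using h5), by dsimp only; omega⟩
  · rw [h] at h1
    exact ⟨_, .ite_true h1 (by simp [enc]) (by simpa [h] using h3), by dsimp only; omega⟩

theorem headD {f : α → List β} {d : α → β} (hf : PolyTime f) (hd : PolyTime d) :
    PolyTime (fun a => (f a).headD (d a)) := by
  refine (iteNil (toEnc.comp hf) (dataFst.comp (toEnc.comp hf)) (toEnc.comp hd)).of_enc_eq
    fun a => ?_
  cases h : f a <;> simp [enc, Data.ofList, Data.fst]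

theorem isEmpty {f : α → List β} (hf : PolyTime f) : PolyTime (fun a => (f a).isEmpty) := by
  refine (iteNil (toEnc.comp hf) (const false) (const true)).of_enc_eq fun a => ?_
  cases h : f a <;> simp [enc, Data.ofList]

theorem and {c d : α → Bool} (hc : PolyTime c) (hd : PolyTime d) :
    PolyTime (fun a => c a && d a) :=
  (hc.ite hd (const false)).of_enc_eq fun a => by cases h : c a <;> simp

theorem or {c d : α → Bool} (hc : PolyTime c) (hd : PolyTime d) :
    PolyTime (fun a => c a || d a) :=
  (hc.ite (const true) hd).of_enc_eq fun a => by cases h : c a <;> simp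

theorem not {c : α → Bool} (hc : PolyTime c) : PolyTime (fun a => !c a) :=
  (hc.ite (const false) (const true)).of_enc_eq fun a => by cases h : c a <;> simp

theorem succ {f : α → ℕ} (hf : PolyTime f) : PolyTime (fun a => f a + 1) :=
  ((const Data.nil).dataCons (toEnc.comp hf)).of_enc_eq fun _ => rfl

theorem pred {f : α → ℕ} (hf : PolyTime f) : PolyTime (fun a => f a - 1) := by
  refine (dataSnd.comp (toEnc.comp hf)).of_enc_eq fun a => ?_
  cases h : f a <;> simp [enc, Data.ofUnary, Data.snd]

end Basic

/-! ### Loops over lists -/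

section Fold

variable {α β γ σ : Type} [Enc α] [Enc β] [Enc γ] [Enc σ]

/-- The program of a loop over a list: from `(g, l, s)`, it passes through all `(g, l', s')`. -/
def foldProg (p : Prog) : Prog :=
  .loop (.comp .snd .fst)
    (.cons .fst (.cons (.comp .snd (.comp .fst .snd))
      (.comp (.cons (.cons .fst (.comp .snd (.comp .fst .fst))) (.comp .snd .snd)) p)))

/-- The bound `T` on the time of one step and the bound `B` on the size of the state are needed only
along the states that actually occur. The factor 20 pays for the bounded number of copies of `g`, of
the list and of the state in one round of the loop. -/
theorem foldProg_runs {p : Prog} (g : γ) (l : List α) (f : σ → α → σ) (s : σ)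
    (T B : ℕ)
    (hp : ∀ l₁ a l₂, l = l₁ ++ a :: l₂ → ∃ n,
      Runs p (enc ((g, a), l₁.foldl f s)) (enc (f (l₁.foldl f s) a)) n ∧ n ≤ T)
    (hB : ∀ l₁ l₂, l = l₁ ++ l₂ → esize (l₁.foldl f s) ≤ B) :
    ∃ n, Runs (foldProg p) (enc (g, l, s)) (enc (g, ([] : List α), l.foldl f s)) n ∧
      n ≤ (l.length + 1) * (T + 20 * (esize g + esize l + B) + 20) := by
  induction l generalizing s with
  | nil =>
    refine ⟨_, .loop_done (m := _) (.comp (.snd _) (.fst _)), ?_⟩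
    have h1 := hB [] [] rfl
    simp only [List.foldl_nil, Data.snd, Data.fst, Data.ofList, Data.size, enc, esize,
      List.map_nil, List.length_nil] at *
    omega
  | cons a l ih =>
    obtain ⟨n, h1, h2⟩ := hp [] a l rfl
    obtain ⟨k, h3, h4⟩ := ih (f s a)
      (fun l₁ b l₂ h => by simpa using hp (a :: l₁) b l₂ (by simp [h]))
      (fun l₁ l₂ h => by simpa using hB (a :: l₁) l₂ (by simp [h]))
    have h5 := hB [] _ rfl
    have h6 := hB [a] l rfl
    simp only [List.foldl_cons, List.foldl_nil] at h1 h5 h6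
    refine ⟨_, .loop_step (b := .cons (enc a) (enc l)) (y := enc (g, l, f s a))
      (.comp (.snd _) (.fst _)) (by simp)
      (.cons (.fst _) (.cons (.comp (.snd _) (.comp (.fst _) (.snd _)))
        (.comp (.cons (.cons (.fst _) (.comp (.snd _) (.comp (.fst _) (.fst _))))
          (.comp (.snd _) (.snd _))) h1))) h3, ?_⟩
    have h7 : (l.length + 1) * (T + 20 * (esize g + esize l + B) + 20) ≤
      (l.length + 1) * (T + 20 * (esize g + (esize a + esize l + 1) + B) + 20) :=
      Nat.mul_le_mul_left _ (by omega)
    rw [List.length_cons, esize_cons, Nat.add_mul (l.length + 1) 1, one_mul]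
    have h8 := one_le_esize a
    have h9 := one_le_esize s
    have h10 := one_le_esize g
    simp only [Data.snd, Data.fst, Data.ofList, Data.size, esize, enc, List.map_cons] at *
    omega

/-- A polynomial-time step may double the size of the state, so folding preserves polynomial time
only if the intermediate states stay polynomially bounded; `S` is that bound. -/
theorem foldl {f : γ → σ → α → σ} {l : γ → List α} {init : γ → σ} {S : γ → ℕ}
    (hf : PolyTime (fun p : (γ × α) × σ => f p.1.1 p.2 p.1.2)) (hl : PolyTime l)
    (hi : PolyTime init) (hS : PolyBound S)
    (hB : ∀ g l₁ l₂, l g = l₁ ++ l₂ → esize (l₁.foldl (f g) (init g)) ≤ S g) :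
    PolyTime (fun g => (l g).foldl (f g) (init g)) := by
  have hls := hl.size
  obtain ⟨p, N, ⟨c, hc⟩, hp⟩ := hf
  have hrun : PolyTime (β := γ × List α × σ)
      (fun g => (g, ([] : List α), (l g).foldl (f g) (init g))) := by
    obtain ⟨q, M, hM, hq⟩ := (PolyTime.id.pair (hl.pair hi))
    refine ⟨.comp q (foldProg p), fun g => M g + esize (l g) *
      ((esize g + esize (l g) + S g + 3) ^ c + 20 * (esize g + esize (l g) + S g) + 20) + 1,
      ?_, fun g => ?_⟩
    · have h1 := (PolyBound.size.add hls).add hS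
      exact (hM.add (hls.mul ((((h1.add (.const 3)).pow c).add ((PolyBound.const 20).mul h1)).add
        (.const 20)))).add (.const 1)
    obtain ⟨m, h1, h2⟩ := hq g
    obtain ⟨k, h3, h4⟩ := foldProg_runs (p := p) g (l g) (f g) (init g)
      ((esize g + esize (l g) + S g + 3) ^ c) (S g) (fun l₁ a l₂ h => by
        obtain ⟨n, h1, h2⟩ := hp ((g, a), l₁.foldl (f g) (init g))
        refine ⟨n, h1, h2.trans ((hc _).trans (Nat.pow_le_pow_left ?_ c))⟩
        have h3 := hB g l₁ (a :: l₂) h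
        have h4 : esize a < esize (l g) := esize_le_of_mem (by simp [h])
        simp only [esize_pair]
        omega) (hB g)
    refine ⟨_, .comp h1 h3, ?_⟩
    have h5 : ((l g).length + 1) *
        ((esize g + esize (l g) + S g + 3) ^ c + 20 * (esize g + esize (l g) + S g) + 20) ≤
        esize (l g) *
        ((esize g + esize (l g) + S g + 3) ^ c + 20 * (esize g + esize (l g) + S g) + 20) :=
      Nat.mul_le_mul_right _ (length_lt_esize _)
    dsimp only
    omega
  exact hrun.snd.snd

theorem replicateNil {n : γ → ℕ} (hn : PolyTime n) :
    PolyTime (fun g => List.replicate (n g) Data.nil) := by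
  refine hn.of_enc_eq fun g => ?_
  induction n g with
  | zero => rfl
  | succ n ih => simpa [enc, Data.ofUnary, Data.ofList, List.replicate_succ] using ih

end Fold
end PolyTime

end ParamComplexity

namespace ParamComplexity
open Enc (enc)

/-! ### List operations and unary arithmetic in polynomial time -/

namespace PolyTime

variable {α β γ δ σ : Type} [Enc α] [Enc β] [Enc γ] [Enc δ] [Enc σ]

/-- An entry is smaller than the list that contains it, so one polynomial bounds the images of all
entries. It supplies the state bound for `map`. -/
theorem polyBound_mem {f : γ → α → β} {l : γ → List α}
    (hf : PolyTime (fun p : γ × α => f p.1 p.2)) (hl : PolyBound fun g => esize (l g)) :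
    ∃ S, PolyBound S ∧ ∀ g, ∀ a ∈ l g, esize (f g a) ≤ S g := by
  obtain ⟨c, hc⟩ := hf.size
  refine ⟨fun g => (esize g + esize (l g) + 2) ^ c,
    ((PolyBound.size.add hl).add (.const 2)).pow c, fun g a ha => ?_⟩
  refine (hc (g, a)).trans (Nat.pow_le_pow_left ?_ c)
  have := esize_le_of_mem ha
  simp only [esize_pair]
  omega

theorem reverse {l : γ → List α} (hl : PolyTime l) : PolyTime (fun g => (l g).reverse) := by
  have h : PolyTime (fun g => (l g).foldl (fun acc a => a :: acc) []) := by
    refine foldl (f := fun _ acc a => a :: acc) (S := fun g => esize (l g))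
      (PolyTime.id.fst.snd.cons PolyTime.id.snd) hl (const []) hl.size fun g l₁ l₂ h => ?_
    have : l₁.foldl (fun acc a => a :: acc) [] = l₁.reverse := by simp
    rw [this, esize_reverse, h]
    exact esize_le_of_sublist (List.sublist_append_left _ _)
  simpa using h

theorem map {f : γ → α → β} {l : γ → List α} (hf : PolyTime (fun p : γ × α => f p.1 p.2))
    (hl : PolyTime l) : PolyTime (fun g => (l g).map (f g)) := by
  obtain ⟨S, hS, hSf⟩ := polyBound_mem hf hl.size
  have e : ∀ g (l : List α), l.foldl (fun acc a => f g a :: acc) [] = (l.map (f g)).reverse := by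
    suffices H : ∀ g (l : List α) acc, l.foldl (fun acc a => f g a :: acc) acc =
        (l.map (f g)).reverse ++ acc from fun g l => by rw [H, List.append_nil]
    intro g l
    induction l with
    | nil => simp
    | cons a l ih => simp [ih]
  have h : PolyTime (fun g => (l g).foldl (fun acc a => f g a :: acc) []) := by
    refine foldl (f := fun g acc a => f g a :: acc)
      (S := fun g => esize (l g) * (S g + 1) + 1)
      ((hf.comp PolyTime.id.fst).cons PolyTime.id.snd) hl (const [])
      ((hl.size.mul (hS.add (.const 1))).add (.const 1)) fun g l₁ l₂ h => ?_
    rw [e, esize_reverse]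
    refine (esize_le_of_forall (B := S g) ?_).trans ?_
    · intro b hb
      obtain ⟨a, ha, rfl⟩ := List.mem_map.1 hb
      exact hSf g a (by simp [h, ha])
    · have h1 := length_lt_esize (l g)
      rw [h] at h1
      rw [List.length_append] at h1
      rw [List.length_map, h]
      gcongr
      omega
  have := h.reverse
  simpa only [e, List.reverse_reverse] using this

theorem append {l m : γ → List α} (hl : PolyTime l) (hm : PolyTime m) :
    PolyTime (fun g => l g ++ m g) := by
  have e : ∀ l m : List α, l.foldl (fun acc a => a :: acc) m = l.reverse ++ m := by
    intro l m
    simp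
  have h : PolyTime (fun g => (l g).reverse.foldl (fun acc a => a :: acc) (m g)) := by
    refine foldl (f := fun _ acc a => a :: acc) (S := fun g => esize (l g) + esize (m g))
      (PolyTime.id.fst.snd.cons PolyTime.id.snd) hl.reverse hm (hl.size.add hm.size)
      fun g l₁ l₂ h => ?_
    have h1 := esize_append l₁.reverse (m g)
    have h2 := esize_append l₁ l₂
    rw [← h, esize_reverse] at h2
    rw [esize_reverse] at h1
    have h3 := one_le_esize l₂
    rw [e]
    omega
  simpa only [e, List.reverse_reverse] using h

theorem esize_flatten (l : List (List α)) : esize l.flatten ≤ esize l := by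
  induction l with
  | nil => simp
  | cons a l ih =>
    have := esize_append a l.flatten
    simp only [List.flatten_cons, esize_cons]
    omega

theorem flatten {l : γ → List (List α)} (hl : PolyTime l) :
    PolyTime (fun g => (l g).flatten) := by
  have e : ∀ l : List (List α), l.foldl (fun acc a => acc ++ a) [] = l.flatten := by
    suffices H : ∀ (l : List (List α)) acc, l.foldl (fun acc a => acc ++ a) acc =
        acc ++ l.flatten from fun l => by rw [H, List.nil_append]
    intro l
    induction l with
    | nil => simp
    | cons a l ih => simp [ih]
  have h : PolyTime (fun g => (l g).foldl (fun acc a => acc ++ a) []) := by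
    refine foldl (f := fun _ acc a => acc ++ a) (S := fun g => esize (l g))
      (PolyTime.id.snd.append PolyTime.id.fst.snd) hl (const []) hl.size fun g l₁ l₂ h => ?_
    rw [e, h]
    exact (esize_flatten _).trans (esize_le_of_sublist (List.sublist_append_left _ _))
  simpa only [e] using h

theorem flatMap {f : γ → α → List β} {l : γ → List α}
    (hf : PolyTime (fun p : γ × α => f p.1 p.2)) (hl : PolyTime l) :
    PolyTime (fun g => (l g).flatMap (f g)) :=
  (hf.map hl).flatten

theorem filter {f : γ → α → Bool} {l : γ → List α}
    (hf : PolyTime (fun p : γ × α => f p.1 p.2)) (hl : PolyTime l) :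
    PolyTime (fun g => (l g).filter (f g)) := by
  have h : PolyTime (fun g => (l g).flatMap fun a => if f g a = true then [a] else []) :=
    flatMap (f := fun g a => if f g a = true then [a] else [])
      (hf.ite (PolyTime.id.snd.cons (const [])) (const [])) hl
  refine h.of_enc_eq fun g => ?_
  congr 1
  induction l g with
  | nil => rfl
  | cons a l ih => cases h : f g a <;> simp [h, ih]

theorem any {f : γ → α → Bool} {l : γ → List α}
    (hf : PolyTime (fun p : γ × α => f p.1 p.2)) (hl : PolyTime l) :
    PolyTime (fun g => (l g).any (f g)) := by
  refine (hf.filter hl).isEmpty.not.of_enc_eq fun g => ?_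
  congr 1
  induction l g with
  | nil => rfl
  | cons a l ih => cases h : f g a <;> simp_all

theorem all {f : γ → α → Bool} {l : γ → List α}
    (hf : PolyTime (fun p : γ × α => f p.1 p.2)) (hl : PolyTime l) :
    PolyTime (fun g => (l g).all (f g)) :=
  (any (f := fun g a => !f g a) hf.not hl).not.of_enc_eq fun g => by
    rw [List.any_eq_not_all_not]; simp

theorem length {l : γ → List α} (hl : PolyTime l) : PolyTime (fun g => (l g).length) := by
  refine (map (f := fun _ _ => Data.nil) (const _) hl).of_enc_eq fun g => ?_
  induction l g with
  | nil => rfl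
  | cons a l ih => simpa [enc, Data.ofList, Data.ofUnary] using ih

/-- A unary number is, as a tree, a list of copies of `nil`, so iteration is a fold that ignores the
entries. -/
theorem iterate {f : γ → σ → σ} {n : γ → ℕ} {init : γ → σ} {S : γ → ℕ}
    (hf : PolyTime (fun p : γ × σ => f p.1 p.2)) (hn : PolyTime n)
    (hi : PolyTime init) (hS : PolyBound S)
    (hB : ∀ g i, i ≤ n g → esize ((f g)^[i] (init g)) ≤ S g) :
    PolyTime (fun g => (f g)^[n g] (init g)) := by
  have e : ∀ g s (l : List Data), l.foldl (fun s _ => f g s) s = (f g)^[l.length] s := by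
    intro g s l
    induction l generalizing s with
    | nil => rfl
    | cons a l ih => simp [ih]
  have h : PolyTime
      (fun g => (List.replicate (n g) Data.nil).foldl (fun s _ => f g s) (init g)) := by
    refine foldl (f := fun g s _ => f g s) (hf.comp (PolyTime.id.fst.fst.pair PolyTime.id.snd))
      hn.replicateNil hi hS fun g l₁ l₂ h => ?_
    rw [e]
    apply hB
    have := congrArg List.length h
    simp at this
    omega
  simpa only [e, List.length_replicate] using h

theorem natAdd {m n : γ → ℕ} (hm : PolyTime m) (hn : PolyTime n) :
    PolyTime (fun g => m g + n g) := by
  have e : ∀ k i : ℕ, (fun j => j + 1)^[i] k = k + i := by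
    intro k i
    induction i with
    | zero => rfl
    | succ i ih => rw [Function.iterate_succ_apply', ih]; rfl
  have h := iterate (f := fun _ j => j + 1) (S := fun g => esize (m g) + esize (n g))
    PolyTime.id.snd.succ hn hm (hm.size.add hn.size) fun g i hi => by
      rw [e]; simp only [esize_nat]; omega
  simpa only [e] using h

theorem natSub {m n : γ → ℕ} (hm : PolyTime m) (hn : PolyTime n) :
    PolyTime (fun g => m g - n g) := by
  have e : ∀ k i : ℕ, (fun j => j - 1)^[i] k = k - i := by
    intro k i
    induction i with
    | zero => rfl
    | succ i ih => rw [Function.iterate_succ_apply', ih]; omega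
  have h := iterate (f := fun _ j => j - 1) (S := fun g => esize (m g))
    PolyTime.id.snd.pred hn hm hm.size fun g i hi => by
      rw [e]; simp only [esize_nat]; omega
  simpa only [e] using h

theorem isZero {m : γ → ℕ} (hm : PolyTime m) : PolyTime (fun g => decide (m g = 0)) := by
  refine (iteNil (toEnc.comp hm) (const false) (const true)).of_enc_eq fun g => ?_
  cases h : m g <;> simp [enc, Data.ofUnary]

theorem natLe {m n : γ → ℕ} (hm : PolyTime m) (hn : PolyTime n) :
    PolyTime (fun g => decide (m g ≤ n g)) :=
  (hm.natSub hn).isZero.of_enc_eq fun g => by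
    congr 2
    exact propext Nat.sub_eq_zero_iff_le

theorem drop {n : γ → ℕ} {l : γ → List α} (hn : PolyTime n) (hl : PolyTime l) :
    PolyTime (fun g => (l g).drop (n g)) := by
  have e : ∀ (l : List α) i, List.tail^[i] l = l.drop i := by
    intro l i
    induction i with
    | zero => rfl
    | succ i ih => rw [Function.iterate_succ_apply', ih]; simp
  have h := iterate (f := fun _ => List.tail) (S := fun g => esize (l g))
    PolyTime.id.snd.tail hn hl hl.size fun g i hi => by
      rw [e]; exact esize_le_of_sublist (List.drop_sublist _ _)
  simpa only [e] using h

theorem take {n : γ → ℕ} {l : γ → List α} (hn : PolyTime n) (hl : PolyTime l) :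
    PolyTime (fun g => (l g).take (n g)) := by
  refine (drop (hl.length.natSub hn) hl.reverse).reverse.of_enc_eq fun g => ?_
  rw [List.drop_reverse, List.reverse_reverse]
  congr 1
  rw [List.take_eq_take_iff]
  omega

theorem getD {n : γ → ℕ} {l : γ → List α} {d : γ → α} (hl : PolyTime l) (hn : PolyTime n)
    (hd : PolyTime d) : PolyTime (fun g => (l g).getD (n g) (d g)) := by
  refine (headD (drop hn hl) hd).of_enc_eq fun g => ?_
  rw [List.headD_eq_head?_getD, List.head?_drop, List.getD_eq_getElem?_getD]

theorem range {n : γ → ℕ} (hn : PolyTime n) : PolyTime (fun g => List.range (n g)) := by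
  have e : ∀ i, (fun l : List ℕ => l ++ [l.length])^[i] [] = List.range i := by
    intro i
    induction i with
    | zero => rfl
    | succ i ih => rw [Function.iterate_succ_apply', ih, List.range_succ]; simp
  have h := iterate (f := fun _ (l : List ℕ) => l ++ [l.length]) (init := fun _ => [])
    (S := fun g => esize (n g) * (esize (n g) + 1) + 1)
    (PolyTime.id.snd.append (PolyTime.id.snd.length.cons (const []))) hn (const [])
    ((hn.size.mul (hn.size.add (.const 1))).add (.const 1)) fun g i hi => by
      rw [e]
      refine (esize_le_of_forall (B := esize (n g)) ?_).trans ?_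
      · intro b hb
        simp only [List.mem_range] at hb
        simp only [esize_nat]
        omega
      · rw [List.length_range]
        gcongr
        rw [esize_nat]
        omega
  simpa only [e] using h

end PolyTime

/-! ### Equality tests and removal of repetitions -/

/-- Types in which equality can be decided in polynomial time. -/
class PolyEq (α : Type) [Enc α] [DecidableEq α] : Prop where
  polyTime : PolyTime (fun p : α × α => decide (p.1 = p.2))

namespace PolyTime

variable {α β γ δ σ : Type} [Enc α] [Enc β] [Enc γ] [Enc δ] [Enc σ]

theorem eq [DecidableEq α] [PolyEq α] {f g : γ → α} (hf : PolyTime f) (hg : PolyTime g) :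
    PolyTime (fun a => decide (f a = g a)) :=
  PolyEq.polyTime.comp (hf.pair hg)

theorem mem [DecidableEq α] [PolyEq α] {f : γ → α} {l : γ → List α} (hf : PolyTime f)
    (hl : PolyTime l) : PolyTime (fun a => decide (f a ∈ l a)) := by
  refine (any (f := fun g a => decide (f g = a)) (eq (hf.comp PolyTime.id.fst) PolyTime.id.snd)
    hl).of_enc_eq fun g => ?_
  congr 1
  induction l g with
  | nil => simp
  | cons a l ih => simp [ih]

end PolyTime

instance : PolyEq ℕ where
  polyTime := by
    refine ((PolyTime.natLe PolyTime.id.fst PolyTime.id.snd).and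
      (PolyTime.natLe PolyTime.id.snd PolyTime.id.fst)).of_enc_eq fun p => ?_
    congr 1
    rw [← Bool.decide_and]
    congr 1
    exact propext le_antisymm_iff.symm

instance : PolyEq Bool where
  polyTime :=
    (PolyTime.id.fst.ite PolyTime.id.snd PolyTime.id.snd.not).of_enc_eq fun p => by
      rcases p with ⟨_ | _, _ | _⟩ <;> rfl

instance {α : Type} [Enc α] [DecidableEq α] [PolyEq α] : PolyEq (List α) where
  polyTime := by
    -- The fold over `l` carries a verdict and the unread rest of `m`. With the default `a` in
    -- `headD` the comparison succeeds when `m` is exhausted, and the emptiness test rejects that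
    -- case.
    have e : ∀ (l m : List α) (b : Bool),
        (fun st : Bool × List α => st.1 && st.2.isEmpty) (l.foldl (fun st a =>
          ((st.1 && !st.2.isEmpty) && decide (st.2.headD a = a), st.2.tail)) (b, m)) =
        (b && decide (l = m)) := by
      intro l
      induction l with
      | nil => intro m b; cases m <;> simp
      | cons a l ih =>
        intro m b
        rw [List.foldl_cons, ih]
        cases m with
        | nil => simp
        | cons c m => by_cases h : c = a <;> simp [h, Ne.symm]
    have h : PolyTime (fun p : List α × List α => p.1.foldl (fun st a =>
          ((st.1 && !st.2.isEmpty) && decide (st.2.headD a = a), st.2.tail)) (true, p.2)) := by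
      refine PolyTime.foldl (γ := List α × List α) (σ := Bool × List α) (f := fun _ st a =>
          ((st.1 && !st.2.isEmpty) && decide (st.2.headD a = a), st.2.tail))
        (l := fun p => p.1) (init := fun p => (true, p.2)) (S := fun p => 4 + esize p)
        (((PolyTime.id.snd.fst.and PolyTime.id.snd.snd.isEmpty.not).and
          ((PolyTime.id.snd.snd.headD PolyTime.id.fst.snd).eq PolyTime.id.fst.snd)).pair
            PolyTime.id.snd.snd.tail) PolyTime.id.fst ((PolyTime.const true).pair PolyTime.id.snd)
        ((PolyBound.const 4).add .size) fun p l₁ l₂ _ => ?_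
      have h2 : ∀ (l m : List α) (b : Bool), (l.foldl (fun st a =>
          ((st.1 && !st.2.isEmpty) && decide (st.2.headD a = a), st.2.tail))
            (b, m)).2.Sublist m := by
        intro l
        induction l with
        | nil => intro m b; exact List.Sublist.refl _
        | cons a l ih =>
          intro m b
          exact (ih m.tail _).trans (List.tail_sublist m)
      have h3 := esize_le_of_sublist (h2 l₁ p.2 true)
      have h4 : esize p = esize p.1 + esize p.2 + 1 := rfl
      refine (esize_pair _ _).trans_le ?_
      have h5 := esize_bool (l₁.foldl (fun (st : Bool × List α) a =>
          ((st.1 && !st.2.isEmpty) && decide (st.2.headD a = a), st.2.tail)) (true, p.2)).1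
      omega
    refine (h.fst.and h.snd.isEmpty).of_enc_eq fun p => ?_
    have := e p.1 p.2 true
    rw [Bool.true_and] at this
    rw [← this]

/-- The list without repetitions. -/
def dedupList {α : Type} [DecidableEq α] (l : List α) : List α :=
  l.foldl (fun acc a => if decide (a ∈ acc) = true then acc else acc ++ [a]) []

theorem dedupList_append_singleton {α : Type} [DecidableEq α] (l : List α) (a : α) :
    dedupList (l ++ [a]) = if a ∈ dedupList l then dedupList l else dedupList l ++ [a] := by
  simp [dedupList, List.foldl_append]

theorem mem_dedupList {α : Type} [DecidableEq α] {l : List α} {a : α} :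
    a ∈ dedupList l ↔ a ∈ l := by
  induction l using List.reverseRecOn with
  | nil => rfl
  | append_singleton l b ih =>
    rw [dedupList_append_singleton]
    split_ifs with h
    · rw [ih]
      simp only [List.mem_append, List.mem_singleton]
      refine ⟨Or.inl, ?_⟩
      rintro (h' | rfl)
      · exact h'
      · exact ih.1 h
    · simp [ih]

theorem nodup_dedupList {α : Type} [DecidableEq α] (l : List α) : (dedupList l).Nodup := by
  induction l using List.reverseRecOn with
  | nil => exact List.nodup_nil
  | append_singleton l b ih =>
    rw [dedupList_append_singleton]
    split_ifs with h
    · exact ih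
    · exact List.nodup_append.2 ⟨ih, by simp, fun c hc e he => by
        rw [List.mem_singleton.1 he]; exact fun hcb => h (hcb ▸ hc)⟩

theorem dedupList_sublist {α : Type} [DecidableEq α] (l : List α) : (dedupList l).Sublist l := by
  induction l using List.reverseRecOn with
  | nil => exact List.Sublist.refl _
  | append_singleton l b ih =>
    rw [dedupList_append_singleton]
    split_ifs with h
    · exact ih.trans (List.sublist_append_left _ _)
    · exact ih.append (List.Sublist.refl _)

theorem PolyTime.dedupList {α γ : Type} [Enc α] [Enc γ] [DecidableEq α] [PolyEq α]
    {l : γ → List α} (hl : PolyTime l) : PolyTime (fun g => dedupList (l g)) := by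
  refine foldl (f := fun _ acc a => if decide (a ∈ acc) = true then acc else acc ++ [a])
    (S := fun g => esize (l g))
    ((PolyTime.id.fst.snd.mem PolyTime.id.snd).ite PolyTime.id.snd
      (PolyTime.id.snd.append (PolyTime.id.fst.snd.cons (const [])))) hl (const [])
    hl.size fun g l₁ l₂ h => ?_
  rw [h]
  exact esize_le_of_sublist ((dedupList_sublist l₁).trans (List.sublist_append_left _ _))

end ParamComplexity

namespace ParamComplexity

/-! ## Treedepth of vertex sets by recursive elimination -/

section Treedepth

variable {V T : Type*}

/-- The set of vertices that can be reached from `u` inside of `S`. -/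
def compSet (A : V → V → Prop) (S : Set V) (u : V) : Set V :=
  {v | Relation.ReflTransGen (fun a b => A a b ∧ b ∈ S) u v}

/-- The subgraph induced by `S` has treedepth at most `j`: every component has a vertex whose
removal leaves a graph of treedepth at most `j - 1`. -/
def SetTreedepthLE (A : V → V → Prop) : ℕ → Set V → Prop
  | 0, S => S = ∅
  | j + 1, S => ∀ u ∈ S, ∃ v ∈ compSet A S u, SetTreedepthLE A j (compSet A S u \ {v})

theorem self_mem_compSet (A : V → V → Prop) (S : Set V) (u : V) : u ∈ compSet A S u := .refl

theorem compSet_subset {A : V → V → Prop} {S : Set V} {u : V} (hu : u ∈ S) :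
    compSet A S u ⊆ S := by
  intro v hv
  rcases Relation.ReflTransGen.cases_tail hv with rfl | ⟨w, _, h⟩
  · exact hu
  · exact h.2

/-- A walk downstairs lifts to a walk upstairs step by step, since adjacency of images implies
adjacency; injectivity of `φ` is not required. -/
theorem compSet_subset_image {A : V → V → Prop} {B : T → T → Prop} {φ : T → V}
    (hA : ∀ a b, A (φ a) (φ b) → B a b) {S : Set T} {S' : Set V} (hS : S' ⊆ φ '' S) (a : T) :
    compSet A S' (φ a) ⊆ φ '' compSet B S a := by
  intro v hv
  induction hv with
  | refl => exact ⟨a, self_mem_compSet _ _ _, rfl⟩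
  | tail _ h ih =>
    obtain ⟨b, hb, rfl⟩ := ih
    obtain ⟨c, hc, rfl⟩ := hS h.2
    exact ⟨c, Relation.ReflTransGen.tail hb ⟨hA _ _ h.1, hc⟩, rfl⟩

/-- An elimination upstairs is copied to the image. With `φ = id` this is monotonicity in the vertex
set; with the inclusion of the vertices outside a modulator into `ℕ` it transfers treedepth to lists
of numbers. -/
theorem SetTreedepthLE.of_subset_image {A : V → V → Prop} {B : T → T → Prop} {φ : T → V}
    (hA : ∀ a b, A (φ a) (φ b) → B a b) {j : ℕ} {S : Set T} {S' : Set V} (hS : S' ⊆ φ '' S)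
    (h : SetTreedepthLE B j S) : SetTreedepthLE A j S' := by
  induction j generalizing S S' with
  | zero =>
    have h : S = ∅ := h
    subst h
    exact Set.subset_empty_iff.1 (by simpa using hS)
  | succ j ih =>
    intro u hu
    obtain ⟨a, ha, rfl⟩ := hS hu
    obtain ⟨b, hb, hab⟩ := h a ha
    have hsub := compSet_subset_image hA hS a
    by_cases hbc : φ b ∈ compSet A S' (φ a)
    · refine ⟨φ b, hbc, ih ?_ hab⟩
      rintro v ⟨hv, hvb⟩
      obtain ⟨c, hc, rfl⟩ := hsub hv
      exact ⟨c, ⟨hc, fun h => hvb (by rw [Set.mem_singleton_iff.1 h]; rfl)⟩, rfl⟩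
    -- The vertex eliminated upstairs has no image in the component, so the component lies in the
    -- image of what remains and any of its vertices may be eliminated.
    · refine ⟨φ a, self_mem_compSet _ _ _, ih ?_ hab⟩
      rintro v ⟨hv, -⟩
      obtain ⟨c, hc, rfl⟩ := hsub hv
      exact ⟨c, ⟨hc, fun h => hbc (by rw [← Set.mem_singleton_iff.1 h]; exact hv)⟩, rfl⟩

theorem SetTreedepthLE.mono {A : V → V → Prop} {j : ℕ} {S S' : Set V} (hS : S' ⊆ S)
    (h : SetTreedepthLE A j S) : SetTreedepthLE A j S' :=
  h.of_subset_image (φ := id) (fun _ _ h => h) (by simpa using hS)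

theorem setTreedepthLE_empty (A : V → V → Prop) (j : ℕ) : SetTreedepthLE A j ∅ := by
  cases j with
  | zero => rfl
  | succ j => exact fun u hu => hu.elim

/-- Whenever the walk returns to a vertex, the path is cut back to that vertex. Absence of
repetitions makes long paths obstructions and bounds the number of rounds of the component search.
-/
theorem exists_path_of_mem_compSet {A : V → V → Prop} {S : Set V} {u v : V} (hu : u ∈ S)
    (h : v ∈ compSet A S u) : ∃ q : List V, (u :: q).Nodup ∧ (u :: q).IsChain A ∧
      v ∈ u :: q ∧ ∀ x ∈ u :: q, x ∈ S := by
  suffices H : ∃ q : List V, (u :: q).Nodup ∧ (u :: q).IsChain A ∧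
      (u :: q).getLast? = some v ∧ ∀ x ∈ u :: q, x ∈ S by
    obtain ⟨q, h1, h2, h3, h4⟩ := H
    exact ⟨q, h1, h2, List.mem_of_getLast? h3, h4⟩
  induction h with
  | refl => exact ⟨[], by simp, by simp, by simp, by simpa using hu⟩
  | @tail b c _ hbc ih =>
    obtain ⟨q, h1, h2, h3, h4⟩ := ih
    by_cases hc : c ∈ u :: q
    · rcases List.mem_cons.1 hc with rfl | hc
      · exact ⟨[], by simp, by simp, by simp, by simpa using hu⟩
      obtain ⟨l, r, rfl⟩ := List.append_of_mem hc
      have e : u :: (l ++ c :: r) = (u :: (l ++ [c])) ++ r := by simp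
      have hs : (u :: (l ++ [c])).Sublist (u :: (l ++ c :: r)) := by
        rw [e]; exact List.sublist_append_left _ _
      refine ⟨l ++ [c], h1.sublist hs, ?_, ?_, fun x hx => h4 x (hs.subset hx)⟩
      · rw [e] at h2; exact h2.left_of_append
      · rw [← List.cons_append, List.getLast?_append]; simp
    · refine ⟨q ++ [c], ?_, ?_, ?_, ?_⟩
      · rw [← List.cons_append]
        exact List.nodup_append.2 ⟨h1, by simp, fun x hx y hy => by
          rw [List.mem_singleton.1 hy]; exact fun h => hc (h ▸ hx)⟩
      · rw [← List.cons_append]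
        refine h2.append (by simp) fun x hx y hy => ?_
        rw [h3] at hx
        simp only [Option.mem_def, Option.some.injEq, List.head?_cons] at hx hy
        rw [← hx, ← hy]
        exact hbc.1
      · rw [← List.cons_append, List.getLast?_append]; simp
      · rw [← List.cons_append]
        intro x hx
        rcases List.mem_append.1 hx with hx | hx
        · exact h4 x hx
        · rw [List.mem_singleton.1 hx]; exact hbc.2

theorem mem_compSet_of_path {A : V → V → Prop} {S : Set V} {u : V} {q : List V}
    (h : (u :: q).IsChain A) (hS : ∀ x ∈ u :: q, x ∈ S) : ∀ x ∈ u :: q, x ∈ compSet A S u := by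
  induction q generalizing u with
  | nil => intro x hx; rw [List.mem_singleton.1 hx]; exact self_mem_compSet _ _ _
  | cons w q ih =>
    intro x hx
    rcases List.mem_cons.1 hx with rfl | hx
    · exact self_mem_compSet _ _ _
    rw [List.isChain_cons_cons] at h
    exact Relation.ReflTransGen.head ⟨h.1, hS w (by simp)⟩
      (ih h.2 (fun y hy => hS y (List.mem_cons_of_mem _ hy)) x hx)

/-- The vertices of a long path do not induce a graph of small treedepth. -/
theorem not_setTreedepthLE_of_path {A : V → V → Prop} {j : ℕ} {p : List V} (hn : p.Nodup)
    (hp : p.IsChain A) (hl : 2 ^ j ≤ p.length) : ¬ SetTreedepthLE A j {x | x ∈ p} := by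
  induction j generalizing p with
  | zero =>
    intro h
    have h : {x | x ∈ p} = ∅ := h
    cases p with
    | nil => simp at hl
    | cons a p => exact (h ▸ List.mem_cons_self : a ∈ (∅ : Set V)).elim
  | succ j ih =>
    intro h
    obtain ⟨u, q, rfl⟩ : ∃ u q, p = u :: q := by
      cases p with
      | nil => simp at hl
      | cons a p => exact ⟨a, p, rfl⟩
    obtain ⟨v, hv, hvj⟩ := h u List.mem_cons_self
    have hv' : v ∈ u :: q := compSet_subset (S := {x | x ∈ u :: q}) List.mem_cons_self hv
    have hall := mem_compSet_of_path (S := {x | x ∈ u :: q}) hp fun x hx => hx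
    obtain ⟨l, r, hlr⟩ := List.append_of_mem hv'
    rw [hlr] at hn hp hl
    -- Eliminating `v` splits the path into two pieces with at least `2 ^ (j + 1) - 1` vertices
    -- together. The longer piece keeps at least `2 ^ j` of them and is an obstruction by induction.
    have hlen : 2 ^ j ≤ l.length ∨ 2 ^ j ≤ r.length := by
      rw [pow_succ, List.length_append, List.length_cons] at hl
      omega
    have hn' := List.nodup_append.1 hn
    have hvl : v ∉ l := fun h => hn'.2.2 v h v List.mem_cons_self rfl
    have hvr : v ∉ r := (List.nodup_cons.1 hn'.2.1).1
    rcases hlen with hlen | hlen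
    · refine ih hn'.1 hp.left_of_append hlen (hvj.mono ?_)
      intro x hx
      refine ⟨hall x ?_, fun h => hvl (Set.mem_singleton_iff.1 h ▸ hx)⟩
      rw [hlr]
      exact List.mem_append_left _ hx
    · refine ih (List.nodup_cons.1 hn'.2.1).2 hp.right_of_append.tail hlen (hvj.mono ?_)
      intro x hx
      refine ⟨hall x ?_, fun h => hvr (Set.mem_singleton_iff.1 h ▸ hx)⟩
      rw [hlr]
      exact List.mem_append_right _ (List.mem_cons_of_mem _ hx)

/-- Obstructions to treedepth at most `d` can be found among the sets of bounded size. -/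
theorem exists_bounded_obstruction [DecidableEq V] (d : ℕ) :
    ∃ c, ∀ (A : V → V → Prop) (S : Set V), ¬ SetTreedepthLE A d S →
      ∃ t : Finset V, ↑t ⊆ S ∧ t.card ≤ c ∧ ¬ SetTreedepthLE A d (t : Set V) := by
  induction d with
  | zero =>
    refine ⟨1, fun A S hS => ?_⟩
    obtain ⟨x, hx⟩ := Set.nonempty_iff_ne_empty.2 hS
    refine ⟨{x}, by simpa using hx, by simp, fun h => ?_⟩
    have h : ((({x} : Finset V)) : Set V) = ∅ := h
    simp at h
  | succ d ih =>
    obtain ⟨c, hc⟩ := ih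
    -- Up to `c + c * c` vertices are joined to `u` by paths with fewer than `2 ^ (d + 1)` vertices.
    -- The summand 1 covers the other case, where the obstruction is an initial segment of a single
    -- long path.
    refine ⟨(c + c * c + 1) * 2 ^ (d + 1), fun A S hS => ?_⟩
    obtain ⟨u, hu, huv⟩ : ∃ u ∈ S, ∀ v ∈ compSet A S u,
        ¬ SetTreedepthLE A d (compSet A S u \ {v}) := by
      by_contra! h
      exact hS h
    choose! H hH using fun v (hv : v ∈ compSet A S u) => hc A _ (huv v hv)
    set H₀ := H u with hH₀
    obtain ⟨h01, h02, h03⟩ := hH u (self_mem_compSet _ _ _)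
    have hH0sub : ∀ v ∈ H₀, v ∈ compSet A S u := fun v hv => (h01 hv).1
    -- `H v` is a bounded obstruction in the component of `u` that avoids `v`. The set `X` retains
    -- an obstruction whichever vertex is removed: `H v` survives the removal of `v ∈ H₀`, and `H₀`
    -- survives any other removal.
    set X := H₀ ∪ H₀.biUnion H with hX
    have hXsub : ∀ x ∈ X, x ∈ compSet A S u := by
      intro x hx
      rcases Finset.mem_union.1 hx with hx | hx
      · exact hH0sub x hx
      · obtain ⟨v, hv, hx⟩ := Finset.mem_biUnion.1 hx
        exact ((hH v (hH0sub v hv)).1 hx).1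
    have hXcard : X.card ≤ c + c * c := by
      refine (Finset.card_union_le _ _).trans (add_le_add h02 ?_)
      refine (Finset.card_biUnion_le_card_mul _ _ c fun v hv => (hH v (hH0sub v hv)).2.1).trans ?_
      exact Nat.mul_le_mul_right c h02
    choose! q hq using fun x (hx : x ∈ compSet A S u) => exists_path_of_mem_compSet hu hx
    by_cases hlong : ∃ x ∈ X, 2 ^ (d + 1) ≤ (u :: q x).length
    · obtain ⟨x, hx, hlen⟩ := hlong
      obtain ⟨h1, h2, -, h4⟩ := hq x (hXsub x hx)
      refine ⟨((u :: q x).take (2 ^ (d + 1))).toFinset, ?_, ?_, ?_⟩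
      · intro y hy
        simp only [List.coe_toFinset, Set.mem_ofPred_eq] at hy
        exact h4 y (List.mem_of_mem_take hy)
      · refine (List.toFinset_card_le _).trans ?_
        rw [List.length_take]
        have : 1 * 2 ^ (d + 1) ≤ (c + c * c + 1) * 2 ^ (d + 1) := Nat.mul_le_mul_right _ (by omega)
        omega
      · rw [List.coe_toFinset]
        refine not_setTreedepthLE_of_path (h1.sublist (List.take_sublist _ _)) (h2.take _) ?_
        rw [List.length_take, min_eq_left hlen]
    · push Not at hlong
      set t := X.biUnion fun x => (u :: q x).toFinset with ht
      have hmem : ∀ x ∈ X, ∀ y ∈ u :: q x, y ∈ (t : Set V) := by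
        intro x hx y hy
        exact Finset.mem_coe.2 (Finset.mem_biUnion.2 ⟨x, hx, List.mem_toFinset.2 hy⟩)
      have hXt : ∀ x ∈ X, x ∈ (t : Set V) := fun x hx => hmem x hx x (hq x (hXsub x hx)).2.2.1
      refine ⟨t, ?_, ?_, ?_⟩
      · intro y hy
        obtain ⟨x, hx, hy⟩ := Finset.mem_biUnion.1 (Finset.mem_coe.1 hy)
        exact (hq x (hXsub x hx)).2.2.2 y (List.mem_toFinset.1 hy)
      · refine (Finset.card_biUnion_le_card_mul _ _ (2 ^ (d + 1)) fun x hx =>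
          (List.toFinset_card_le _).trans (hlong x hx).le).trans ?_
        exact Nat.mul_le_mul_right _ (by omega)
      · intro htd
        -- The set `t` is a union of paths from `u` to the vertices of `X`, so it contains `u` only
        -- if there is at least one such path.
        have hne : H₀.Nonempty := by
          by_contra hne
          rw [Finset.not_nonempty_iff_eq_empty] at hne
          rw [← hH₀, hne, Finset.coe_empty] at h03
          exact h03 (setTreedepthLE_empty _ _)
        obtain ⟨x0, hx0⟩ := hne
        have hut : u ∈ (t : Set V) :=
          hmem x0 (Finset.mem_union_left _ hx0) u List.mem_cons_self
        obtain ⟨v, hv, hvd⟩ := htd u hut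
        have hcomp : ∀ y ∈ (t : Set V), y ∈ compSet A (t : Set V) u := by
          intro y hy
          obtain ⟨x, hx, hy⟩ := Finset.mem_biUnion.1 (Finset.mem_coe.1 hy)
          exact mem_compSet_of_path (hq x (hXsub x hx)).2.1 (hmem x hx) y (List.mem_toFinset.1 hy)
        -- Since `t` is connected, the elimination removes a single vertex `v` of `t`, and the
        -- obstruction in `X` that avoids `v` contradicts treedepth at most `d` of the rest.
        by_cases hvH : v ∈ H₀
        · obtain ⟨h1, -, h3⟩ := hH v (hH0sub v hvH)
          refine h3 (hvd.mono ?_)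
          intro x hx
          refine ⟨hcomp x (hXt x ?_), (h1 hx).2⟩
          exact Finset.mem_union_right _ (Finset.mem_biUnion.2 ⟨v, hvH, hx⟩)
        · refine h03 (hvd.mono ?_)
          intro x hx
          refine ⟨hcomp x (hXt x ?_), fun h => hvH ?_⟩
          · exact Finset.mem_union_left _ hx
          · rw [← Set.mem_singleton_iff.1 h]; exact hx

/-! ### From elimination forests to recursive elimination -/

namespace RootedForest

/-- Every vertex has at most one parent, so upward paths from `w` cannot branch. -/
theorem isAncestor_total (F : RootedForest V) {u v w : V} (hu : F.IsAncestor u w)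
    (hv : F.IsAncestor v w) : u = v ∨ F.IsAncestor u v ∨ F.IsAncestor v u := by
  have hU : Relator.RightUnique (Function.swap fun a b => F.parent b = some a) := by
    intro a b c h1 h2
    simpa [Function.swap] using h1.symm.trans h2
  have h := Relation.ReflTransGen.total_of_right_unique hU
    (Relation.reflTransGen_swap.2 hu.to_reflTransGen)
    (Relation.reflTransGen_swap.2 hv.to_reflTransGen)
  rcases h with h | h
  · rcases Relation.reflTransGen_iff_eq_or_transGen.1 h with h | h
    · exact .inl h.symm
    · exact .inr (.inr (Relation.transGen_swap.1 h))
  · rcases Relation.reflTransGen_iff_eq_or_transGen.1 h with h | h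
    · exact .inl h
    · exact .inr (.inl (Relation.transGen_swap.1 h))

/-- Each ancestor step expands to a downward path with at least one edge, so a chain of ancestors
refines to a downward path that is at least as long. -/
theorem isChain_isAncestor_length_le {F : RootedForest V} {d : ℕ} (hF : F.DepthLE d) {p : List V}
    (hp : p.IsChain F.IsAncestor) : p.length ≤ d := by
  have step : ∀ {a b : V}, F.IsAncestor a b → ∀ q : List V,
      (b :: q).IsChain (fun u v => F.parent v = some u) →
      ∃ q', (a :: q').IsChain (fun u v => F.parent v = some u) ∧ q.length + 1 ≤ q'.length := by
    intro a b hab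
    induction hab with
    | single h => exact fun q hq => ⟨_ :: q, List.isChain_cons_cons.2 ⟨h, hq⟩, by simp⟩
    | tail _ h ih =>
      intro q hq
      obtain ⟨q', h1, h2⟩ := ih (_ :: q) (List.isChain_cons_cons.2 ⟨h, hq⟩)
      exact ⟨q', h1, by simp at h2; omega⟩
  have key : ∀ (p : List V) a, (a :: p).IsChain F.IsAncestor →
      ∃ q, (a :: q).IsChain (fun u v => F.parent v = some u) ∧ p.length ≤ q.length := by
    intro p
    induction p with
    | nil => exact fun a _ => ⟨[], by simp, le_rfl⟩
    | cons b p ih =>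
      intro a h
      rw [List.isChain_cons_cons] at h
      obtain ⟨q, h1, h2⟩ := ih b h.2
      obtain ⟨q', h3, h4⟩ := step h.1 q h1
      exact ⟨q', h3, by simp; omega⟩
  cases p with
  | nil => simp
  | cons a p =>
    obtain ⟨q, h1, h2⟩ := key p a hp
    have := hF _ h1
    simp only [List.length_cons] at *
    omega

/-- In each component a topmost vertex `v` is eliminated. All other vertices of the component are
its descendants, so every remaining ancestor chain can be prolonged by `v` at the top, and the bound
on chain lengths drops by one. -/
theorem IsEliminationForest.setTreedepthLE {F : RootedForest V} {G : SimpleGraph V}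
    (hF : F.IsEliminationForest G) {j : ℕ} {S : Set V}
    (hS : ∀ p : List V, (∀ x ∈ p, x ∈ S) → p.IsChain F.IsAncestor → p.length ≤ j) :
    SetTreedepthLE G.Adj j S := by
  induction j generalizing S with
  | zero =>
    refine Set.eq_empty_of_forall_notMem fun x hx => ?_
    have := hS [x] (by simpa using hx) (by simp)
    simp at this
  | succ j ih =>
    intro u hu
    have hwf : WellFounded F.IsAncestor := F.wf.transGen
    obtain ⟨v, hv, hmin⟩ := hwf.has_min _ ⟨u, self_mem_compSet G.Adj S u⟩
    -- Being equal to or below `v` passes to neighbors in the component: if the neighbor `y` is an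
    -- ancestor of `x`, then `y` and `v` are comparable, and `y` cannot lie above the topmost
    -- vertex.
    have hclosed : ∀ x y, y ∈ compSet G.Adj S u → G.Adj x y → (x = v ∨ F.IsAncestor v x) →
        (y = v ∨ F.IsAncestor v y) := by
      intro x y hy hxy hx
      rcases hF x y hxy with h | h
      · rcases hx with rfl | hx
        · exact .inr h
        · exact .inr (hx.trans h)
      · rcases hx with rfl | hx
        · exact absurd h (hmin y hy)
        · rcases F.isAncestor_total hx h with h | h | h
          · exact .inl h.symm
          · exact .inr h
          · exact absurd h (hmin y hy)
    have hiff : ∀ x ∈ compSet G.Adj S u,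
        ((x = v ∨ F.IsAncestor v x) ↔ (u = v ∨ F.IsAncestor v u)) := by
      intro x hx
      induction hx with
      | refl => rfl
      | @tail b c hb h ih =>
        rw [← ih]
        exact ⟨hclosed c b hb h.1.symm, hclosed b c (Relation.ReflTransGen.tail hb h) h.1⟩
    have hall : ∀ x ∈ compSet G.Adj S u, x = v ∨ F.IsAncestor v x :=
      fun x hx => (hiff x hx).2 ((hiff v hv).1 (.inl rfl))
    refine ⟨v, hv, ih fun p hpS hp => ?_⟩
    have hmem : ∀ x ∈ v :: p, x ∈ S := by
      intro x hx
      rcases List.mem_cons.1 hx with rfl | hx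
      · exact compSet_subset hu hv
      · exact compSet_subset hu (hpS x hx).1
    have hch : (v :: p).IsChain F.IsAncestor := by
      cases p with
      | nil => simp
      | cons a p =>
        refine List.isChain_cons_cons.2 ⟨?_, hp⟩
        obtain ⟨h1, h2⟩ := hpS a List.mem_cons_self
        exact (hall a h1).resolve_left h2
    have := hS _ hmem hch
    simpa using this

end RootedForest

theorem TreedepthLE.setTreedepthLE {G : SimpleGraph V} {d : ℕ} (h : TreedepthLE G d) :
    SetTreedepthLE G.Adj d Set.univ := by
  obtain ⟨F, hF, hd⟩ := h
  exact hF.setTreedepthLE fun p _ hp => RootedForest.isChain_isAncestor_length_le hd hp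

end Treedepth

end ParamComplexity

namespace ParamComplexity
open Enc (enc)

/-! ## Computing components, treedepth and an approximate modulator -/

section Algorithms

variable (A : ℕ → ℕ → Bool)

/-- The vertices of `S` that are in `R` or have a neighbour in `R`. -/
def closeStep (S R : List ℕ) : List ℕ :=
  S.filter fun u => decide (u ∈ R) || R.any fun r => A r u

/-- The component of `u` in the graph induced by `S`. -/
def compList (S : List ℕ) (u : ℕ) : List ℕ :=
  (closeStep A S)^[S.length] [u]

/-- The list without the element `v`. -/
def removeElem (v : ℕ) (S : List ℕ) : List ℕ :=
  S.filter fun w => !decide (w = v)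

/-- The decision procedure for treedepth at most `j`. -/
def treedepthTest : ℕ → List ℕ → Bool
  | 0, S => S.isEmpty
  | j + 1, S => S.all fun u =>
      (compList A S u).any fun v => treedepthTest j (removeElem v (compList A S u))

/-- The lists of length at most `c` with entries in `V`. -/
def shortLists (V : List ℕ) : ℕ → List (List ℕ)
  | 0 => [[]]
  | c + 1 => shortLists V c ++ (shortLists V c).flatMap fun t => V.map fun v => v :: t

/-- The entries of `t` that are not in `W`. -/
def newElems (W t : List ℕ) : List ℕ := t.filter fun v => !decide (v ∈ W)

/-- One step of the greedy construction of a modulator. -/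
def greedyStep (d : ℕ) (W t : List ℕ) : List ℕ :=
  if treedepthTest A d (newElems W t) = true then W else t ++ W

/-- The union of a maximal sequence of obstructions each of which has a new vertex. -/
def greedyModulator (d c : ℕ) (V : List ℕ) : List ℕ :=
  (shortLists V c).foldl (greedyStep A d) []

variable {A}

theorem mem_closeStep {S R : List ℕ} {v : ℕ} :
    v ∈ closeStep A S R ↔ v ∈ S ∧ (v ∈ R ∨ ∃ r ∈ R, A r v = true) := by
  simp [closeStep]

/-- A repetition-free path inside `S` has at most `S.length` vertices, and each round of `closeStep`
advances at least one edge along it. -/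
theorem mem_compList {S : List ℕ} {u v : ℕ} (hu : u ∈ S) :
    v ∈ compList A S u ↔ v ∈ compSet (fun a b => A a b = true) {x | x ∈ S} u := by
  constructor
  · have H : ∀ n v, v ∈ (closeStep A S)^[n] [u] →
        v ∈ compSet (fun a b => A a b = true) {x | x ∈ S} u := by
      intro n
      induction n with
      | zero =>
        intro v hv
        rw [List.mem_singleton.1 hv]
        exact self_mem_compSet _ _ _
      | succ n ih =>
        intro v hv
        rw [Function.iterate_succ_apply', mem_closeStep] at hv
        obtain ⟨hvS, hv | ⟨r, hr, hrv⟩⟩ := hv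
        · exact ih v hv
        · exact Relation.ReflTransGen.tail (ih r hr) ⟨hrv, hvS⟩
    exact H _ v
  · intro hv
    obtain ⟨q, h1, h2, h3, h4⟩ := exists_path_of_mem_compSet (S := {x | x ∈ S}) hu hv
    have hmono : ∀ n m, n ≤ m → ∀ w ∈ S, w ∈ (closeStep A S)^[n] [u] →
        w ∈ (closeStep A S)^[m] [u] := by
      intro n m hnm w hwS hw
      induction hnm with
      | refl => exact hw
      | step _ ih =>
        rw [Function.iterate_succ_apply', mem_closeStep]
        exact ⟨hwS, .inl ih⟩
    have H : ∀ (q : List ℕ) a n, (a :: q).IsChain (fun a b => A a b = true) →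
        (∀ x ∈ a :: q, x ∈ S) → a ∈ (closeStep A S)^[n] [u] →
        ∀ x ∈ a :: q, x ∈ (closeStep A S)^[n + q.length] [u] := by
      intro q
      induction q with
      | nil => intro a n _ _ ha x hx; rw [List.mem_singleton.1 hx]; exact ha
      | cons b q ih =>
        intro a n hq hS ha x hx
        rw [List.isChain_cons_cons] at hq
        rcases List.mem_cons.1 hx with rfl | hx
        · exact hmono n _ (by simp) x (hS x List.mem_cons_self) ha
        · have := ih b (n + 1) hq.2 (fun y hy => hS y (List.mem_cons_of_mem _ hy)) (by
            rw [Function.iterate_succ_apply', mem_closeStep]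
            exact ⟨hS b (by simp), .inr ⟨a, ha, hq.1⟩⟩) x hx
          rwa [List.length_cons, Nat.add_comm q.length, ← Nat.add_assoc]
    have hlen : (u :: q).length ≤ S.length := (h1.subperm h4).length_le
    refine hmono _ _ ?_ v (h4 v h3) (H q u 0 h2 h4 (by simp) v h3)
    simp at hlen
    omega

theorem setOf_mem_compList {S : List ℕ} {u : ℕ} (hu : u ∈ S) :
    {x | x ∈ compList A S u} = compSet (fun a b => A a b = true) {x | x ∈ S} u :=
  Set.ext fun _ => mem_compList hu

theorem setOf_mem_removeElem {S : List ℕ} {v : ℕ} :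
    {x | x ∈ removeElem v S} = {x | x ∈ S} \ {v} :=
  Set.ext fun x => by simp [removeElem]

theorem treedepthTest_iff {j : ℕ} {S : List ℕ} :
    treedepthTest A j S = true ↔
      SetTreedepthLE (fun a b => A a b = true) j {x | x ∈ S} := by
  induction j generalizing S with
  | zero =>
    simp [treedepthTest, SetTreedepthLE, Set.eq_empty_iff_forall_notMem,
      List.eq_nil_iff_forall_not_mem]
  | succ j ih =>
    simp only [treedepthTest, SetTreedepthLE, List.all_eq_true, List.any_eq_true]
    refine forall₂_congr fun u hu => ?_
    refine exists_congr fun v => ?_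
    rw [ih, setOf_mem_removeElem, setOf_mem_compList hu, mem_compList hu]

theorem mem_shortLists {V : List ℕ} {c : ℕ} {t : List ℕ} :
    t ∈ shortLists V c ↔ (∀ v ∈ t, v ∈ V) ∧ t.length ≤ c := by
  induction c generalizing t with
  | zero =>
    simp only [shortLists, List.mem_singleton, Nat.le_zero, List.length_eq_zero_iff]
    exact ⟨fun h => by simp [h], fun h => h.2⟩
  | succ c ih =>
    simp only [shortLists, List.mem_append, List.mem_flatMap, List.mem_map, ih]
    constructor
    · rintro (⟨h1, h2⟩ | ⟨s, ⟨h1, h2⟩, v, hv, rfl⟩)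
      · exact ⟨h1, by omega⟩
      · refine ⟨fun w hw => ?_, by simpa using h2⟩
        rcases List.mem_cons.1 hw with rfl | hw
        · exact hv
        · exact h1 w hw
    · rintro ⟨h1, h2⟩
      cases t with
      | nil => exact .inl ⟨h1, by simp⟩
      | cons v t =>
        exact .inr ⟨t, ⟨fun w hw => h1 w (List.mem_cons_of_mem _ hw), by simpa using h2⟩, v,
          h1 v List.mem_cons_self, rfl⟩

theorem subset_foldl_greedyStep {d : ℕ} (l : List (List ℕ)) (W : List ℕ) :
    ∀ v ∈ W, v ∈ l.foldl (greedyStep A d) W := by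
  induction l generalizing W with
  | nil => exact fun v hv => hv
  | cons t l ih =>
    intro v hv
    refine ih _ v ?_
    unfold greedyStep
    split_ifs
    · exact hv
    · exact List.mem_append_right _ hv

/-- The vertices that the greedy construction leaves over induce a graph of treedepth at most
`d`. -/
theorem treedepth_compl_greedyModulator {d c : ℕ} {V : List ℕ}
    (hc : ∀ S : Set ℕ, ¬ SetTreedepthLE (fun a b => A a b = true) d S →
      ∃ t : Finset ℕ, ↑t ⊆ S ∧ t.card ≤ c ∧
        ¬ SetTreedepthLE (fun a b => A a b = true) d (t : Set ℕ)) :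
    SetTreedepthLE (fun a b => A a b = true) d
      {v | v ∈ V ∧ v ∉ greedyModulator A d c V} := by
  by_contra hS
  obtain ⟨t, h1, h2, h3⟩ := hc _ hS
  have ht : t.toList ∈ shortLists V c :=
    mem_shortLists.2 ⟨fun v hv => (h1 (Finset.mem_toList.1 hv)).1, by simpa using h2⟩
  obtain ⟨l, r, hlr⟩ := List.append_of_mem ht
  set W := l.foldl (greedyStep A d) [] with hW
  have hG : greedyModulator A d c V = r.foldl (greedyStep A d) (greedyStep A d W t.toList) := by
    rw [greedyModulator, hlr, List.foldl_append, List.foldl_cons]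
  have hsub := subset_foldl_greedyStep (A := A) (d := d) r (greedyStep A d W t.toList)
  rw [← hG] at hsub
  have hWsub : ∀ v ∈ W, v ∈ greedyStep A d W t.toList :=
    subset_foldl_greedyStep (A := A) (d := d) [t.toList] W
  -- The collected set only grows, and `t` avoids its final value. So `t` was entirely new when its
  -- turn came and had to be added, a contradiction.
  have hnew : newElems W t.toList = t.toList := by
    refine List.filter_eq_self.2 fun v hv => ?_
    have : v ∉ W := fun h => (h1 (Finset.mem_toList.1 hv)).2 (hsub v (hWsub v h))
    simpa using this
  have htest : ¬ treedepthTest A d (newElems W t.toList) = true := by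
    rw [hnew, treedepthTest_iff]
    simpa using h3
  obtain ⟨v, hv⟩ : t.Nonempty := by
    by_contra hne
    rw [Finset.not_nonempty_iff_eq_empty] at hne
    rw [hne, Finset.coe_empty] at h3
    exact h3 (setTreedepthLE_empty _ _)
  refine (h1 hv).2 (hsub v ?_)
  rw [greedyStep, if_neg htest]
  exact List.mem_append_left _ (Finset.mem_toList.2 hv)

/-- The greedy construction approximates any modulator within the factor `c`. -/
theorem length_greedyModulator_le {d c : ℕ} {V : List ℕ} (M : Finset ℕ)
    (hM : SetTreedepthLE (fun a b => A a b = true) d {v | v ∈ V ∧ v ∉ M}) :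
    (greedyModulator A d c V).length ≤ c * M.card := by
  -- Invariant: the collected list is at most `c` times as long as the part of `M` that it covers.
  suffices H : ∀ (l : List (List ℕ)) W, (∀ t ∈ l, t ∈ shortLists V c) →
      W.length ≤ c * (M.filter (· ∈ W)).card →
      (l.foldl (greedyStep A d) W).length ≤
        c * (M.filter (· ∈ l.foldl (greedyStep A d) W)).card by
    refine (H (shortLists V c) [] (fun t h => h) (by simp)).trans ?_
    exact Nat.mul_le_mul_left _ (Finset.card_filter_le _ _)
  intro l
  induction l with
  | nil => exact fun W _ h => h
  | cons t l ih =>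
    intro W hl hW
    refine ih _ (fun s hs => hl s (List.mem_cons_of_mem _ hs)) ?_
    unfold greedyStep
    split_ifs with htest
    · exact hW
    obtain ⟨ht1, ht2⟩ := mem_shortLists.1 (hl t List.mem_cons_self)
    -- The new part of `t` has treedepth more than `d`, so it cannot avoid `M`. The at most `c`
    -- added entries are charged to one new vertex of `M`.
    obtain ⟨v, hvt, hvW, hvM⟩ : ∃ v ∈ t, v ∉ W ∧ v ∈ M := by
      by_contra! hno
      refine htest (treedepthTest_iff.2 (hM.mono fun v hv => ?_))
      have hv : v ∈ t ∧ v ∉ W := by simpa [newElems] using hv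
      exact ⟨ht1 v hv.1, hno v hv.1 hv.2⟩
    have hlt : (M.filter (· ∈ W)).card < (M.filter (· ∈ t ++ W)).card := by
      refine Finset.card_lt_card ⟨fun w hw => ?_, fun h => ?_⟩
      · rw [Finset.mem_filter] at hw ⊢
        exact ⟨hw.1, List.mem_append_right _ hw.2⟩
      · have := h (Finset.mem_filter.2 ⟨hvM, List.mem_append_left _ hvt⟩)
        exact hvW (Finset.mem_filter.1 this).2
    rw [List.length_append]
    calc t.length + W.length ≤ c + c * (M.filter (· ∈ W)).card := add_le_add ht2 hW
      _ = c * ((M.filter (· ∈ W)).card + 1) := by ring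
      _ ≤ _ := Nat.mul_le_mul_left _ hlt

end Algorithms

/-! ## Raw instances of List Coloring -/

/-- The type of the data that encode instances of List Coloring. -/
abbrev RawInstance := List (List Bool × List (List Bool))

namespace RawInstance

/-- The adjacency test. -/
def adj (x : RawInstance) (u v : ℕ) : Bool := (x.getD u ([], [])).1.getD v false

/-- The colors of a vertex, without repetitions. -/
def cols (x : RawInstance) (u : ℕ) : List (List Bool) := dedupList (x.getD u ([], [])).2

end RawInstance

/-! ### Components, treedepth and the greedy modulator in polynomial time -/

namespace PolyTime

variable {γ : Type} [Enc γ] {x : γ → RawInstance} {u v c : γ → ℕ} {R S W : γ → List ℕ}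

theorem adj (hx : PolyTime x) (hu : PolyTime u) (hv : PolyTime v) :
    PolyTime (fun g => (x g).adj (u g) (v g)) :=
  ((hx.getD hu (const _)).fst).getD hv (const _)

theorem cols (hx : PolyTime x) (hu : PolyTime u) : PolyTime (fun g => (x g).cols (u g)) :=
  dedupList (hx.getD hu (const _)).snd

theorem closeStep (hx : PolyTime x) (hS : PolyTime S) (hR : PolyTime R) :
    PolyTime (fun g => closeStep (x g).adj (S g) (R g)) := by
  refine filter (f := fun g u => decide (u ∈ R g) || (R g).any fun r => (x g).adj r u)
    ((PolyTime.id.snd.mem (hR.comp PolyTime.id.fst)).or ?_) hS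
  exact any (f := fun (p : γ × ℕ) r => (x p.1).adj r p.2)
    (adj (hx.comp PolyTime.id.fst.fst) PolyTime.id.snd PolyTime.id.fst.snd)
    (hR.comp PolyTime.id.fst)

theorem compList (hx : PolyTime x) (hS : PolyTime S) (hu : PolyTime u) :
    PolyTime (fun g => compList (x g).adj (S g) (u g)) := by
  refine iterate (f := fun g R => ParamComplexity.closeStep (x g).adj (S g) R)
    (S := fun g => esize (S g) + (esize (u g) + 2))
    (closeStep (hx.comp PolyTime.id.fst) (hS.comp PolyTime.id.fst) PolyTime.id.snd)
    hS.length (hu.cons (const [])) (hS.size.add (hu.size.add (.const 2))) fun g i _ => ?_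
  cases i with
  | zero => simp only [Function.iterate_zero, id_eq, esize_cons, esize_nil]; omega
  | succ i =>
    rw [Function.iterate_succ_apply']
    exact (esize_le_of_sublist List.filter_sublist).trans (Nat.le_add_right _ _)

theorem removeElem (hv : PolyTime v) (hS : PolyTime S) :
    PolyTime (fun g => removeElem (v g) (S g)) :=
  filter (f := fun g w => !decide (w = v g))
    (PolyTime.id.snd.eq (hv.comp PolyTime.id.fst)).not hS

theorem treedepthTest (j : ℕ) (hx : PolyTime x) (hS : PolyTime S) :
    PolyTime (fun g => treedepthTest (x g).adj j (S g)) := by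
  -- The depth is a constant, so the nesting of loops is fixed and the degree of the polynomial may
  -- grow with `j`. The type `γ` varies because each nested loop adds its variable to the context.
  induction j generalizing γ with
  | zero => exact hS.isEmpty
  | succ j ih =>
    refine all (f := fun g u => (ParamComplexity.compList (x g).adj (S g) u).any fun v =>
      ParamComplexity.treedepthTest (x g).adj j
        (ParamComplexity.removeElem v (ParamComplexity.compList (x g).adj (S g) u))) ?_ hS
    refine any (f := fun (p : γ × ℕ) v => ParamComplexity.treedepthTest (x p.1).adj j
      (ParamComplexity.removeElem v (ParamComplexity.compList (x p.1).adj (S p.1) p.2))) ?_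
      (compList (hx.comp PolyTime.id.fst) (hS.comp PolyTime.id.fst) PolyTime.id.snd)
    exact ih (hx.comp PolyTime.id.fst.fst) (removeElem PolyTime.id.snd
      (compList (hx.comp PolyTime.id.fst.fst) (hS.comp PolyTime.id.fst.fst) PolyTime.id.fst.snd))

theorem shortLists (c : ℕ) (hS : PolyTime S) : PolyTime (fun g => shortLists (S g) c) := by
  induction c with
  | zero => exact const _
  | succ c ih =>
    refine ih.append (flatMap (f := fun g t => (S g).map fun v => v :: t) ?_ ih)
    exact map (f := fun (p : γ × List ℕ) v => v :: p.2)
      (PolyTime.id.snd.cons PolyTime.id.fst.snd) (hS.comp PolyTime.id.fst)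

theorem esize_foldl_greedyStep (A : ℕ → ℕ → Bool) (d : ℕ) (l : List (List ℕ)) (W : List ℕ) :
    esize (l.foldl (greedyStep A d) W) ≤ esize W + esize l := by
  induction l generalizing W with
  | nil => exact Nat.le_add_right _ _
  | cons t l ih =>
    refine (ih _).trans ?_
    have h1 : esize (greedyStep A d W t) ≤ esize W + esize t := by
      unfold greedyStep
      split_ifs
      · exact Nat.le_add_right _ _
      · have := esize_append t W; omega
    rw [esize_cons]
    omega

theorem greedyModulator (d c : ℕ) (hx : PolyTime x) (hS : PolyTime S) :
    PolyTime (fun g => greedyModulator (x g).adj d c (S g)) := by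
  have hl := shortLists c hS
  refine foldl (f := fun g => greedyStep (x g).adj d)
    (S := fun g => 1 + esize (ParamComplexity.shortLists (S g) c)) ?_ hl (const [])
    ((PolyBound.const 1).add hl.size) fun g l₁ l₂ h => ?_
  · refine ite (treedepthTest d (hx.comp PolyTime.id.fst.fst) ?_) PolyTime.id.snd
      (PolyTime.id.fst.snd.append PolyTime.id.snd)
    exact filter (f := fun (p : (γ × List ℕ) × List ℕ) v => !decide (v ∈ p.2))
      (PolyTime.id.snd.mem PolyTime.id.fst.snd).not PolyTime.id.fst.snd
  · refine (esize_foldl_greedyStep _ _ _ _).trans ?_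
    rw [h]
    exact Nat.add_le_add_left (esize_le_of_sublist (List.sublist_append_left _ _)) _

end PolyTime

end ParamComplexity

namespace ParamComplexity
open Enc (enc)

/-! ## Layered formulas and their circuits -/

/-- Formulas with `j` alternations: a conjunction of disjunctions of formulas with `j - 1`
alternations. A formula without alternations is the number of a gate. -/
def Formula : ℕ → Type
  | 0 => ℕ
  | j + 1 => List (List (Formula j))

namespace Formula

/-- The formula that consists of a gate. -/
def lit (i : ℕ) : Formula 0 := i

/-- The gate of a formula without alternations. -/
def gate (f : Formula 0) : ℕ := f

/-- The conjunction of disjunctions. -/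
def mk {j : ℕ} (l : List (List (Formula j))) : Formula (j + 1) := l

/-- The disjunctions that constitute a formula. -/
def clauses {j : ℕ} (f : Formula (j + 1)) : List (List (Formula j)) := f

@[simp] theorem gate_lit (i : ℕ) : gate (lit i) = i := rfl

@[simp] theorem clauses_mk {j : ℕ} (l : List (List (Formula j))) : clauses (mk l) = l := rfl

/-- A gate as a formula with `j` alternations. -/
def embed : ∀ j, ℕ → Formula j
  | 0, i => lit i
  | j + 1, i => mk [[embed j i]]

/-- The truth value of a formula. -/
def Eval (v : ℕ → Prop) : ∀ j, Formula j → Prop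
  | 0, f => v (gate f)
  | j + 1, f => ∀ l ∈ clauses f, ∃ g ∈ l, Eval v j g

/-- All gates that occur in the formula have a number less than `n`. -/
def GatesLT (n : ℕ) : ∀ j, Formula j → Prop
  | 0, f => gate f < n
  | j + 1, f => ∀ l ∈ clauses f, ∀ g ∈ l, GatesLT n j g

theorem eval_embed {v : ℕ → Prop} {j i : ℕ} : Eval v j (embed j i) ↔ v i := by
  induction j with
  | zero => rfl
  | succ j ih => simp [Eval, embed, ih]

theorem gatesLT_embed {n j i : ℕ} : GatesLT n j (embed j i) ↔ i < n := by
  induction j with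
  | zero => rfl
  | succ j ih => simp [GatesLT, embed, ih]

/-- The representation of formulas. -/
def encode : ∀ j, Formula j → Data
  | 0, f => enc (gate f)
  | j + 1, f => Data.ofList ((clauses f).map fun l => Data.ofList (l.map (encode j)))

instance (j : ℕ) : Enc (Formula j) := ⟨encode j⟩

end Formula

/-- Appends gates with given predecessors, and returns their numbers. -/
def addGates (mk : List ℕ → Gate) (gs : List Gate) (ls : List (List ℕ)) : List Gate × List ℕ :=
  (gs ++ ls.map mk, (List.range ls.length).map fun i => gs.length + i)

/-- Appends gates that compute the given formulas, and returns the numbers of the gates that hold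
the results. -/
def addFormulas (gs : List Gate) : ∀ j, List (Formula j) → List Gate × List ℕ
  | 0, fs => (gs, fs.map Formula.gate)
  | j + 1, fs =>
    let r := addFormulas gs j (fs.map Formula.clauses).flatten.flatten
    let s := addGates Gate.disj r.1
      (((fs.map Formula.clauses).flatten.map List.length).splitLengths r.2)
    addGates Gate.conj s.1 (((fs.map Formula.clauses).map List.length).splitLengths s.2)

/-- Gates are created for the flattened list of all subformulas at once; cutting the list of their
numbers by the old block lengths restores the grouping. -/
theorem forall₂_splitLengths {α β : Type*} {R : α → β → Prop} {xs : List (List α)} {l : List β}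
    (h : List.Forall₂ R xs.flatten l) :
    List.Forall₂ (List.Forall₂ R) xs ((xs.map List.length).splitLengths l) := by
  induction xs generalizing l with
  | nil => simp
  | cons x xs ih =>
    rw [List.map_cons, List.splitLengths_cons]
    rw [List.flatten_cons] at h
    refine .cons ?_ (ih ?_)
    · simpa using List.forall₂_take x.length h
    · simpa using List.forall₂_drop x.length h

theorem Forall₂.comp {α β γ : Type*} {R : α → β → Prop} {Q : β → γ → Prop} {T : α → γ → Prop}
    (hT : ∀ a b c, R a b → Q b c → T a c) {l : List α} {m : List β} {n : List γ}
    (h : List.Forall₂ R l m) (h' : List.Forall₂ Q m n) : List.Forall₂ T l n := by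
  induction h generalizing n with
  | nil => cases h'; exact .nil
  | cons hab _ ih => cases h' with | cons hbc h' => exact .cons (hT _ _ _ hab hbc) (ih h')

/-- Each gate only reads gates of smaller number and level, and large gates have level at
least 2. -/
def Leveled (gs : List Gate) (lev : ℕ → ℕ) : Prop :=
  ∀ i g, gs[i]? = some g →
    (∀ k ∈ g.preds, k < i ∧ lev k < lev i) ∧ (2 < g.preds.length → 2 ≤ lev i)

/-- All new gates read only old gates, so a single new level `L + 1` serves them all. It is at least
2, whatever their fan-in. -/
theorem addGates_leveled {mk : List ℕ → Gate} (hmk : ∀ l, (mk l).preds = l) {gs : List Gate}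
    {ls : List (List ℕ)} {lev : ℕ → ℕ} {L : ℕ} (hL : 1 ≤ L) (hlev : Leveled gs lev)
    (hle : ∀ i < gs.length, lev i ≤ L) (hls : ∀ l ∈ ls, ∀ k ∈ l, k < gs.length) :
    ∃ lev', Leveled (addGates mk gs ls).1 lev' ∧
      ∀ i < (addGates mk gs ls).1.length, lev' i ≤ L + 1 := by
  refine ⟨fun i => if i < gs.length then lev i else L + 1, ?_, ?_⟩
  · intro i g hg
    by_cases hi : i < gs.length
    · have hg' : gs[i]? = some g := by
        rw [← hg]; exact (List.getElem?_append_left hi).symm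
      obtain ⟨h1, h2⟩ := hlev i g hg'
      refine ⟨fun k hk => ⟨(h1 k hk).1, ?_⟩, by simpa [hi] using h2⟩
      have := (h1 k hk).1.trans hi
      simpa [hi, this] using (h1 k hk).2
    · have hg' : (ls.map mk)[i - gs.length]? = some g := by
        rw [← hg]; exact (List.getElem?_append_right (not_lt.1 hi)).symm
      obtain ⟨l, hl, rfl⟩ := List.mem_map.1 (List.mem_of_getElem? hg')
      rw [hmk]
      refine ⟨fun k hk => ?_, fun _ => by simp [hi]; omega⟩
      have := hls l hl k hk
      refine ⟨by omega, ?_⟩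
      have h3 := hle k this
      simp only [this, hi, if_true, if_false]
      omega
  · intro i _
    dsimp only
    split_ifs with hi
    · exact (hle i hi).trans (Nat.le_succ _)
    · exact le_rfl

theorem addGates_lt {mk : List ℕ → Gate} {gs : List Gate} {ls : List (List ℕ)} :
    ∀ i ∈ (addGates mk gs ls).2, i < (addGates mk gs ls).1.length := by
  intro i hi
  simp only [addGates, List.mem_map, List.mem_range, List.length_append, List.length_map] at *
  obtain ⟨a, ha, rfl⟩ := hi
  omega

theorem addGates_forall₂ {mk : List ℕ → Gate} {gs : List Gate} {ls : List (List ℕ)} :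
    List.Forall₂ (fun l i => (addGates mk gs ls).1[i]? = some (mk l)) ls
      (addGates mk gs ls).2 := by
  rw [List.forall₂_iff_get]
  refine ⟨by simp [addGates], fun i h1 h2 => ?_⟩
  simp [addGates, h1]

theorem mem_splitLengths {sz : List ℕ} {l m : List ℕ} (h : m ∈ sz.splitLengths l) :
    ∀ k ∈ m, k ∈ l := by
  induction sz generalizing l with
  | nil => simp at h
  | cons n sz ih =>
    rw [List.splitLengths_cons, List.mem_cons] at h
    rcases h with rfl | h
    · exact fun k hk => List.mem_of_mem_take hk
    · exact fun k hk => List.mem_of_mem_drop (ih h k hk)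

theorem addFormulas_prefix (gs : List Gate) (j : ℕ) (fs : List (Formula j)) :
    gs <+: (addFormulas gs j fs).1 := by
  induction j with
  | zero => exact List.prefix_rfl
  | succ j ih =>
    exact (ih _).trans ((List.prefix_append _ _).trans (List.prefix_append _ _))

/-- Each alternation adds two levels, one of disjunctions and one of conjunctions, on top of the
literals at levels 0 and 1. -/
theorem addFormulas_leveled {gs : List Gate} {lev : ℕ → ℕ} (hlev : Leveled gs lev)
    (hle : ∀ i < gs.length, lev i ≤ 1) (j : ℕ) (fs : List (Formula j))
    (hfs : ∀ f ∈ fs, Formula.GatesLT gs.length j f) :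
    (∀ i ∈ (addFormulas gs j fs).2, i < (addFormulas gs j fs).1.length) ∧
    ∃ lev', Leveled (addFormulas gs j fs).1 lev' ∧
      ∀ i < (addFormulas gs j fs).1.length, lev' i ≤ 2 * j + 1 := by
  induction j with
  | zero =>
    refine ⟨fun i hi => ?_, lev, hlev, hle⟩
    obtain ⟨f, hf, rfl⟩ := List.mem_map.1 hi
    exact hfs f hf
  | succ j ih =>
    obtain ⟨h1, lev1, h2, h3⟩ := ih (fs.map Formula.clauses).flatten.flatten fun g hg => by
      simp only [List.mem_flatten, List.mem_map] at hg
      obtain ⟨l, ⟨_, ⟨f, hf, rfl⟩, hl⟩, hg⟩ := hg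
      exact hfs f hf l hl g hg
    obtain ⟨lev2, h4, h5⟩ := addGates_leveled (mk := Gate.disj)
      (ls := (((fs.map Formula.clauses).flatten.map List.length).splitLengths
        (addFormulas gs j (fs.map Formula.clauses).flatten.flatten).2)) (fun _ => rfl)
      (by omega) h2 h3 fun l hl k hk => h1 k (mem_splitLengths hl k hk)
    obtain ⟨lev3, h6, h7⟩ := addGates_leveled (mk := Gate.conj)
      (ls := ((fs.map Formula.clauses).map List.length).splitLengths (addGates Gate.disj
        (addFormulas gs j (fs.map Formula.clauses).flatten.flatten).1
        (((fs.map Formula.clauses).flatten.map List.length).splitLengths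
        (addFormulas gs j (fs.map Formula.clauses).flatten.flatten).2)).2) (fun _ => rfl)
      (by omega) h4 h5 fun l hl k hk => addGates_lt k (mem_splitLengths hl k hk)
    exact ⟨fun i hi => addGates_lt i hi, lev3, h6, h7⟩

theorem addGates_ne_input {mk : List ℕ → Gate} (hmk : ∀ l, mk l ≠ Gate.input) {gs : List Gate}
    {ls : List (List ℕ)} {i : ℕ} (h : (addGates mk gs ls).1[i]? = some Gate.input) :
    gs[i]? = some Gate.input := by
  rcases lt_or_ge i gs.length with hi | hi
  · rw [← h]; exact (List.getElem?_append_left hi).symm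
  · rw [addGates, List.getElem?_append_right hi] at h
    obtain ⟨l, -, hl⟩ := List.mem_map.1 (List.mem_of_getElem? h)
    exact absurd hl (hmk l)

theorem addFormulas_ne_input {gs : List Gate} {j : ℕ} {fs : List (Formula j)} {i : ℕ}
    (h : (addFormulas gs j fs).1[i]? = some Gate.input) : gs[i]? = some Gate.input := by
  induction j with
  | zero => exact h
  | succ j ih => exact ih (addGates_ne_input (by simp) (addGates_ne_input (by simp) h))

theorem getElem?_eq_some_of_prefix {α : Type*} {l m : List α} (h : l <+: m) {i : ℕ} {a : α}
    (hi : l[i]? = some a) : m[i]? = some a := by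
  obtain ⟨t, rfl⟩ := h
  obtain ⟨hlt, -⟩ := List.getElem?_eq_some_iff.1 hi
  rw [List.getElem?_append_left hlt, hi]

theorem addFormulas_forall₂ {gs : List Gate} {j : ℕ} {fs : List (Formula j)} {v : ℕ → Prop}
    (hv : ∀ (i : ℕ) (g : Gate), (addFormulas gs j fs).1[i]? = some g → g.Holds v (v i)) :
    List.Forall₂ (fun f i => Formula.Eval v j f ↔ v i) fs (addFormulas gs j fs).2 := by
  induction j with
  | zero =>
    rw [show (addFormulas gs 0 fs).2 = fs.map Formula.gate from rfl, List.forall₂_map_right_iff]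
    exact List.forall₂_same.2 fun f _ => Iff.rfl
  | succ j ih =>
    have hs : ∀ (i : ℕ) (g : Gate), (addGates Gate.disj
        (addFormulas gs j (fs.map Formula.clauses).flatten.flatten).1
        (((fs.map Formula.clauses).flatten.map List.length).splitLengths
        (addFormulas gs j (fs.map Formula.clauses).flatten.flatten).2)).1[i]? = some g →
        g.Holds v (v i) := fun i g h => hv i g (getElem?_eq_some_of_prefix (List.prefix_append _ _) h)
    have hr : ∀ (i : ℕ) (g : Gate), (addFormulas gs j (fs.map Formula.clauses).flatten.flatten).1[i]? = some g →
        g.Holds v (v i) := fun i g h => hs i g (getElem?_eq_some_of_prefix (List.prefix_append _ _) h)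
    have h1 := forall₂_splitLengths (ih hr)
    have h2 := Forall₂.comp (T := fun l i => (∃ g ∈ l, Formula.Eval v j g) ↔ v i)
      (fun l is i hl hi => by
        have := hs i _ hi
        rw [Gate.Holds] at this
        rw [this]
        clear this hi
        induction hl with
        | nil => simp
        | cons h _ ih => simp [h, ih]) h1 addGates_forall₂
    have h3 := forall₂_splitLengths h2
    rw [List.forall₂_map_left_iff] at h3
    exact Forall₂.comp (fun f is i hl hi => by
        have := hv i _ hi
        rw [Gate.Holds] at this
        rw [this, Formula.Eval]
        clear this hi
        generalize f.clauses = l at hl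
        induction hl with
        | nil => simp
        | cons h _ ih => simp [h, ih]) h3 addGates_forall₂

theorem Gate.holds_congr {v w : ℕ → Prop} {b : Prop} {g : Gate}
    (h : ∀ k ∈ g.preds, v k ↔ w k) : g.Holds v b ↔ g.Holds w b := by
  cases g with
  | input => rfl
  | neg i => simp only [Gate.Holds, h i (by simp [Gate.preds])]
  | conj is => exact iff_congr Iff.rfl (forall₂_congr h)
  | disj is =>
    exact iff_congr Iff.rfl (exists_congr fun k => and_congr_right (h k))

/-- The values of the input gates can be chosen freely. -/
theorem Circuit.exists_consistent (C : Circuit) (a : ℕ → Prop) :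
    ∃ v, C.Consistent v ∧ ∀ i, C.gates[i]? = some .input → (v i ↔ a i) := by
  have H : ∀ n, ∃ v : ℕ → Prop, ∀ i < n, ∀ g, C.gates[i]? = some g →
      g.Holds v (v i) ∧ (g = .input → (v i ↔ a i)) := by
    intro n
    induction n with
    | zero => exact ⟨fun _ => True, by simp⟩
    | succ n ih =>
      obtain ⟨v, hv⟩ := ih
      obtain ⟨b, hb⟩ : ∃ b : Prop, ∀ g, C.gates[n]? = some g →
          g.Holds v b ∧ (g = .input → (b ↔ a n)) := by
        cases hg : C.gates[n]? with
        | none => exact ⟨True, by simp⟩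
        | some g =>
          cases g with
          | input => exact ⟨a n, by simp [Gate.Holds]⟩
          | neg i => exact ⟨¬ v i, by simp [Gate.Holds]⟩
          | conj is => exact ⟨∀ i ∈ is, v i, by simp [Gate.Holds]⟩
          | disj is => exact ⟨∃ i ∈ is, v i, by simp [Gate.Holds]⟩
      have hup : ∀ k < n, (Function.update v n b) k = v k := fun k hk =>
        Function.update_of_ne hk.ne _ _
      refine ⟨Function.update v n b, fun i hi g hg => ?_⟩
      have hc : ∀ k ∈ g.preds, (Function.update v n b) k ↔ v k := fun k hk => by
        rw [hup k ((C.preds_lt i g hg k hk).trans_le (Nat.lt_succ_iff.1 hi))]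
      rw [Gate.holds_congr hc]
      rcases Nat.lt_succ_iff_lt_or_eq.1 hi with hi | rfl
      · rw [hup i hi]; exact hv i hi g hg
      · rw [Function.update_self]; exact hb g hg
  obtain ⟨v, hv⟩ := H C.gates.length
  have hlt : ∀ {i g}, C.gates[i]? = some g → i < C.gates.length := fun h => by
    obtain ⟨h, -⟩ := List.getElem?_eq_some_iff.1 h; exact h
  exact ⟨v, fun i g hg => (hv i (hlt hg) g hg).1, fun i hi => (hv i (hlt hi) _ hi).2 rfl⟩

/-! ### Depth and weft of leveled circuits -/

theorem Leveled.chain {C : Circuit} {lev : ℕ → ℕ} (h : Leveled C.gates lev) {p : List ℕ}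
    (hp : p.IsChain C.Wire) : (p.map lev).Pairwise (· < ·) := by
  rw [← List.isChain_iff_pairwise, List.isChain_map]
  refine hp.imp ?_
  rintro i j ⟨g, hg, hi⟩
  exact ((h j g hg).1 i hi).2

theorem Leveled.depthLE {C : Circuit} {lev : ℕ → ℕ} {L : ℕ} (h : Leveled C.gates lev)
    (hL : ∀ i < C.gates.length, lev i ≤ L) : C.DepthLE L := by
  intro p hp
  by_cases hall : ∀ i ∈ p, i < C.gates.length
  · have hn : (p.map lev).Nodup := (h.chain hp).imp fun h => h.ne
    have hsub : (p.map lev) ⊆ List.range (L + 1) := by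
      intro a ha
      obtain ⟨i, hi, rfl⟩ := List.mem_map.1 ha
      exact List.mem_range.2 (Nat.lt_succ_of_le (hL i (hall i hi)))
    simpa using (hn.subperm hsub).length_le
  -- A list with a single entry is a path even if the entry is not the number of a gate. No wire
  -- touches such a number, so the path has no further entries.
  · push Not at hall
    obtain ⟨i, hi, hilen⟩ := hall
    obtain ⟨l, r, rfl⟩ := List.append_of_mem hi
    have hlt : ∀ {a b}, C.Wire a b → a < C.gates.length ∧ b < C.gates.length := by
      rintro a b ⟨g, hg, ha⟩
      obtain ⟨hb, -⟩ := List.getElem?_eq_some_iff.1 hg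
      exact ⟨(C.preds_lt b g hg a ha).trans hb, hb⟩
    have hr : r = [] := by
      cases r with
      | nil => rfl
      | cons b r =>
        have := (List.isChain_cons_cons.1 hp.right_of_append).1
        exact absurd (hlt this).1 (by omega)
    have hl : l = [] := by
      rcases List.eq_nil_or_concat l with rfl | ⟨l, a, rfl⟩
      · rfl
      · rw [List.concat_eq_append, List.append_assoc] at hp
        have := (List.isChain_cons_cons.1 hp.right_of_append).1
        exact absurd (hlt this).2 (by omega)
    simp [hl, hr]

theorem Leveled.weftLE {C : Circuit} {lev : ℕ → ℕ} {L : ℕ} (h : Leveled C.gates lev)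
    (hL : ∀ i < C.gates.length, lev i ≤ L + 1) : C.WeftLE L := by
  intro p hp
  rw [List.countP_eq_length_filter]
  have hlarge : ∀ i ∈ p.filter C.isLarge, 2 ≤ lev i ∧ lev i ≤ L + 1 := by
    intro i hi
    have hi := (List.mem_filter.1 hi).2
    rw [Circuit.isLarge] at hi
    cases hg : C.gates[i]? with
    | none => simp [hg] at hi
    | some g =>
      rw [hg] at hi
      obtain ⟨hb, -⟩ := List.getElem?_eq_some_iff.1 hg
      exact ⟨(h i g hg).2 (by simpa using hi), hL i hb⟩
  -- Large gates on a path have distinct levels between 2 and `L + 1`, which leaves `L` values. The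
  -- negations at level 1 have fan-in 1 and do not count.
  have hn : ((p.filter C.isLarge).map lev).Nodup :=
    ((h.chain hp).imp fun h => h.ne).sublist (List.filter_sublist.map lev)
  have hsub : ((p.filter C.isLarge).map lev) ⊆ (List.range L).map (· + 2) := by
    intro a ha
    obtain ⟨i, hi, rfl⟩ := List.mem_map.1 ha
    have := hlarge i hi
    exact List.mem_map.2 ⟨lev i - 2, List.mem_range.2 (by omega), by omega⟩
  simpa using (hn.subperm hsub).length_le

/-! ### Construction of the gates in polynomial time -/

namespace PolyTime

variable {α β γ : Type} [Enc α] [Enc β] [Enc γ]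

theorem mk {j : ℕ} {l : γ → List (List (Formula j))} (hl : PolyTime l) :
    PolyTime (fun g => Formula.mk (l g)) :=
  hl.of_enc_eq fun _ => rfl

theorem clauses {j : ℕ} {f : γ → Formula (j + 1)} (hf : PolyTime f) :
    PolyTime (fun g => Formula.clauses (f g)) :=
  hf.of_enc_eq fun _ => rfl

theorem gate {f : γ → Formula 0} (hf : PolyTime f) : PolyTime (fun g => Formula.gate (f g)) :=
  hf.of_enc_eq fun _ => rfl

theorem lit {i : γ → ℕ} (hi : PolyTime i) : PolyTime (fun g => Formula.lit (i g)) :=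
  hi.of_enc_eq fun _ => rfl

theorem embed (j : ℕ) {i : γ → ℕ} (hi : PolyTime i) :
    PolyTime (fun g => Formula.embed j (i g)) := by
  induction j with
  | zero => exact hi.lit
  | succ j ih => exact ((ih.cons (const [])).cons (const [])).mk

theorem gateNeg {i : γ → ℕ} (hi : PolyTime i) : PolyTime (fun g => Gate.neg (i g)) :=
  ((const (Data.ofUnary 1)).dataCons (toEnc.comp hi)).of_enc_eq fun _ => rfl

theorem gateConj {l : γ → List ℕ} (hl : PolyTime l) : PolyTime (fun g => Gate.conj (l g)) :=
  ((const (Data.ofUnary 2)).dataCons (toEnc.comp hl)).of_enc_eq fun _ => rfl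

theorem gateDisj {l : γ → List ℕ} (hl : PolyTime l) : PolyTime (fun g => Gate.disj (l g)) :=
  ((const (Data.ofUnary 3)).dataCons (toEnc.comp hl)).of_enc_eq fun _ => rfl

theorem splitLengths {s : γ → List ℕ} {l : γ → List α} (hs : PolyTime s) (hl : PolyTime l) :
    PolyTime (fun g => (s g).splitLengths (l g)) := by
  have e : ∀ (s : List ℕ) (l : List α) (acc : List (List α)),
      s.foldl (fun st n => (st.1 ++ [st.2.take n], st.2.drop n)) (acc, l) =
        (acc ++ s.splitLengths l, l.drop s.sum) := by
    intro s
    induction s with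
    | nil => simp
    | cons n s ih => intro l acc; rw [List.foldl_cons, ih]; simp
  have e2 : ∀ (s : List ℕ) (l : List α),
      esize (s.splitLengths l) + esize (l.drop s.sum) ≤ esize l + 2 * s.length + 1 := by
    intro s
    induction s with
    | nil => intro l; simp; omega
    | cons n s ih =>
      intro l
      have h1 := ih (l.drop n)
      have h2 := esize_append (l.take n) (l.drop n)
      rw [List.take_append_drop] at h2
      rw [List.drop_drop] at h1
      simp only [List.splitLengths_cons, esize_cons, List.sum_cons, List.length_cons]
      omega
  have h : PolyTime (fun g => (s g).foldl (fun (st : List (List α) × List α) n =>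
      (st.1 ++ [st.2.take n], st.2.drop n)) ([], l g)) := by
    refine foldl (f := fun _ (st : List (List α) × List α) n =>
      (st.1 ++ [st.2.take n], st.2.drop n)) (S := fun g => esize (l g) + 2 * esize (s g) + 2)
      ((PolyTime.id.snd.fst.append
        ((PolyTime.id.fst.snd.take PolyTime.id.snd.snd).cons (const []))).pair
        (PolyTime.id.fst.snd.drop PolyTime.id.snd.snd)) hs ((const []).pair hl)
      ((hl.size.add ((PolyBound.const 2).mul hs.size)).add (.const 2)) fun g l₁ l₂ h => ?_
    rw [e, esize_pair, List.nil_append]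
    have h1 := e2 l₁ (l g)
    have h2 := length_lt_esize (s g)
    rw [h, List.length_append] at h2
    rw [h]
    omega
  simpa only [e, List.nil_append] using h.fst

theorem addGates {mk : List ℕ → Gate} {gs : γ → List Gate} {ls : γ → List (List ℕ)}
    (hmk : PolyTime mk) (hgs : PolyTime gs) (hls : PolyTime ls) :
    PolyTime (fun g => addGates mk (gs g) (ls g)) :=
  (hgs.append (map (f := fun _ l => mk l) (hmk.comp PolyTime.id.snd) hls)).pair
    (map (f := fun g i => (gs g).length + i)
      ((hgs.length.comp PolyTime.id.fst).natAdd PolyTime.id.snd) hls.length.range)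

theorem addFormulas {gs : γ → List Gate} {j : ℕ} {fs : γ → List (Formula j)} (hgs : PolyTime gs)
    (hfs : PolyTime fs) : PolyTime (fun g => addFormulas (gs g) j (fs g)) := by
  induction j with
  | zero => exact hgs.pair (map (f := fun _ f => Formula.gate f) PolyTime.id.snd.gate hfs)
  | succ j ih =>
    have hc : PolyTime (fun g => (fs g).map Formula.clauses) :=
      map (f := fun _ f => Formula.clauses f) PolyTime.id.snd.clauses hfs
    have hr := ih hc.flatten.flatten
    have hs := addGates (mk := Gate.disj) PolyTime.id.gateDisj hr.fst
      (splitLengths (map (f := fun _ l => List.length l) PolyTime.id.snd.length hc.flatten) hr.snd)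
    exact addGates (mk := Gate.conj) PolyTime.id.gateConj hs.fst
      (splitLengths (map (f := fun _ l => List.length l) PolyTime.id.snd.length hc) hs.snd)

end PolyTime

end ParamComplexity

namespace ParamComplexity
open Enc (enc)

/-! ## The formula of an instance of List Coloring -/

/-- At most `n` of the lists that choose one entry from each of the given lists, and all of them
if there are no more than `n`. -/
def boundedSections (n : ℕ) (ls : List (List ℕ)) : List (List ℕ) :=
  ls.foldr (fun l acc => (acc.flatMap fun s => l.map fun a => a :: s).take n) [[]]

theorem mem_of_mem_boundedSections {n : ℕ} {ls : List (List ℕ)} {s : List ℕ}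
    (hs : s ∈ boundedSections n ls) : ∀ a ∈ s, ∃ l ∈ ls, a ∈ l := by
  induction ls generalizing s with
  | nil =>
    have : s = [] := List.mem_singleton.1 hs
    simp [this]
  | cons l ls ih =>
    have hs' := List.mem_of_mem_take hs
    simp only [List.mem_flatMap, List.mem_map] at hs'
    obtain ⟨t, ht, b, hb, rfl⟩ := hs'
    intro a ha
    rcases List.mem_cons.1 ha with rfl | ha
    · exact ⟨l, List.mem_cons_self, hb⟩
    · obtain ⟨l', hl', h⟩ := ih ht a ha
      exact ⟨l', List.mem_cons_of_mem _ hl', h⟩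

/-- The number of sections is at most `K ^ ls.length` and does not exceed `n` at any intermediate
stage, so the truncation, which serves only to keep the computation polynomial in `n`, has no
effect. -/
theorem boundedSections_eq {n K : ℕ} (hK : 1 ≤ K) {ls : List (List ℕ)}
    (hls : ∀ l ∈ ls, l.length ≤ K) (hn : K ^ ls.length ≤ n) :
    boundedSections n ls = ls.sections ∧ ls.sections.length ≤ K ^ ls.length := by
  induction ls with
  | nil => simp [boundedSections, List.sections]
  | cons l ls ih =>
    rw [List.length_cons, pow_succ] at hn
    have h1 : K ^ ls.length ≤ K ^ ls.length * K := Nat.le_mul_of_pos_right _ hK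
    obtain ⟨h2, h3⟩ := ih (fun l hl => hls l (List.mem_cons_of_mem _ hl)) (h1.trans hn)
    have hlen : ((ls.sections.flatMap fun s => l.map fun a => a :: s)).length ≤
        K ^ ls.length * K := by
      simp only [List.length_flatMap, List.length_map, List.map_const', List.sum_replicate,
        smul_eq_mul]
      exact Nat.mul_le_mul h3 (hls l List.mem_cons_self)
    refine ⟨?_, by rw [List.length_cons, pow_succ]; exact hlen⟩
    change (List.flatMap _ (boundedSections n ls)).take n = _
    rw [h2, List.take_of_length_le (hlen.trans hn)]
    rfl

/-- The distributive law: if every list had an entry violating `Q`, the section made of these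
entries would violate the left side. It rewrites a disjunction of conjunctions as a conjunction of
disjunctions at the lowest level. -/
theorem forall_sections_exists {ls : List (List ℕ)} {Q : ℕ → Prop} :
    (∀ s ∈ ls.sections, ∃ a ∈ s, Q a) ↔ ∃ l ∈ ls, ∀ a ∈ l, Q a := by
  induction ls with
  | nil => simp [List.sections]
  | cons l ls ih =>
    simp only [List.sections, List.mem_flatMap, List.mem_map, List.mem_cons,
      exists_eq_or_imp, ← ih]
    constructor
    · intro h
      by_contra! hno
      obtain ⟨⟨a, ha, hQa⟩, s, hs, hQs⟩ := hno
      obtain ⟨b, hb, hQb⟩ := h (a :: s) ⟨s, hs, a, ha, rfl⟩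
      rcases List.mem_cons.1 hb with rfl | hb
      · exact hQa hQb
      · exact hQs b hb hQb
    · rintro (h | h) _ ⟨s, hs, a, ha, rfl⟩
      · exact ⟨a, List.mem_cons_self, h a ha⟩
      · obtain ⟨b, hb, hQb⟩ := h s hs
        exact ⟨b, List.mem_cons_of_mem _ hb, hQb⟩

namespace RawInstance

variable (x : RawInstance) (P : List (ℕ × List Bool)) (k n : ℕ)

/-- The pairs of a vertex of `W` and one of its colors. -/
def inputs (W : List ℕ) : List (ℕ × List Bool) :=
  W.flatMap fun w => (x.cols w).map fun c => (w, c)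

/-- The vertex of an input. -/
def inputVertex (P : List (ℕ × List Bool)) (i : ℕ) : ℕ := (P.getD i (0, [])).1

/-- The color of an input. -/
def inputColor (P : List (ℕ × List Bool)) (i : ℕ) : List Bool := (P.getD i (0, [])).2

/-- The colors of `u` that are not excluded by the colored vertices in `env`. -/
def avail (u : ℕ) (env : List (ℕ × List Bool)) : List (List Bool) :=
  (x.cols u).filter fun c => !(env.any fun e => x.adj u e.1 && decide (e.2 = c))

/-- The numbers of the inputs that exclude the color `c` for the vertex `u`. -/
def blockers (u : ℕ) (c : List Bool) : List ℕ :=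
  (List.range P.length).filter fun i =>
    x.adj u (inputVertex P i) && decide (inputColor P i = c)

/-- The possible roots of the component of `u` in an elimination forest of depth `j + 1`. -/
def roots (j : ℕ) (S : List ℕ) (u : ℕ) : List ℕ :=
  (compList x.adj S u).filter fun v =>
    treedepthTest x.adj j (removeElem v (compList x.adj S u))

/-- The formula for the extendability of a partial coloring to the vertices in `S`, which induce
a graph of treedepth at most `j + 1`; the vertices in `env` are already colored. -/
def extensionFormula : ∀ j, List ℕ → List (ℕ × List Bool) → Formula (j + 1)
  | 0, S, env => Formula.mk (S.flatMap fun u =>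
      -- With more than `k = |W|` available colors some color is always free, so no clause is
      -- needed. Otherwise the condition that some color has all its blockers false is multiplied
      -- out; gate `P.length + i` is the negation of input `i`.
      if decide ((x.avail u env).length ≤ k) = true then
        (boundedSections n ((x.avail u env).map fun c =>
          (x.blockers P u c).map fun i => P.length + i)).map fun s => s.map Formula.lit
      else [])
  | j + 1, S, env => Formula.mk (S.map fun u =>
      (x.roots (j + 1) S u).flatMap fun v =>
        (x.avail v env).map fun c =>
          -- The conjunction over the blockers is joined to the top conjunction of the recursive
          -- formula, so it costs no extra layer. The color of `v` is hard-wired into `env`.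
          Formula.mk (((x.blockers P v c).map fun i => [Formula.embed j (P.length + i)]) ++
            Formula.clauses
              (extensionFormula j (removeElem v (compList x.adj S u)) ((v, c) :: env))))

/-- The formula for the existence of a coloring. -/
def coloringFormula (j : ℕ) (W S : List ℕ) : Formula (j + 1) :=
  Formula.mk (Formula.clauses (x.extensionFormula P k n j S []) ++
    -- Besides extendability: each vertex of `W` has a true input, and two inputs that give adjacent
    -- vertices of `W` the same color are not both true.
    ((W.map fun w => ((List.range P.length).filter fun i =>
      decide (inputVertex P i = w)).map fun i => Formula.embed j i) ++
    (List.range P.length).flatMap fun i =>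
      (x.blockers P (inputVertex P i) (inputColor P i)).map fun i' =>
        [Formula.embed j (P.length + i), Formula.embed j (P.length + i')]))

/-- The coloring `f` of `W` can be extended to the vertices in `S` such that there is no conflict
with the colored vertices in `env`. -/
def Extendable (W : List ℕ) (f : ℕ → List Bool) (S : Set ℕ) (env : List (ℕ × List Bool)) : Prop :=
  ∃ g : ℕ → List Bool, ∀ u ∈ S, g u ∈ x.cols u ∧ (∀ w ∈ W, x.adj u w = true → f w ≠ g u) ∧
    (∀ e ∈ env, x.adj u e.1 = true → e.2 ≠ g u) ∧ ∀ v ∈ S, x.adj u v = true → g u ≠ g v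

variable {x P k n}

theorem mem_avail {u : ℕ} {env : List (ℕ × List Bool)} {c : List Bool} :
    c ∈ x.avail u env ↔ c ∈ x.cols u ∧ ∀ e ∈ env, x.adj u e.1 = true → e.2 ≠ c := by
  simp [avail]

theorem mem_blockers {u i : ℕ} {c : List Bool} :
    i ∈ x.blockers P u c ↔
      i < P.length ∧ x.adj u (inputVertex P i) = true ∧ inputColor P i = c := by
  simp [blockers]

theorem compSet_eq_of_mem {A : ℕ → ℕ → Prop} (hA : ∀ a b, A a b → A b a) {S : Set ℕ} {u v : ℕ}
    (hu : u ∈ S) (hv : v ∈ compSet A S u) : compSet A S v = compSet A S u := by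
  have hback : u ∈ compSet A S v := by
    induction hv with
    | refl => exact self_mem_compSet _ _ _
    | tail hb h ih =>
      exact Relation.ReflTransGen.head ⟨hA _ _ h.1, compSet_subset hu hb⟩ ih
  ext w
  exact ⟨fun hw => Relation.ReflTransGen.trans hv hw,
    fun hw => Relation.ReflTransGen.trans hback hw⟩

/-- Components do not interact, so their extensions can be glued. -/
theorem extendable_iff_forall_compSet (hsymm : ∀ u v, x.adj u v = x.adj v u) {W : List ℕ}
    {f : ℕ → List Bool} {S : Set ℕ} {env : List (ℕ × List Bool)} :
    x.Extendable W f S env ↔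
      ∀ u ∈ S, x.Extendable W f (compSet (fun a b => x.adj a b = true) S u) env := by
  constructor
  · rintro ⟨g, hg⟩ u hu
    refine ⟨g, fun v hv => ?_⟩
    obtain ⟨h1, h2, h3, h4⟩ := hg v (compSet_subset hu hv)
    exact ⟨h1, h2, h3, fun w hw => h4 w (compSet_subset hu hw)⟩
  · intro h
    have H : ∀ C, x.Extendable W f C env → ∃ g : ℕ → List Bool, ∀ u ∈ C, g u ∈ x.cols u ∧
      (∀ w ∈ W, x.adj u w = true → f w ≠ g u) ∧
      (∀ e ∈ env, x.adj u e.1 = true → e.2 ≠ g u) ∧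
      ∀ v ∈ C, x.adj u v = true → g u ≠ g v := fun _ h => h
    choose! G hG using H
    -- The extensions are chosen as a function of the component as a set, not of the vertex, so
    -- adjacent vertices use the same extension.
    refine ⟨fun u => G (compSet (fun a b => x.adj a b = true) S u) u, fun u hu => ?_⟩
    obtain ⟨h1, h2, h3, h4⟩ := hG _ (h u hu) u (self_mem_compSet _ _ _)
    refine ⟨h1, h2, h3, fun v hv huv => ?_⟩
    have hvC : v ∈ compSet (fun a b => x.adj a b = true) S u := .single ⟨huv, hv⟩
    dsimp only
    rw [compSet_eq_of_mem (fun a b h => by rw [hsymm]; exact h) hu hvC]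
    exact h4 v hvC huv

/-- Once `v` has the color `c`, it acts on the remaining vertices exactly like an entry `(v, c)` of
`env`. -/
theorem extendable_iff_exists_root (hsymm : ∀ u v, x.adj u v = x.adj v u)
    (hirr : ∀ u, x.adj u u = false) {W : List ℕ}
    {f : ℕ → List Bool} {S : Set ℕ} {env : List (ℕ × List Bool)} {v : ℕ} (hv : v ∈ S) :
    x.Extendable W f S env ↔ ∃ c ∈ x.avail v env, (∀ w ∈ W, x.adj v w = true → f w ≠ c) ∧
      x.Extendable W f (S \ {v}) ((v, c) :: env) := by
  constructor
  · rintro ⟨g, hg⟩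
    obtain ⟨h1, h2, h3, h4⟩ := hg v hv
    refine ⟨g v, mem_avail.2 ⟨h1, h3⟩, h2, g, fun u hu => ?_⟩
    obtain ⟨h5, h6, h7, h8⟩ := hg u hu.1
    refine ⟨h5, h6, fun e he hue => ?_, fun w hw => h8 w hw.1⟩
    rcases List.mem_cons.1 he with rfl | he
    · exact (h8 v hv hue).symm
    · exact h7 e he hue
  · rintro ⟨c, hc, h2, g, hg⟩
    obtain ⟨h1, h3⟩ := mem_avail.1 hc
    refine ⟨Function.update g v c, fun u hu => ?_⟩
    by_cases huv : u = v
    · subst huv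
      rw [Function.update_self]
      refine ⟨h1, h2, h3, fun w hw huw => ?_⟩
      have hwu : w ≠ u := by rintro rfl; simp [hirr] at huw
      rw [Function.update_of_ne hwu]
      exact (hg w ⟨hw, hwu⟩).2.2.1 (u, c) List.mem_cons_self (by rw [hsymm]; exact huw)
    · obtain ⟨h5, h6, h7, h8⟩ := hg u ⟨hu, huv⟩
      rw [Function.update_of_ne huv]
      refine ⟨h5, h6, fun e he => h7 e (List.mem_cons_of_mem _ he), fun w hw huw => ?_⟩
      by_cases hwv : w = v
      · subst hwv
        rw [Function.update_self]
        exact (h7 (w, c) List.mem_cons_self huw).symm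
      · rw [Function.update_of_ne hwv]
        exact h8 w ⟨hw, hwv⟩ huw

theorem mem_inputs {W : List ℕ} {e : ℕ × List Bool} :
    e ∈ x.inputs W ↔ e.1 ∈ W ∧ e.2 ∈ x.cols e.1 := by
  obtain ⟨w, c⟩ := e
  simp only [inputs, List.mem_flatMap, List.mem_map, Prod.mk.injEq]
  exact ⟨by rintro ⟨w, hw, c, hc, rfl, rfl⟩; exact ⟨hw, hc⟩, fun h => ⟨w, h.1, c, h.2, rfl, rfl⟩⟩

theorem nodup_inputs {W : List ℕ} (hW : W.Nodup) : (x.inputs W).Nodup := by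
  refine List.nodup_flatMap.2 ⟨fun w _ => ?_, hW.imp fun {a b} hab => ?_⟩
  · exact (nodup_dedupList _).map fun c d h => (Prod.mk.inj h).2
  · intro e h1 h2
    obtain ⟨c, -, rfl⟩ := List.mem_map.1 h1
    obtain ⟨d, -, hd⟩ := List.mem_map.1 h2
    exact hab (Prod.mk.inj hd).1.symm

theorem input_mem {W : List ℕ} {i : ℕ} (hi : i < (x.inputs W).length) :
    inputVertex (x.inputs W) i ∈ W ∧
      inputColor (x.inputs W) i ∈ x.cols (inputVertex (x.inputs W) i) := by
  rw [inputVertex, inputColor, List.getD_eq_getElem _ _ hi]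
  exact mem_inputs.1 (List.getElem_mem hi)

theorem exists_input {W : List ℕ} {w : ℕ} {c : List Bool} (hw : w ∈ W) (hc : c ∈ x.cols w) :
    ∃ i < (x.inputs W).length, inputVertex (x.inputs W) i = w ∧
      inputColor (x.inputs W) i = c := by
  obtain ⟨i, hi, h⟩ := List.getElem_of_mem (mem_inputs.2 ⟨hw, hc⟩ : (w, c) ∈ x.inputs W)
  refine ⟨i, hi, ?_⟩
  rw [inputVertex, inputColor, List.getD_eq_getElem _ _ hi, h]
  exact ⟨rfl, rfl⟩

theorem input_injective {W : List ℕ} (hW : W.Nodup) {i i' : ℕ} (hi : i < (x.inputs W).length)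
    (hi' : i' < (x.inputs W).length)
    (h1 : inputVertex (x.inputs W) i = inputVertex (x.inputs W) i')
    (h2 : inputColor (x.inputs W) i = inputColor (x.inputs W) i') : i = i' := by
  rw [inputVertex, inputVertex, List.getD_eq_getElem _ _ hi, List.getD_eq_getElem _ _ hi'] at h1
  rw [inputColor, inputColor, List.getD_eq_getElem _ _ hi, List.getD_eq_getElem _ _ hi'] at h2
  exact ((nodup_inputs hW).getElem_inj_iff).1 (Prod.ext h1 h2)

/-- All blockers carry the color `c`, so each is determined by its vertex in `W`. -/
theorem length_blockers_le {W : List ℕ} (hW : W.Nodup) {u : ℕ} {c : List Bool} :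
    (x.blockers (x.inputs W) u c).length ≤ W.length := by
  have hn : ((x.blockers (x.inputs W) u c).map (inputVertex (x.inputs W))).Nodup := by
    refine List.Nodup.map_on (fun i hi i' hi' h => ?_) (List.nodup_range.filter _)
    obtain ⟨h1, -, h2⟩ := mem_blockers.1 hi
    obtain ⟨h3, -, h4⟩ := mem_blockers.1 hi'
    exact input_injective hW h1 h3 h (h2.trans h4.symm)
  have hsub : ((x.blockers (x.inputs W) u c).map (inputVertex (x.inputs W))) ⊆ W := by
    intro w hw
    obtain ⟨i, hi, rfl⟩ := List.mem_map.1 hw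
    exact (input_mem (mem_blockers.1 hi).1).1
  simpa using (hn.subperm hsub).length_le

/-- The values `v` of the gates represent the coloring `f` of `W`. -/
structure Represents (x : RawInstance) (W : List ℕ) (v : ℕ → Prop) (f : ℕ → List Bool) :
    Prop where
  mem_cols : ∀ w ∈ W, f w ∈ x.cols w
  input_iff : ∀ i < (x.inputs W).length,
    (v i ↔ inputColor (x.inputs W) i = f (inputVertex (x.inputs W) i))
  neg_iff : ∀ i < (x.inputs W).length, (v ((x.inputs W).length + i) ↔ ¬ v i)

theorem Represents.blockers_iff {W : List ℕ} {v : ℕ → Prop} {f : ℕ → List Bool}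
    (h : x.Represents W v f) {u : ℕ} {c : List Bool} :
    (∀ i ∈ x.blockers (x.inputs W) u c, v ((x.inputs W).length + i)) ↔
      ∀ w ∈ W, x.adj u w = true → f w ≠ c := by
  constructor
  · rintro hv w hw huw rfl
    obtain ⟨i, hi, h1, h2⟩ := exists_input hw (h.mem_cols w hw)
    refine (h.neg_iff i hi).1 (hv i (mem_blockers.2 ⟨hi, by rwa [h1], h2⟩)) ?_
    rw [h.input_iff i hi, h1, h2]
  · intro hf i hi
    obtain ⟨h1, h2, h3⟩ := mem_blockers.1 hi
    rw [h.neg_iff i h1, h.input_iff i h1, h3]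
    exact fun he => hf _ (input_mem h1).1 h2 he.symm

theorem nodup_avail (u : ℕ) (env : List (ℕ × List Bool)) : (x.avail u env).Nodup :=
  (nodup_dedupList _).filter _

/-- The coloring `f` takes at most `|W|` values on `W`, and the available colors are pairwise
distinct. -/
theorem exists_avail_of_lt_length {W : List ℕ} (f : ℕ → List Bool) {u : ℕ}
    {env : List (ℕ × List Bool)} (h : W.length < (x.avail u env).length) :
    ∃ c ∈ x.avail u env, ∀ w ∈ W, x.adj u w = true → f w ≠ c := by
  by_contra! hno
  have hsub : x.avail u env ⊆ W.map f := by
    intro c hc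
    obtain ⟨w, hw, -, rfl⟩ := hno c hc
    exact List.mem_map_of_mem hw
  have := ((nodup_avail u env).subperm hsub).length_le
  rw [List.length_map] at this
  omega

theorem mem_roots {j : ℕ} {S : List ℕ} {u v : ℕ} (hu : u ∈ S) :
    v ∈ x.roots j S u ↔ v ∈ compSet (fun a b => x.adj a b = true) {x | x ∈ S} u ∧
      treedepthTest x.adj j (removeElem v (compList x.adj S u)) = true := by
  rw [roots, List.mem_filter, mem_compList hu]

/-- The conjunction ranges over all vertices of `S` instead of one per component; this repeats
conditions but does not change the meaning. Both sides are compared component by component, by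
induction on the treedepth. -/
theorem eval_extensionFormula (hsymm : ∀ u v, x.adj u v = x.adj v u)
    (hirr : ∀ u, x.adj u u = false) {W : List ℕ} (hW : W.Nodup) {v : ℕ → Prop}
    {f : ℕ → List Bool} (h : x.Represents W v f) (hn : 2 ^ (W.length * W.length) ≤ n) {j : ℕ}
    {S : List ℕ} {env : List (ℕ × List Bool)} (hS : treedepthTest x.adj (j + 1) S = true) :
    Formula.Eval v (j + 1) (x.extensionFormula (x.inputs W) W.length n j S env) ↔
      x.Extendable W f {u | u ∈ S} env := by
  rw [extendable_iff_forall_compSet hsymm]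
  have hS' := treedepthTest_iff.1 hS
  induction j generalizing S env with
  | zero =>
    simp only [Formula.Eval, extensionFormula, Formula.clauses_mk, List.mem_flatMap,
      forall_exists_index, and_imp]
    rw [forall_comm]
    refine forall_congr' fun u => ?_
    rw [forall_comm]
    refine forall_congr' fun hu => ?_
    -- Treedepth at most 1: one vertex exhausts the component, so the component is `{u}`.
    have hC : compSet (fun a b => x.adj a b = true) {u | u ∈ S} u \ {u} = ∅ := by
      obtain ⟨r, hr, hr0⟩ := hS' u hu
      have hr0 : _ \ _ = _ := hr0
      rw [Set.sdiff_eq_empty] at hr0 ⊢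
      have hru : u = r := Set.mem_singleton_iff.1 (hr0 (self_mem_compSet _ _ u))
      rwa [← hru] at hr0
    rw [extendable_iff_exists_root hsymm hirr (self_mem_compSet _ _ u), hC]
    have hE : ∀ env, x.Extendable W f ∅ env := fun env => ⟨f, by simp⟩
    simp only [hE, and_true]
    by_cases hle : (x.avail u env).length ≤ W.length
    · have hlen : ∀ l ∈ (x.avail u env).map fun c =>
          (x.blockers (x.inputs W) u c).map fun i => (x.inputs W).length + i,
          l.length ≤ 2 ^ W.length := by
        intro l hl
        obtain ⟨c, -, rfl⟩ := List.mem_map.1 hl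
        rw [List.length_map]
        exact (length_blockers_le hW).trans Nat.lt_two_pow_self.le
      -- The crude bound `2 ^ |W|` on the number of blockers is positive even for empty `W`, and its
      -- power with exponent at most `|W|` is at most `2 ^ (|W| * |W|)`, the number that the
      -- reduction computes.
      have hbs := (boundedSections_eq (n := n) Nat.one_le_two_pow hlen (by
        rw [← pow_mul, List.length_map]
        exact (Nat.pow_le_pow_right (by omega) (Nat.mul_le_mul_left _ hle)).trans hn)).1
      simp only [hle, decide_true, if_true, hbs]
      have := forall_sections_exists (Q := v) (ls := (x.avail u env).map fun c =>
          (x.blockers (x.inputs W) u c).map fun i => (x.inputs W).length + i)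
      simp only [List.mem_map, exists_exists_and_eq_and, forall_exists_index, and_imp,
        forall_apply_eq_imp_iff₂] at this ⊢
      simp only [Formula.gate_lit]
      rw [this]
      simp only [h.blockers_iff]
    · simp only [hle, decide_false, Bool.false_eq_true, if_false, List.not_mem_nil,
        false_imp_iff, implies_true, true_iff]
      exact exists_avail_of_lt_length f (by omega)
  | succ j ih =>
    rw [Formula.Eval, extensionFormula]
    simp only [Formula.clauses_mk, List.mem_map, List.mem_flatMap, forall_exists_index, and_imp,
      forall_apply_eq_imp_iff₂]
    refine forall₂_congr fun u hu => ?_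
    -- Every admissible root gives the same answer, namely extendability to the whole component. The
    -- disjunction over roots only needs that at least one exists, which the treedepth guarantees.
    have key : ∀ r ∈ x.roots (j + 1) S u, ((∃ c ∈ x.avail r env,
        Formula.Eval v (j + 1) (Formula.mk (((x.blockers (x.inputs W) r c).map fun i =>
          [Formula.embed j ((x.inputs W).length + i)]) ++
          Formula.clauses (x.extensionFormula (x.inputs W) W.length n j
            (removeElem r (compList x.adj S u)) ((r, c) :: env)))))
        ↔ x.Extendable W f (compSet (fun a b => x.adj a b = true) {x | x ∈ S} u) env) := by
      intro r hr
      obtain ⟨hrC, hrT⟩ := (mem_roots hu).1 hr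
      rw [extendable_iff_exists_root hsymm hirr hrC]
      refine exists_congr fun c => and_congr_right fun hc => ?_
      have h1 := ih (env := (r, c) :: env) hrT (treedepthTest_iff.1 hrT)
      rw [← extendable_iff_forall_compSet hsymm, setOf_mem_removeElem, setOf_mem_compList hu]
        at h1
      rw [← h.blockers_iff]
      refine Iff.trans ?_ (and_congr_right fun _ => h1)
      simp only [Formula.Eval, Formula.clauses_mk, List.mem_append, or_imp, forall_and,
        List.mem_map, forall_exists_index, and_imp, forall_apply_eq_imp_iff₂, List.mem_singleton,
        exists_eq_left, Formula.eval_embed]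
    obtain ⟨r, hr, hrT⟩ := hS' u hu
    have hrr : r ∈ x.roots (j + 1) S u := (mem_roots hu).2 ⟨hr, treedepthTest_iff.2 (by
      rwa [setOf_mem_removeElem, setOf_mem_compList hu])⟩
    constructor
    · rintro ⟨_, ⟨r', hr', c, hc, rfl⟩, hE⟩
      exact (key r' hr').1 ⟨c, hc, hE⟩
    · intro hE
      obtain ⟨c, hc, hE⟩ := (key r hrr).2 hE
      exact ⟨_, ⟨r, hrr, c, hc, rfl⟩, hE⟩

theorem gatesLT_extensionFormula (j : ℕ) (S : List ℕ) (env : List (ℕ × List Bool)) :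
    Formula.GatesLT (2 * P.length) (j + 1) (x.extensionFormula P k n j S env) := by
  induction j generalizing S env with
  | zero =>
    intro l hl g hg
    obtain ⟨u, -, hl⟩ := List.mem_flatMap.1 hl
    split_ifs at hl with hle
    · obtain ⟨s, hs, rfl⟩ := List.mem_map.1 hl
      obtain ⟨a, ha, rfl⟩ := List.mem_map.1 hg
      obtain ⟨l, hl, hal⟩ := mem_of_mem_boundedSections hs a ha
      obtain ⟨c, -, rfl⟩ := List.mem_map.1 hl
      obtain ⟨i, hi, rfl⟩ := List.mem_map.1 hal
      have := (mem_blockers.1 hi).1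
      change P.length + i < _
      omega
    · simp at hl
  | succ j ih =>
    intro l hl g hg
    obtain ⟨u, -, rfl⟩ := List.mem_map.1 hl
    obtain ⟨r, -, hg⟩ := List.mem_flatMap.1 hg
    obtain ⟨c, -, rfl⟩ := List.mem_map.1 hg
    intro l hl g hg
    rcases List.mem_append.1 hl with hl | hl
    · obtain ⟨i, hi, rfl⟩ := List.mem_map.1 hl
      have := (mem_blockers.1 hi).1
      rw [List.mem_singleton.1 hg, Formula.gatesLT_embed]
      omega
    · exact ih _ _ l hl g hg

theorem gatesLT_coloringFormula (j : ℕ) (W S : List ℕ) :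
    Formula.GatesLT (2 * P.length) (j + 1) (x.coloringFormula P k n j W S) := by
  intro l hl g hg
  rcases List.mem_append.1 hl with hl | hl
  · exact gatesLT_extensionFormula j S [] l hl g hg
  rcases List.mem_append.1 hl with hl | hl
  · obtain ⟨w, -, rfl⟩ := List.mem_map.1 hl
    obtain ⟨i, hi, rfl⟩ := List.mem_map.1 hg
    have := List.mem_range.1 (List.mem_filter.1 hi).1
    rw [Formula.gatesLT_embed]
    omega
  · obtain ⟨i, hi, hl⟩ := List.mem_flatMap.1 hl
    obtain ⟨i', hi', rfl⟩ := List.mem_map.1 hl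
    have h1 := List.mem_range.1 hi
    have h2 := (mem_blockers.1 hi').1
    simp only [List.mem_cons, List.not_mem_nil, or_false] at hg
    rcases hg with rfl | rfl <;> rw [Formula.gatesLT_embed] <;> omega

theorem eval_coloringFormula (hsymm : ∀ u v, x.adj u v = x.adj v u)
    (hirr : ∀ u, x.adj u u = false) {W : List ℕ} (hW : W.Nodup) {v : ℕ → Prop}
    {f : ℕ → List Bool} (h : x.Represents W v f) (hn : 2 ^ (W.length * W.length) ≤ n) {j : ℕ}
    {S : List ℕ} (hS : treedepthTest x.adj (j + 1) S = true) :
    Formula.Eval v (j + 1) (x.coloringFormula (x.inputs W) W.length n j W S) ↔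
      x.Extendable W f {u | u ∈ S} [] ∧
        ∀ u ∈ W, ∀ w ∈ W, x.adj u w = true → f u ≠ f w := by
  rw [← eval_extensionFormula hsymm hirr hW h hn hS]
  have h1 : ∀ w ∈ W, ∃ i < (x.inputs W).length, inputVertex (x.inputs W) i = w ∧ v i := by
    intro w hw
    obtain ⟨i, hi, h1, h2⟩ := exists_input hw (h.mem_cols w hw)
    exact ⟨i, hi, h1, by rw [h.input_iff i hi, h1, h2]⟩
  rw [coloringFormula, Formula.Eval]
  simp only [Formula.clauses_mk, List.mem_append, or_imp, forall_and]
  rw [← Formula.Eval]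
  refine and_congr_right fun _ => ?_
  have h2 : ∀ w ∈ W, ∃ g, (∃ i, (i < (x.inputs W).length ∧ inputVertex (x.inputs W) i = w) ∧
      Formula.embed j i = g) ∧ Formula.Eval v j g := by
    intro w hw
    obtain ⟨i, hi, h3, h4⟩ := h1 w hw
    exact ⟨_, ⟨i, ⟨hi, h3⟩, rfl⟩, Formula.eval_embed.2 h4⟩
  simp only [List.mem_map, List.mem_filter, List.mem_range, decide_eq_true_eq,
    forall_exists_index, and_imp, forall_apply_eq_imp_iff₂, List.mem_flatMap]
  refine (and_iff_right (fun w hw => ?_)).trans ?_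
  · obtain ⟨g, ⟨i, hi, rfl⟩, hg⟩ := h2 w hw
    exact ⟨_, ⟨i, hi, rfl⟩, hg⟩
  have h3 : ∀ (i : ℕ), (∀ i' ∈ x.blockers (x.inputs W) (inputVertex (x.inputs W) i)
      (inputColor (x.inputs W) i), v ((x.inputs W).length + i')) ↔ _ :=
    fun i => h.blockers_iff
  constructor
  · intro hcl u hu w hw huw heq
    obtain ⟨i, hi, h4, h5⟩ := exists_input hu (h.mem_cols u hu)
    obtain ⟨i', hi', h6, h7⟩ := exists_input hw (h.mem_cols w hw)
    have hb : i' ∈ x.blockers (x.inputs W) (inputVertex (x.inputs W) i)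
        (inputColor (x.inputs W) i) :=
      mem_blockers.2 ⟨hi', by rwa [h4, h6], by rw [h7, h5, heq]⟩
    obtain ⟨g, hg, hE⟩ := hcl _ i hi i' hb rfl
    simp only [List.mem_cons, List.not_mem_nil, or_false] at hg
    rcases hg with rfl | rfl
    · rw [Formula.eval_embed, h.neg_iff i hi, h.input_iff i hi, h4, h5] at hE
      exact hE rfl
    · rw [Formula.eval_embed, h.neg_iff i' hi', h.input_iff i' hi', h6, h7] at hE
      exact hE rfl
  · intro hf l i hi i' hi' hl
    subst hl
    obtain ⟨h4, h5, h6⟩ := mem_blockers.1 hi'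
    by_cases hv : v i
    · refine ⟨_, List.mem_cons_of_mem _ List.mem_cons_self, ?_⟩
      rw [Formula.eval_embed, h.neg_iff i' h4, h.input_iff i' h4, h6, (h.input_iff i hi).1 hv]
      exact hf _ (input_mem hi).1 _ (input_mem h4).1 h5
    · refine ⟨_, List.mem_cons_self, ?_⟩
      rw [Formula.eval_embed, h.neg_iff i hi]
      exact hv

/-- No coloring of `W` is presupposed here. Combined with the weight, this is how a satisfying
assignment yields one. -/
theorem exists_input_of_eval {W : List ℕ} {v : ℕ → Prop} {j : ℕ} {S : List ℕ}
    (hE : Formula.Eval v (j + 1) (x.coloringFormula P k n j W S)) {w : ℕ} (hw : w ∈ W) :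
    ∃ i < P.length, inputVertex P i = w ∧ v i := by
  obtain ⟨g, hg, hgE⟩ := hE _ (List.mem_append_right _ (List.mem_append_left _
    (List.mem_map_of_mem hw)))
  obtain ⟨i, hi, rfl⟩ := List.mem_map.1 hg
  rw [Formula.eval_embed] at hgE
  rw [List.mem_filter, List.mem_range] at hi
  exact ⟨i, hi.1, by simpa using hi.2, hgE⟩

end RawInstance

end ParamComplexity

namespace ParamComplexity
open Enc (enc)

/-! ## The formula is computed in polynomial time -/

/-- The summand 1 is for the empty list, whose only section is not truncated. Together with the size
bound on each section this gives the state bound for the fold. -/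
theorem length_boundedSections_le (n : ℕ) (ls : List (List ℕ)) :
    (boundedSections n ls).length ≤ n + 1 := by
  cases ls with
  | nil => simp [boundedSections]
  | cons l ls =>
    change (List.take _ _).length ≤ _
    rw [List.length_take]
    omega

theorem esize_of_mem_boundedSections {n : ℕ} {ls : List (List ℕ)} {s : List ℕ}
    (hs : s ∈ boundedSections n ls) : esize s ≤ esize ls := by
  induction ls generalizing s with
  | nil =>
    have : s = [] := List.mem_singleton.1 hs
    simp [this]
  | cons l ls ih =>
    have hs' := List.mem_of_mem_take hs
    simp only [List.mem_flatMap, List.mem_map] at hs'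
    obtain ⟨t, ht, b, hb, rfl⟩ := hs'
    have h1 := ih ht
    have h2 := esize_le_of_mem hb
    simp only [esize_cons] at *
    omega

namespace PolyTime

variable {γ : Type} [Enc γ]

theorem boundedSections {n : γ → ℕ} {ls : γ → List (List ℕ)} (hn : PolyTime n)
    (hls : PolyTime ls) : PolyTime (fun g => boundedSections (n g) (ls g)) := by
  have e : ∀ n (ls : List (List ℕ)), ls.foldl (fun acc l =>
      (acc.flatMap fun s => l.map fun a => a :: s).take n) [[]] =
      ParamComplexity.boundedSections n ls.reverse := by
    intro n ls
    rw [ParamComplexity.boundedSections, List.foldr_reverse]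
  have h : PolyTime (fun g => (ls g).reverse.foldl (fun acc l =>
      (acc.flatMap fun s => l.map fun a => a :: s).take (n g)) [[]]) := by
    refine foldl (γ := γ) (α := List ℕ) (f := fun g acc l =>
      (acc.flatMap fun s => l.map fun a => a :: s).take (n g)) (l := fun g => (ls g).reverse)
      (S := fun g => (esize (n g) + 1) * (esize (ls g) + 1) + 1) ?_ hls.reverse (const [[]])
      (((hn.size.add (.const 1)).mul (hls.size.add (.const 1))).add (.const 1))
      fun g l₁ l₂ h => ?_
    · refine take (hn.comp PolyTime.id.fst.fst) ?_
      refine flatMap (γ := (γ × List ℕ) × List (List ℕ))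
        (f := fun p s => p.1.2.map fun a => a :: s) ?_ PolyTime.id.snd
      exact map (γ := ((γ × List ℕ) × List (List ℕ)) × List ℕ) (f := fun p a => a :: p.2)
        (PolyTime.id.snd.cons PolyTime.id.fst.snd) PolyTime.id.fst.fst.snd
    · rw [e]
      have hsub : l₁.reverse.Sublist (ls g) := by
        have := congrArg List.reverse h
        rw [List.reverse_reverse, List.reverse_append] at this
        rw [this]
        exact List.sublist_append_right _ _
      refine (esize_le_of_forall (B := esize (ls g)) fun s hs =>
        (esize_of_mem_boundedSections hs).trans (esize_le_of_sublist hsub)).trans ?_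
      gcongr
      refine (length_boundedSections_le _ _).trans ?_
      rw [esize_nat]
      omega
  simpa only [e, List.reverse_reverse] using h

variable {x : γ → RawInstance} {P env : γ → List (ℕ × List Bool)} {k n u i : γ → ℕ}
  {c : γ → List Bool} {S W : γ → List ℕ}

theorem inputs (hx : PolyTime x) (hW : PolyTime W) : PolyTime (fun g => (x g).inputs (W g)) := by
  refine flatMap (f := fun g w => ((x g).cols w).map fun c => (w, c)) ?_ hW
  exact map (γ := γ × ℕ) (f := fun p c => (p.2, c)) (PolyTime.id.fst.snd.pair PolyTime.id.snd)
    (cols (hx.comp PolyTime.id.fst) PolyTime.id.snd)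

theorem inputVertex (hP : PolyTime P) (hi : PolyTime i) :
    PolyTime (fun g => RawInstance.inputVertex (P g) (i g)) :=
  (hP.getD hi (const _)).fst

theorem inputColor (hP : PolyTime P) (hi : PolyTime i) :
    PolyTime (fun g => RawInstance.inputColor (P g) (i g)) :=
  (hP.getD hi (const _)).snd

theorem avail (hx : PolyTime x) (hu : PolyTime u) (henv : PolyTime env) :
    PolyTime (fun g => (x g).avail (u g) (env g)) := by
  refine filter (f := fun g c => !((env g).any fun e => (x g).adj (u g) e.1 && decide (e.2 = c)))
    (not ?_) (cols hx hu)
  exact any (γ := γ × List Bool) (f := fun p e => (x p.1).adj (u p.1) e.1 && decide (e.2 = p.2))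
    ((adj (hx.comp PolyTime.id.fst.fst) (hu.comp PolyTime.id.fst.fst) PolyTime.id.snd.fst).and
      (PolyTime.id.snd.snd.eq PolyTime.id.fst.snd)) (henv.comp PolyTime.id.fst)

theorem blockers (hx : PolyTime x) (hP : PolyTime P) (hu : PolyTime u) (hc : PolyTime c) :
    PolyTime (fun g => (x g).blockers (P g) (u g) (c g)) :=
  filter (f := fun g i => (x g).adj (u g) (RawInstance.inputVertex (P g) i) &&
      decide (RawInstance.inputColor (P g) i = c g))
    ((adj (hx.comp PolyTime.id.fst) (hu.comp PolyTime.id.fst)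
      (inputVertex (hP.comp PolyTime.id.fst) PolyTime.id.snd)).and
      ((inputColor (hP.comp PolyTime.id.fst) PolyTime.id.snd).eq (hc.comp PolyTime.id.fst)))
    hP.length.range

theorem roots (j : ℕ) (hx : PolyTime x) (hS : PolyTime S) (hu : PolyTime u) :
    PolyTime (fun g => (x g).roots j (S g) (u g)) :=
  filter (f := fun g v => ParamComplexity.treedepthTest (x g).adj j
      (ParamComplexity.removeElem v (ParamComplexity.compList (x g).adj (S g) (u g))))
    (treedepthTest j (hx.comp PolyTime.id.fst) (removeElem PolyTime.id.snd
      (compList (hx.comp PolyTime.id.fst) (hS.comp PolyTime.id.fst) (hu.comp PolyTime.id.fst))))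
    (compList hx hS hu)

theorem extensionFormula (j : ℕ) (hx : PolyTime x) (hP : PolyTime P) (hk : PolyTime k)
    (hn : PolyTime n) (hS : PolyTime S) (henv : PolyTime env) :
    PolyTime (fun g => (x g).extensionFormula (P g) (k g) (n g) j (S g) (env g)) := by
  induction j generalizing γ with
  | zero =>
    refine mk (flatMap (f := fun g u =>
      if decide (((x g).avail u (env g)).length ≤ k g) = true then
        (ParamComplexity.boundedSections (n g) (((x g).avail u (env g)).map fun c =>
          ((x g).blockers (P g) u c).map fun i => (P g).length + i)).map fun s =>
            s.map Formula.lit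
      else []) ?_ hS)
    have hav : PolyTime (fun p : γ × ℕ => (x p.1).avail p.2 (env p.1)) :=
      avail (hx.comp PolyTime.id.fst) PolyTime.id.snd (henv.comp PolyTime.id.fst)
    refine ite (hav.length.natLe (hk.comp PolyTime.id.fst)) ?_ (const [])
    refine map (γ := γ × ℕ) (f := fun _ (s : List ℕ) => s.map Formula.lit)
      (map (γ := (γ × ℕ) × List ℕ) (f := fun _ i => Formula.lit i) PolyTime.id.snd.lit
        PolyTime.id.snd) ?_
    refine boundedSections (hn.comp PolyTime.id.fst) ?_
    refine map (γ := γ × ℕ) (f := fun p c => ((x p.1).blockers (P p.1) p.2 c).map fun i =>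
      (P p.1).length + i) ?_ hav
    exact map (γ := (γ × ℕ) × List Bool) (f := fun p i => (P p.1.1).length + i)
      ((hP.comp PolyTime.id.fst.fst.fst).length.natAdd PolyTime.id.snd)
      (blockers (hx.comp PolyTime.id.fst.fst) (hP.comp PolyTime.id.fst.fst) PolyTime.id.fst.snd
        PolyTime.id.snd)
  | succ j ih =>
    refine mk (map (f := fun g u => ((x g).roots (j + 1) (S g) u).flatMap fun v =>
        ((x g).avail v (env g)).map fun c =>
          Formula.mk ((((x g).blockers (P g) v c).map fun i =>
            [Formula.embed j ((P g).length + i)]) ++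
            Formula.clauses ((x g).extensionFormula (P g) (k g) (n g) j
              (ParamComplexity.removeElem v (ParamComplexity.compList (x g).adj (S g) u))
              ((v, c) :: env g)))) ?_ hS)
    refine flatMap (γ := γ × ℕ) (f := fun p v =>
        ((x p.1).avail v (env p.1)).map fun c =>
          Formula.mk ((((x p.1).blockers (P p.1) v c).map fun i =>
            [Formula.embed j ((P p.1).length + i)]) ++
            Formula.clauses ((x p.1).extensionFormula (P p.1) (k p.1) (n p.1) j
              (ParamComplexity.removeElem v (ParamComplexity.compList (x p.1).adj (S p.1) p.2))
              ((v, c) :: env p.1)))) ?_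
      (roots (j + 1) (hx.comp PolyTime.id.fst) (hS.comp PolyTime.id.fst) PolyTime.id.snd)
    refine map (γ := (γ × ℕ) × ℕ) (f := fun p c =>
          Formula.mk ((((x p.1.1).blockers (P p.1.1) p.2 c).map fun i =>
            [Formula.embed j ((P p.1.1).length + i)]) ++
            Formula.clauses ((x p.1.1).extensionFormula (P p.1.1) (k p.1.1) (n p.1.1) j
              (ParamComplexity.removeElem p.2
                (ParamComplexity.compList (x p.1.1).adj (S p.1.1) p.1.2))
              ((p.2, c) :: env p.1.1)))) ?_
      (avail (hx.comp PolyTime.id.fst.fst) PolyTime.id.snd (henv.comp PolyTime.id.fst.fst))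
    have hg : PolyTime (fun p : ((γ × ℕ) × ℕ) × List Bool => p.1.1.1) := PolyTime.id.fst.fst.fst
    refine mk (append ?_ (clauses ?_))
    · refine map (γ := ((γ × ℕ) × ℕ) × List Bool)
        (f := fun p i => [Formula.embed j ((P p.1.1.1).length + i)]) ?_
        (blockers (hx.comp hg) (hP.comp hg) PolyTime.id.fst.snd PolyTime.id.snd)
      exact (embed j ((hP.comp (hg.comp PolyTime.id.fst)).length.natAdd PolyTime.id.snd)).cons
        (const [])
    · exact ih (hx.comp hg) (hP.comp hg) (hk.comp hg) (hn.comp hg)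
        (removeElem PolyTime.id.fst.snd (compList (hx.comp hg) (hS.comp hg)
          PolyTime.id.fst.fst.snd))
        ((PolyTime.id.fst.snd.pair PolyTime.id.snd).cons (henv.comp hg))

theorem coloringFormula (j : ℕ) (hx : PolyTime x) (hP : PolyTime P) (hk : PolyTime k)
    (hn : PolyTime n) (hW : PolyTime W) (hS : PolyTime S) :
    PolyTime (fun g => (x g).coloringFormula (P g) (k g) (n g) j (W g) (S g)) := by
  refine mk (append (clauses (extensionFormula j hx hP hk hn hS (const []))) (append ?_ ?_))
  · refine map (f := fun g w => ((List.range (P g).length).filter fun i =>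
      decide (RawInstance.inputVertex (P g) i = w)).map fun i => Formula.embed j i) ?_ hW
    refine map (γ := γ × ℕ) (f := fun _ i => Formula.embed j i) (embed j PolyTime.id.snd) ?_
    exact filter (γ := γ × ℕ) (f := fun p i => decide (RawInstance.inputVertex (P p.1) i = p.2))
      ((inputVertex (hP.comp PolyTime.id.fst.fst) PolyTime.id.snd).eq PolyTime.id.fst.snd)
      (hP.comp PolyTime.id.fst).length.range
  · refine flatMap (f := fun g i => ((x g).blockers (P g) (RawInstance.inputVertex (P g) i)
      (RawInstance.inputColor (P g) i)).map fun i' =>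
        [Formula.embed j ((P g).length + i), Formula.embed j ((P g).length + i')]) ?_
      hP.length.range
    refine map (γ := γ × ℕ) (f := fun p i' => [Formula.embed j ((P p.1).length + p.2),
      Formula.embed j ((P p.1).length + i')]) ?_
      (blockers (hx.comp PolyTime.id.fst) (hP.comp PolyTime.id.fst)
        (inputVertex (hP.comp PolyTime.id.fst) PolyTime.id.snd)
        (inputColor (hP.comp PolyTime.id.fst) PolyTime.id.snd))
    have hl : PolyTime (fun p : (γ × ℕ) × ℕ => (P p.1.1).length) :=
      (hP.comp PolyTime.id.fst.fst).length
    exact (embed j (hl.natAdd PolyTime.id.fst.snd)).cons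
      ((embed j (hl.natAdd PolyTime.id.snd)).cons (const []))

end PolyTime

/-- The program that appends the number `2 ^ |W| ^ 2`. -/
theorem exists_pad_program : ∃ (p : Prog) (N : (RawInstance × List ℕ) × ℕ → ℕ), PolyBound N ∧
    ∀ g : RawInstance × List ℕ, ∃ t,
      Runs p (enc g) (enc (g, 2 ^ (g.2.length * g.2.length))) t ∧
      t ≤ N (g, 2 ^ (g.2.length * g.2.length)) := by
  -- The concatenation of `|W|` copies of `W` has `|W| ^ 2` entries and serves as the counter of a
  -- loop that doubles the number 1.
  obtain ⟨p, M, hM, hp⟩ : PolyTime (fun g : RawInstance × List ℕ =>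
      (g, (g.2.flatMap fun _ => g.2), 1)) :=
    PolyTime.id.pair ((PolyTime.flatMap (f := fun (g : RawInstance × List ℕ) _ => g.2)
      PolyTime.id.fst.snd PolyTime.id.snd).pair (PolyTime.const 1))
  obtain ⟨q, D, ⟨d, hd⟩, hq⟩ :
      PolyTime (fun r : ((RawInstance × List ℕ) × ℕ) × ℕ => r.2 + r.2) :=
    PolyTime.id.snd.natAdd PolyTime.id.snd
  obtain ⟨r, E, hE, hr⟩ : PolyTime (fun r : (RawInstance × List ℕ) × List ℕ × ℕ => (r.1, r.2.2)) :=
    PolyTime.id.fst.pair PolyTime.id.snd.snd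
  have hL : PolyTime (fun a : (RawInstance × List ℕ) × ℕ => a.1.2.flatMap fun _ => a.1.2) :=
    PolyTime.flatMap (f := fun (a : (RawInstance × List ℕ) × ℕ) _ => a.1.2)
      PolyTime.id.fst.fst.snd PolyTime.id.fst.snd
  have hN : PolyBound (fun a : (RawInstance × List ℕ) × ℕ =>
      M a.1 + (esize (a.1.2.flatMap fun _ => a.1.2) *
        ((esize a + esize (a.1.2.flatMap fun _ => a.1.2) + 3) ^ d +
          20 * (esize a + esize (a.1.2.flatMap fun _ => a.1.2) + esize a.2) + 20) +
        E (a.1, [], a.2) + 1) + 1) := by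
    have h1 : PolyBound (fun a : (RawInstance × List ℕ) × ℕ => esize a) := .size
    have h2 := hL.size
    have h3 : PolyBound (fun a : (RawInstance × List ℕ) × ℕ => esize a.2) := PolyTime.id.snd.size
    have h4 : PolyBound (fun a : (RawInstance × List ℕ) × ℕ => M a.1) :=
      hM.comp PolyTime.id.fst.size
    have h5 : PolyBound (fun a : (RawInstance × List ℕ) × ℕ => E (a.1, [], a.2)) :=
      hE.comp (PolyTime.id.fst.pair ((PolyTime.const []).pair PolyTime.id.snd)).size
    exact (h4.add (((h2.mul (((((h1.add h2).add (.const 3)).pow d).add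
      ((PolyBound.const 20).mul ((h1.add h2).add h3))).add (.const 20))).add h5).add
      (.const 1))).add (.const 1)
  refine ⟨.comp p (.comp (PolyTime.foldProg q) r), _, hN, fun g => ?_⟩
  have hfold : ∀ l : List ℕ, l.foldl (fun s _ => s + s) 1 = 2 ^ l.length := by
    intro l
    induction l using List.reverseRecOn with
    | nil => rfl
    | append_singleton l a ih => rw [List.foldl_append, ih]; simp [pow_succ]; omega
  have hlen : (g.2.flatMap fun _ => g.2).length = g.2.length * g.2.length := by
    simp [List.length_flatMap]
  set B := 2 ^ (g.2.length * g.2.length) with hB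
  have hbound : ∀ l₁ l₂ : List ℕ, (g.2.flatMap fun _ => g.2) = l₁ ++ l₂ →
      l₁.foldl (fun s _ => s + s) 1 ≤ B := by
    intro l₁ l₂ h
    rw [hfold, hB, ← hlen, h, List.length_append]
    exact Nat.pow_le_pow_right (by omega) (by omega)
  obtain ⟨t1, h1, h2⟩ := hp g
  -- The states grow exponentially in the input, so `PolyTime.foldl` does not apply. The final value
  -- bounds all of them, and the time is polynomial in the size of the output.
  obtain ⟨t2, h3, h4⟩ := PolyTime.foldProg_runs (p := q) g (g.2.flatMap fun _ => g.2)
    (fun s _ => s + s) 1 ((esize (g, B) + esize (g.2.flatMap fun _ => g.2) + 3) ^ d) (esize B)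
    (fun l₁ a l₂ h => by
      obtain ⟨t, h1, h2⟩ := hq ((g, a), l₁.foldl (fun s _ => s + s) 1)
      refine ⟨t, h1, h2.trans ((hd _).trans (Nat.pow_le_pow_left ?_ d))⟩
      have h3 := hbound l₁ _ h
      have h4 : esize a < esize (g.2.flatMap fun _ => g.2) := esize_le_of_mem (by simp [h])
      simp only [esize_pair, esize_nat] at *
      omega)
    (fun l₁ l₂ h => by
      have := hbound l₁ l₂ h
      simp only [esize_nat]
      omega)
  rw [hfold, hlen, ← hB] at h3
  obtain ⟨t3, h5, h6⟩ := hr (g, [], B)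
  refine ⟨_, .comp h1 (.comp h3 h5), ?_⟩
  have h7 : ((g.2.flatMap fun _ => g.2).length + 1) *
      ((esize (g, B) + esize (g.2.flatMap fun _ => g.2) + 3) ^ d +
        20 * (esize g + esize (g.2.flatMap fun _ => g.2) + esize B) + 20) ≤
      esize (g.2.flatMap fun _ => g.2) *
      ((esize (g, B) + esize (g.2.flatMap fun _ => g.2) + 3) ^ d +
        20 * (esize (g, B) + esize (g.2.flatMap fun _ => g.2) + esize B) + 20) := by
    refine Nat.mul_le_mul (length_lt_esize _) ?_
    have : esize g ≤ esize (g, B) := by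
      have := esize_pair g B
      omega
    omega
  exact Nat.add_le_add_right (Nat.add_le_add h2
    (Nat.add_le_add_right (Nat.add_le_add (h4.trans h7) h6) 1)) 1

end ParamComplexity

namespace ParamComplexity
open Enc (enc)

/-! ## The circuit of an instance -/

/-- The gates with fixed position: the inputs and their negations. -/
def literalGates (m : ℕ) : List Gate :=
  ((List.range m).map fun _ => Gate.input) ++ (List.range m).map Gate.neg

theorem length_literalGates (m : ℕ) : (literalGates m).length = 2 * m := by
  simp [literalGates]; omega

theorem literalGates_input {m i : ℕ} (hi : i < m) : (literalGates m)[i]? = some .input := by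
  simp [literalGates, List.getElem?_append, hi]

theorem literalGates_neg {m i : ℕ} (hi : i < m) :
    (literalGates m)[m + i]? = some (.neg i) := by
  simp [literalGates, hi]

theorem literalGates_cases {m i : ℕ} {g : Gate} (h : (literalGates m)[i]? = some g) :
    (i < m ∧ g = .input) ∨ ∃ k < m, i = m + k ∧ g = .neg k := by
  obtain ⟨hi, -⟩ := List.getElem?_eq_some_iff.1 h
  rw [length_literalGates] at hi
  rcases lt_or_ge i m with him | him
  · rw [literalGates_input him] at h
    exact .inl ⟨him, (Option.some.inj h).symm⟩
  · obtain ⟨k, rfl⟩ := Nat.exists_eq_add_of_le him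
    have hk : k < m := by omega
    rw [literalGates_neg hk] at h
    exact .inr ⟨k, hk, rfl, (Option.some.inj h).symm⟩

theorem leveled_literalGates (m : ℕ) :
    Leveled (literalGates m) fun i => if i < m then 0 else 1 := by
  intro i g hg
  rcases literalGates_cases hg with ⟨hi, rfl⟩ | ⟨k, hk, rfl, rfl⟩
  · simp [Gate.preds]
  · simp [Gate.preds, hk]
    omega

/-- The gates of a circuit for a formula over `m` inputs and their negations. -/
def formulaGates (m j : ℕ) (f : Formula j) : List Gate × ℕ :=
  ((addFormulas (literalGates m) j [f]).1, (addFormulas (literalGates m) j [f]).2.headD 0)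

/-- One formula yields one result, so the default 0 in `formulaGates` is never used. -/
theorem exists_formulaGates_out (m j : ℕ) (f : Formula j) :
    (addFormulas (literalGates m) j [f]).2 = [(formulaGates m j f).2] := by
  have : (addFormulas (literalGates m) j [f]).2.length = 1 := by
    cases j <;> simp [addFormulas, addGates]
  obtain ⟨a, ha⟩ := List.length_eq_one_iff.1 this
  simp [formulaGates, ha]

theorem exists_leveled_formulaGates {m j : ℕ} {f : Formula j} (hf : f.GatesLT (2 * m)) :
    (formulaGates m j f).2 < (formulaGates m j f).1.length ∧
    ∃ lev, Leveled (formulaGates m j f).1 lev ∧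
      ∀ i < (formulaGates m j f).1.length, lev i ≤ 2 * j + 1 := by
  obtain ⟨h1, h2⟩ := addFormulas_leveled (leveled_literalGates m)
    (fun i _ => by split_ifs <;> omega) j [f] (by simpa [length_literalGates] using hf)
  refine ⟨h1 _ ?_, h2⟩
  rw [exists_formulaGates_out]
  exact List.mem_singleton_self _

/-- The circuit for a formula. -/
def formulaCircuit (m j : ℕ) (f : Formula j) (hf : f.GatesLT (2 * m)) : Circuit where
  gates := (formulaGates m j f).1
  out := (formulaGates m j f).2
  out_lt := (exists_leveled_formulaGates hf).1
  preds_lt := fun i g hg k hk => by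
    obtain ⟨-, lev, h, -⟩ := exists_leveled_formulaGates hf
    exact ((h i g hg).1 k hk).1

theorem formulaCircuit_input {m j : ℕ} {f : Formula j} (hf : f.GatesLT (2 * m)) {i : ℕ} :
    (formulaCircuit m j f hf).gates[i]? = some .input ↔ i < m := by
  constructor
  · intro h
    rcases literalGates_cases (addFormulas_ne_input h) with ⟨hi, -⟩ | ⟨k, -, -, h⟩
    · exact hi
    · simp at h
  · exact fun hi => getElem?_eq_some_of_prefix (addFormulas_prefix _ _ _) (literalGates_input hi)

theorem formulaCircuit_neg {m j : ℕ} {f : Formula j} (hf : f.GatesLT (2 * m)) {v : ℕ → Prop}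
    (hv : (formulaCircuit m j f hf).Consistent v) {i : ℕ} (hi : i < m) : v (m + i) ↔ ¬ v i :=
  hv (m + i) _ (getElem?_eq_some_of_prefix (addFormulas_prefix _ _ _) (literalGates_neg hi))

theorem formulaCircuit_out {m j : ℕ} {f : Formula j} (hf : f.GatesLT (2 * m)) {v : ℕ → Prop}
    (hv : (formulaCircuit m j f hf).Consistent v) :
    v (formulaCircuit m j f hf).out ↔ f.Eval v j := by
  have h := addFormulas_forall₂ (gs := literalGates m) (fs := [f]) hv
  rw [exists_formulaGates_out] at h
  exact (List.forall₂_cons.1 h).1.symm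

/-! ### Correctness of the circuit -/

namespace RawInstance

variable {x : RawInstance}

/-- The circuit is satisfiable if and only if the coloring exists. -/
theorem weightedSat_iff (hsymm : ∀ u v, x.adj u v = x.adj v u)
    (hirr : ∀ u, x.adj u u = false) {W : List ℕ} (hW : W.Nodup) {n j : ℕ}
    (hn : 2 ^ (W.length * W.length) ≤ n)
    {S : List ℕ} (hS : treedepthTest x.adj (j + 1) S = true) :
    (formulaCircuit (x.inputs W).length (j + 1)
      (x.coloringFormula (x.inputs W) W.length n j W S)
      (gatesLT_coloringFormula j W S)).WeightedSat W.length ↔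
      ∃ f : ℕ → List Bool, (∀ w ∈ W, f w ∈ x.cols w) ∧ x.Extendable W f {u | u ∈ S} [] ∧
        ∀ u ∈ W, ∀ w ∈ W, x.adj u w = true → f u ≠ f w := by
  classical
  set P := x.inputs W with hP
  set C := formulaCircuit P.length (j + 1) (x.coloringFormula P W.length n j W S)
    (gatesLT_coloringFormula j W S) with hC
  have hset : ∀ v : ℕ → Prop, {i | C.gates[i]? = some .input ∧ v i} =
      (((Finset.range P.length).filter fun i => v i : Finset ℕ) : Set ℕ) := by
    intro v
    ext i
    simp [hC, formulaCircuit_input]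
  constructor
  · rintro ⟨v, hv, hcard, hout⟩
    rw [hset, Set.ncard_coe_finset] at hcard
    rw [formulaCircuit_out _ hv] at hout
    have hex := fun w hw => exists_input_of_eval hout (w := w) hw
    have himg : ((Finset.range P.length).filter fun i => v i).image (inputVertex P) =
        W.toFinset := by
      ext w
      simp only [Finset.mem_image, Finset.mem_filter, Finset.mem_range, List.mem_toFinset]
      constructor
      · rintro ⟨i, ⟨hi, -⟩, rfl⟩
        exact (input_mem hi).1
      · intro hw
        obtain ⟨i, hi, h1, h2⟩ := hex w hw
        exact ⟨i, ⟨hi, h2⟩, h1⟩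
    -- The `|W|` true inputs are mapped onto the `|W|` vertices of `W`, hence injectively: every
    -- vertex of `W` gets exactly one color.
    have hinj : Set.InjOn (inputVertex P)
        ((Finset.range P.length).filter fun i => v i : Finset ℕ) := by
      rw [← Finset.card_image_iff, himg, hcard, List.toFinset_card_of_nodup hW]
    choose! idx hidx using hex
    have hrep : x.Represents W v fun w => inputColor P (idx w) := by
      refine ⟨fun w hw => ?_, fun i hi => ?_, fun i hi => formulaCircuit_neg _ hv hi⟩
      · obtain ⟨h1, h2, -⟩ := hidx w hw
        have := (input_mem h1).2
        rwa [← hP, h2] at this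
      · have hw := (input_mem hi).1
        obtain ⟨h1, h2, h3⟩ := hidx _ hw
        constructor
        · intro hvi
          have := hinj (by simpa using ⟨hi, hvi⟩) (by simpa using ⟨h1, h3⟩) h2.symm
          exact congrArg (inputColor P) this
        · intro hc
          rw [input_injective hW hi h1 h2.symm hc]
          exact h3
    exact ⟨_, hrep.mem_cols, (eval_coloringFormula hsymm hirr hW hrep hn hS).1 hout⟩
  · rintro ⟨f, hf, hE⟩
    obtain ⟨v, hv, hva⟩ := C.exists_consistent fun i => inputColor P i = f (inputVertex P i)
    have hva' : ∀ i < P.length, (v i ↔ inputColor P i = f (inputVertex P i)) :=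
      fun i hi => hva i ((formulaCircuit_input _).2 hi)
    have hrep : x.Represents W v f :=
      ⟨hf, hva', fun i hi => formulaCircuit_neg _ hv hi⟩
    refine ⟨v, hv, ?_, (formulaCircuit_out _ hv).2
      ((eval_coloringFormula hsymm hirr hW hrep hn hS).2 hE)⟩
    -- The true inputs are the pairs `(w, f w)`, in bijection with `W`.
    rw [hset, Set.ncard_coe_finset, ← List.toFinset_card_of_nodup hW]
    refine Finset.card_nbij (inputVertex P) (fun i hi => ?_) (fun i hi i' hi' h => ?_)
      fun w hw => ?_
    · simp only [Finset.coe_filter, Finset.mem_range, Set.mem_ofPred_eq] at hi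
      exact Finset.mem_coe.2 <| List.mem_toFinset.2 (input_mem hi.1).1
    · simp only [Finset.coe_filter, Finset.mem_range, Set.mem_ofPred_eq] at hi hi'
      refine input_injective hW hi.1 hi'.1 h ?_
      rw [← hP, (hva' i hi.1).1 hi.2, (hva' i' hi'.1).1 hi'.2, h]
    · have hw := List.mem_toFinset.1 (Finset.mem_coe.1 hw)
      obtain ⟨i, hi, h1, h2⟩ := exists_input hw (hf w hw)
      refine ⟨i, ?_, h1⟩
      simp only [Finset.coe_filter, Finset.mem_range, Set.mem_ofPred_eq]
      exact ⟨hi, (hva' i hi).2 (by rw [hP, h1, h2])⟩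

/-- The vertices that are put into the modulator. -/
def modulator (d c : ℕ) (x : RawInstance) : List ℕ :=
  (List.range x.length).filter fun v =>
    decide (v ∈ greedyModulator x.adj d c (List.range x.length))

/-- The vertices outside of a set. -/
def complement (W : List ℕ) (x : RawInstance) : List ℕ :=
  newElems W (List.range x.length)

end RawInstance

/-! ## From instances of List Coloring to raw instances -/

namespace ListColoringInstance

open Classical in
/-- The data of an instance. -/
noncomputable def raw (I : ListColoringInstance) : RawInstance :=
  List.ofFn fun u => (List.ofFn fun v => decide (I.graph.Adj u v), (I.colors u).map Nat.bits)

variable (I : ListColoringInstance)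

/-- The raw instance is the same tree as the given encoding, so programs for raw instances run on it
directly, without a conversion. -/
theorem enc_raw : enc I.raw = I.encode := by
  simp only [enc, raw, encode, List.map_ofFn]
  congr 2
  funext u
  simp only [Function.comp_apply, List.map_ofFn, List.map_map]
  rfl

@[simp] theorem length_raw : I.raw.length = I.n := by simp [raw]

theorem adj_raw {u v : ℕ} : I.raw.adj u v = true ↔
    ∃ (hu : u < I.n) (hv : v < I.n), I.graph.Adj ⟨u, hu⟩ ⟨v, hv⟩ := by
  unfold RawInstance.adj
  by_cases hu : u < I.n
  · by_cases hv : v < I.n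
    · simp [raw, List.getD_eq_getElem?_getD, hu, hv]
    · simp [raw, List.getD_eq_getElem?_getD, hu, hv]
  · simp [List.getD_eq_getElem?_getD, hu]

theorem mem_cols_raw (u : Fin I.n) {c : List Bool} :
    c ∈ I.raw.cols u ↔ ∃ a ∈ I.colors u, a.bits = c := by
  simp [RawInstance.cols, mem_dedupList, raw, List.getD_eq_getElem?_getD]

theorem adj_raw_comm (u v : ℕ) : I.raw.adj u v = I.raw.adj v u := by
  rw [Bool.eq_iff_iff, adj_raw, adj_raw]
  exact ⟨fun ⟨h1, h2, h⟩ => ⟨h2, h1, h.symm⟩, fun ⟨h1, h2, h⟩ => ⟨h2, h1, h.symm⟩⟩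

theorem adj_raw_self (u : ℕ) : I.raw.adj u u = false := by
  rw [Bool.eq_false_iff]
  intro h
  obtain ⟨_, _, h⟩ := I.adj_raw.1 h
  exact I.graph.irrefl h

theorem colorable_iff_raw : I.Colorable ↔ ∃ f : ℕ → List Bool, ∀ u < I.n,
    f u ∈ I.raw.cols u ∧ ∀ v < I.n, I.raw.adj u v = true → f u ≠ f v := by
  constructor
  · rintro ⟨f, h1, h2⟩
    refine ⟨fun u => if hu : u < I.n then (f ⟨u, hu⟩).bits else [], fun u hu => ⟨?_, ?_⟩⟩
    · simp only [hu, dif_pos]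
      exact (I.mem_cols_raw ⟨u, hu⟩).2 ⟨_, h1 _, rfl⟩
    · intro v hv huv
      obtain ⟨_, _, huv⟩ := I.adj_raw.1 huv
      simp only [hu, hv, dif_pos]
      intro h
      refine h2 _ _ huv (Data.ofBinary_injective ?_)
      rw [Data.ofBinary, h, Data.ofBinary]
  · rintro ⟨f, hf⟩
    choose g hg1 hg2 using fun u : Fin I.n => (I.mem_cols_raw u).1 (hf u u.2).1
    refine ⟨g, hg1, fun u v huv h => ?_⟩
    refine (hf u u.2).2 v v.2 (I.adj_raw.2 ⟨u.2, v.2, huv⟩) ?_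
    rw [← hg2, ← hg2, h]

/-- A coloring of the whole graph is split into its restriction to `W`, which the inputs encode, and
an extension to the other vertices, which the formula tests. -/
theorem colorable_iff_extendable (W : List ℕ) (hW : ∀ w ∈ W, w < I.n) :
    I.Colorable ↔ ∃ f : ℕ → List Bool, (∀ w ∈ W, f w ∈ I.raw.cols w) ∧
      I.raw.Extendable W f {u | u ∈ RawInstance.complement W I.raw} [] ∧
        ∀ u ∈ W, ∀ w ∈ W, I.raw.adj u w = true → f u ≠ f w := by
  have hmem : ∀ u, u ∈ RawInstance.complement W I.raw ↔ u < I.n ∧ u ∉ W := by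
    intro u
    simp [RawInstance.complement, newElems]
  rw [colorable_iff_raw]
  constructor
  · rintro ⟨f, hf⟩
    refine ⟨f, fun w hw => (hf w (hW w hw)).1, ⟨f, fun u hu => ?_⟩,
      fun u hu w hw => (hf u (hW u hu)).2 w (hW w hw)⟩
    have hu := ((hmem u).1 hu).1
    refine ⟨(hf u hu).1, fun w hw huw h => (hf u hu).2 w (hW w hw) huw h.symm, by simp,
      fun v hv => (hf u hu).2 v ((hmem v).1 hv).1⟩
  · rintro ⟨f, h1, ⟨g, hg⟩, h2⟩
    refine ⟨fun u => if u ∈ W then f u else g u, fun u hu => ?_⟩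
    by_cases huW : u ∈ W
    · simp only [huW, if_true]
      refine ⟨h1 u huW, fun v hv huv => ?_⟩
      split_ifs with hvW
      · exact h2 u huW v hvW huv
      · exact (hg v ((hmem v).2 ⟨hv, hvW⟩)).2.1 u huW (by rwa [adj_raw_comm])
    · obtain ⟨h3, h4, -, h5⟩ := hg u ((hmem u).2 ⟨hu, huW⟩)
      simp only [huW, if_false]
      refine ⟨h3, fun v hv huv => ?_⟩
      split_ifs with hvW
      · exact (h4 v hvW huv).symm
      · exact h5 v ((hmem v).2 ⟨hv, hvW⟩) huv

theorem length_modulator_le (d c : ℕ) :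
    (RawInstance.modulator d c I.raw).length ≤ c * treedepthModulatorNum I.graph d := by
  classical
  -- The set of all vertices is a modulator, so the infimum in the definition is attained.
  have hne : {k | ∃ W : Set (Fin I.n), IsTreedepthModulator I.graph d W ∧ W.ncard = k}.Nonempty := by
    refine ⟨_, Set.univ, ⟨⟨fun _ => none, ⟨fun a => ⟨a, fun b hb => by simp at hb⟩⟩⟩, ?_, ?_⟩, rfl⟩
    · exact fun u => (u.2 trivial).elim
    · intro p _
      cases p with
      | nil => simp
      | cons a p => exact (a.2 trivial).elim
  obtain ⟨W, hW, hcard⟩ := Nat.sInf_mem hne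
  have hM := hW.setTreedepthLE
  set M : Finset ℕ := W.toFinite.toFinset.image Fin.val with hMdef
  have hMcard : M.card ≤ treedepthModulatorNum I.graph d := by
    refine Finset.card_image_le.trans ?_
    rw [← Set.ncard_eq_toFinset_card]
    exact hcard.le
  have hbound := length_greedyModulator_le (A := I.raw.adj) (d := d) (c := c)
    (V := List.range I.raw.length) M (by
      refine hM.of_subset_image (φ := fun a : ↥Wᶜ => (a.1 : ℕ)) (fun a b hab => ?_) ?_
      · obtain ⟨_, _, h⟩ := I.adj_raw.1 hab
        exact h
      · rintro v ⟨hv, hvM⟩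
        rw [length_raw, List.mem_range] at hv
        refine ⟨⟨⟨v, hv⟩, fun hvW => hvM ?_⟩, trivial, rfl⟩
        exact Finset.mem_image.2 ⟨⟨v, hv⟩, by simpa using hvW, rfl⟩)
  refine le_trans ?_ (hbound.trans (Nat.mul_le_mul_left _ hMcard))
  -- The greedy list may contain repetitions; filtering the range removes them and can only shorten
  -- it.
  refine ((List.nodup_range.filter _).subperm fun v hv => ?_).length_le
  simpa using (List.mem_filter.1 hv).2

end ListColoringInstance

/-! ### The reduction and its running time -/

/-- The encoding of the circuit that the reduction produces. -/
def reductionOutput (j : ℕ) (p : (RawInstance × List ℕ) × ℕ) : (List Gate × ℕ) × ℕ :=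
  (formulaGates (p.1.1.inputs p.1.2).length (j + 1)
    (p.1.1.coloringFormula (p.1.1.inputs p.1.2) p.1.2.length p.2 j p.1.2
      (RawInstance.complement p.1.2 p.1.1)), p.1.2.length)

namespace PolyTime

theorem reductionOutput (j : ℕ) : PolyTime (reductionOutput j) := by
  have hx : PolyTime (fun p : (RawInstance × List ℕ) × ℕ => p.1.1) := PolyTime.id.fst.fst
  have hW : PolyTime (fun p : (RawInstance × List ℕ) × ℕ => p.1.2) := PolyTime.id.fst.snd
  have hP := inputs hx hW
  have hS : PolyTime (fun p : (RawInstance × List ℕ) × ℕ =>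
      RawInstance.complement p.1.2 p.1.1) :=
    filter (f := fun (p : (RawInstance × List ℕ) × ℕ) v => !decide (v ∈ p.1.2))
      (PolyTime.id.snd.mem (hW.comp PolyTime.id.fst)).not hx.length.range
  have hf := coloringFormula j hx hP hW.length PolyTime.id.snd hW hS
  have hg : PolyTime (fun p : (RawInstance × List ℕ) × ℕ =>
      literalGates (p.1.1.inputs p.1.2).length) :=
    (map (f := fun _ _ => Gate.input) (const _) hP.length.range).append
      (map (f := fun _ i => Gate.neg i) PolyTime.id.snd.gateNeg hP.length.range)
  have hr := addFormulas hg (hf.cons (const []))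
  exact (hr.fst.pair (hr.snd.headD (const 0))).pair hW.length

theorem modulator (d c : ℕ) : PolyTime (RawInstance.modulator d c) := by
  have hV : PolyTime (fun x : RawInstance => List.range x.length) := PolyTime.id.length.range
  exact filter (f := fun (x : RawInstance) v =>
      decide (v ∈ ParamComplexity.greedyModulator x.adj d c (List.range x.length)))
    (PolyTime.id.snd.mem ((greedyModulator d c PolyTime.id hV).comp PolyTime.id.fst)) hV

end PolyTime

theorem computable_const_mul_pow (A a B b c : ℕ) :
    Computable fun k : ℕ => A + B * (a * 2 ^ ((b * k) * (b * k))) ^ c := by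
  have hpow : Primrec₂ ((· ^ ·) : ℕ → ℕ → ℕ) := Primrec₂.unpaired'.1 Nat.Primrec.pow
  have hk : Primrec fun k : ℕ => b * k := Primrec.nat_mul.comp (Primrec.const b) Primrec.id
  exact (Primrec.nat_add.comp (Primrec.const A) (Primrec.nat_mul.comp (Primrec.const B)
    (hpow.comp (Primrec.nat_mul.comp (Primrec.const a) (hpow.comp (Primrec.const 2)
      (Primrec.nat_mul.comp hk hk))) (Primrec.const c)))).to_comp

/-- The arithmetic behind the running time of the reduction. -/
theorem time_bound {s q Q t₁ t₂ t₃ e a b c : ℕ} (hs : 1 ≤ s) (hq : q ≤ Q) (hQ : 1 ≤ Q)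
    (h₁ : t₁ ≤ (s + 1) ^ a) (he : e ≤ (s + 1) ^ a) (h₂ : t₂ ≤ (e + 2 * q + 3) ^ b)
    (h₃ : t₃ ≤ (e + 2 * q + 3) ^ c) :
    t₁ + (t₂ + t₃ + 1) + 1 ≤ (2 ^ a + 2 + 2 * (6 * 2 ^ a * Q) ^ (b + c)) * s ^ (a * (b + c) + a) := by
  have h2s : (s + 1) ^ a ≤ 2 ^ a * s ^ a := by
    rw [← mul_pow]; exact Nat.pow_le_pow_left (by omega) a
  have hsa : 1 ≤ s ^ a := Nat.one_le_pow _ _ hs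
  have h2a : 1 ≤ 2 ^ a := Nat.one_le_two_pow
  -- With `M = 2 ^ a * s ^ a * Q` the three summands are at most `M`, `2 * M` and `3 * M`. This
  -- separates the dependence on the parameter, in `Q`, from that on the size `s`.
  have hR : e + 2 * q + 3 ≤ (6 * 2 ^ a * Q) * s ^ a := by
    have h1 : 1 ≤ 2 ^ a * s ^ a := Nat.one_le_iff_ne_zero.2 (by positivity)
    have h2 : 2 ^ a * s ^ a ≤ (2 ^ a * s ^ a) * Q := Nat.le_mul_of_pos_right _ hQ
    have h3 : Q ≤ (2 ^ a * s ^ a) * Q := Nat.le_mul_of_pos_left _ h1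
    calc e + 2 * q + 3 ≤ 6 * ((2 ^ a * s ^ a) * Q) := by omega
      _ = _ := by ring
  have hbc : ∀ m ≤ b + c, (e + 2 * q + 3) ^ m ≤
      (6 * 2 ^ a * Q) ^ (b + c) * s ^ (a * (b + c) + a) := by
    intro m hm
    calc (e + 2 * q + 3) ^ m ≤ (e + 2 * q + 3) ^ (b + c) := Nat.pow_le_pow_right (by omega) hm
      _ ≤ ((6 * 2 ^ a * Q) * s ^ a) ^ (b + c) := Nat.pow_le_pow_left hR _
      _ = (6 * 2 ^ a * Q) ^ (b + c) * s ^ (a * (b + c)) := by rw [mul_pow, ← pow_mul]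
      _ ≤ _ := Nat.mul_le_mul_left _ (Nat.pow_le_pow_right hs (by omega))
  have h4 := h₂.trans (hbc b (by omega))
  have h5 := h₃.trans (hbc c (by omega))
  have h6 : t₁ ≤ 2 ^ a * s ^ (a * (b + c) + a) := (h₁.trans h2s).trans
    (Nat.mul_le_mul_left _ (Nat.pow_le_pow_right hs (by omega)))
  have h7 : 1 ≤ s ^ (a * (b + c) + a) := Nat.one_le_pow _ _ hs
  rw [add_mul, add_mul, mul_assoc 2]
  omega

/-- List Coloring reduces to weighted satisfiability of circuits of weft `2 * (j + 1)`, with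
bounds in terms of the size of a modulator to treedepth at most `j + 1`. -/
theorem exists_reduction (j : ℕ) : ∃ (p : Prog) (f g : ℕ → ℕ) (c : ℕ),
    (Computable f ∧ Monotone f) ∧ (Computable g ∧ Monotone g) ∧
    ∀ I : ListColoringInstance, ∃ (y : WCSInstance (2 * (j + 1)) (2 * (j + 1) + 1)) (n : ℕ),
      Runs p I.encode ((weightedCircuitSat _ _).encode y) n ∧
      n ≤ f (treedepthModulatorNum I.graph (j + 1)) * I.encode.size ^ c ∧
      y.weight ≤ g (treedepthModulatorNum I.graph (j + 1)) ∧
      (I.Colorable ↔ y.circuit.WeightedSat y.weight) := by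
  obtain ⟨K, hK⟩ := exists_bounded_obstruction (V := ℕ) (j + 1)
  obtain ⟨p₁, N₁, ⟨a, ha⟩, h₁⟩ := PolyTime.id.pair (PolyTime.modulator (j + 1) K)
  obtain ⟨p₂, N₂, ⟨b, hb⟩, h₂⟩ := exists_pad_program
  obtain ⟨p₃, N₃, ⟨c, hc⟩, h₃⟩ := PolyTime.reductionOutput j
  -- The three programs compute the modulator, append the padding number, and write the circuit. The
  -- padding is at most `2 ^ ((K * k) * (K * k))` for the optimum `k`, since the modulator has at
  -- most `K * k` vertices.
  refine ⟨.comp p₁ (.comp p₂ p₃),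
    fun k => 2 ^ a + 2 + 2 * (6 * 2 ^ a * 2 ^ ((K * k) * (K * k))) ^ (b + c), fun k => K * k,
    a * (b + c) + a, ⟨computable_const_mul_pow _ _ _ _ _, fun k l hkl => ?_⟩,
    ⟨(Primrec.nat_mul.comp (Primrec.const K) Primrec.id).to_comp,
      fun k l hkl => Nat.mul_le_mul_left _ hkl⟩, fun I => ?_⟩
  · dsimp only
    gcongr
    omega
  set x := I.raw with hx
  set W := x.modulator (j + 1) K with hWdef
  set q := 2 ^ (W.length * W.length) with hq
  have hWlen : W.length ≤ K * treedepthModulatorNum I.graph (j + 1) :=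
    I.length_modulator_le (j + 1) K
  have hWnodup : W.Nodup := List.nodup_range.filter _
  have hWlt : ∀ w ∈ W, w < I.n := fun w hw => by
    simpa [hx] using (List.mem_filter.1 hw).1
  have hS : treedepthTest x.adj (j + 1) (RawInstance.complement W x) = true := by
    rw [treedepthTest_iff]
    refine (treedepth_compl_greedyModulator (V := List.range x.length) (hK _)).mono ?_
    intro v hv
    have hv : v < x.length ∧ v ∉ W := by
      simpa [RawInstance.complement, newElems] using hv
    refine ⟨List.mem_range.2 hv.1, fun h => hv.2 ?_⟩
    exact List.mem_filter.2 ⟨List.mem_range.2 hv.1, by simpa using h⟩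
  have hf := RawInstance.gatesLT_coloringFormula (x := x) (P := x.inputs W) (k := W.length)
    (n := q) j W (RawInstance.complement W x)
  obtain ⟨-, lev, hlev, hle⟩ := exists_leveled_formulaGates hf
  obtain ⟨t₁, h4, h5⟩ := h₁ x
  obtain ⟨t₂, h6, h7⟩ := h₂ (x, W)
  obtain ⟨t₃, h8, h9⟩ := h₃ ((x, W), q)
  refine ⟨⟨formulaCircuit _ _ _ hf, hlev.weftLE hle, hlev.depthLE hle, W.length⟩,
    t₁ + (t₂ + t₃ + 1) + 1, ?_, ?_, hWlen, ?_⟩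
  · rw [← I.enc_raw]
    exact .comp h4 (.comp h6 h8)
  · rw [← I.enc_raw]
    have he : esize ((x, W), q) + 1 = esize (x, W) + 2 * q + 3 := by
      rw [esize_pair (x, W) q, esize_nat]
      omega
    refine time_bound (q := q) (e := esize (x, W)) (one_le_esize x) ?_ Nat.one_le_two_pow
      (h5.trans (ha x)) ((h4.size_le.trans h5).trans (ha x)) ?_ ?_
    · exact Nat.pow_le_pow_right (by omega) (Nat.mul_le_mul hWlen hWlen)
    · exact he ▸ h7.trans (hb _)
    · exact he ▸ h9.trans (hc _)
  · rw [I.colorable_iff_extendable W hWlt]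
    exact (RawInstance.weightedSat_iff I.adj_raw_comm I.adj_raw_self hWnodup le_rfl hS).symm

/-- The bounds on time and weight are monotone, so they remain valid for any parameter that is at
least the size of an optimal modulator; both claims are instances. -/
theorem inW_of_treedepthModulatorNum_le (j : ℕ) (κ : ListColoringInstance → ℕ)
    (hκ : ∀ I, treedepthModulatorNum I.graph (j + 1) ≤ κ I) :
    InW (2 * (j + 1)) (listColoring κ) := by
  obtain ⟨p, f, g, c, ⟨hf, hf'⟩, ⟨hg, hg'⟩, h⟩ := exists_reduction j
  refine ⟨2 * (j + 1) + 1, p, f, g, c, hf, hg, fun I => ?_⟩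
  obtain ⟨y, n, h1, h2, h3, h4⟩ := h I
  exact ⟨y, n, h1, h2.trans (Nat.mul_le_mul_right _ (hf' (hκ I))), h3.trans (hg' (hκ I)), h4⟩

/-- Outside a vertex cover there are no edges, so the forest in which every vertex is a root is an
elimination forest of depth at most 1. -/
theorem treedepthModulatorNum_one_le {n : ℕ} (G : SimpleGraph (Fin n)) :
    treedepthModulatorNum G 1 ≤ G.vertexCoverNum.toNat := by
  obtain ⟨C, hC, hcover⟩ := SimpleGraph.vertexCoverNum_exists G
  refine Nat.sInf_le ⟨C, ⟨⟨fun _ => none, ⟨fun a => ⟨a, fun b hb => by simp at hb⟩⟩⟩, ?_, ?_⟩, ?_⟩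
  · intro u v huv
    rcases hcover huv with h | h
    · exact (u.2 h).elim
    · exact (v.2 h).elim
  · intro p hp
    match p, hp with
    | [], _ => simp
    | [a], _ => simp
    | a :: b :: p, hp => simpa using (List.isChain_cons_cons.1 hp).1
  · rw [← hC]
    rfl

end ParamComplexity

theorem theorem7 :
    ParamComplexity.InW 2 ParamComplexity.listColoringByVertexCover ∧
    ∀ d : ℕ, 1 ≤ d →
      ParamComplexity.InW (2 * d) (ParamComplexity.listColoringByTreedepthModulator d) := by
  refine ⟨ParamComplexity.inW_of_treedepthModulatorNum_le 0 _ fun I =>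
    ParamComplexity.treedepthModulatorNum_one_le I.graph, fun d hd => ?_⟩
  obtain ⟨j, rfl⟩ := Nat.exists_eq_add_of_le' hd
  exact ParamComplexity.inW_of_treedepthModulatorNum_le j _ fun _ => le_rfl
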